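/- Let $(X,\rho)$ be a complete metric space whose metric satisfies $\rho(x,y)\le\max\{\rho(x,z),\rho(y,z)\}$, and let $f:X\to X$ be continuous. *Disks.* A disk is a closed ball of radius $r\ge 0$ or an open ball of radius $r>0$; it is nontrivial if it is an open or closed ball of positive radius. A map $g$ is scaling on a set $U\subseteq X$ if $g(U)$ is a disk and there is $\lambda>0$ with $\rho(g(x),g(y))=\lambda\rho(x,y)$ for all $x,y\in U$. A scaling disk is a disk (possibly trivial) on which $f$ is scaling. *Julia set and singular points.* For $n\ge 1$ let $\mathrm{Fix}^*(f^n)$ be the set of points $x$ with $f^n(x)=x$ such that $U\subsetneq f^n(U)$ for every sufficiently small nontrivial disk $U\ni x$. The points of $\bigcup_{n\ge1}\mathrm{Fix}^*(f^n)$ are the repelling periodic points, and their forward orbits are the repelling cycles. The Julia set $\mathcal J(f)$ is the closure of the grand orbit of the set of repelling periodic points, i.e. of the set of $x$ with $f^n(x)=f^m(y)$ for some $n,m\ge 0$ and some repelling periodic $y$. A point of $\mathcal J(f)$ is singular if $f$ is not scaling on any nontrivial disk containing it; $\mathrm{Sing}(f)$ is the set of singular points. The map $f$ is subhyperbolic if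 $\mathrm{Sing}(f)$ is finite and for each $x\in\mathrm{Sing}(f)$ there is $k>0$ such that $f^k(x)$ is a repelling periodic point. In that case, for $x\in\mathrm{Sing}(f)$, let $\gamma_x$ be the unique repelling cycle contained in the forward orbit of $x$, and put $\Gamma(f)=\{\gamma_x: x\in\mathrm{Sing}(f)\}$. *Normality.* A point $x\in\mathrm{Sing}(f)$ is normal if there are a nontrivial disk $U\ni x$ and a number $0<r\le 1$ such that $U\cap\mathrm{Sing}(f)=\{x\}$, $f(y)\ne f(x)$ for all $y\in U\setminus\{x\}$, and every maximal scaling disk $V$ contained in $U\setminus\{x\}$ satisfies $\operatorname{diam}(V)\ge r\,\rho(x,V)$ and $\operatorname{diam}(f(V))\ge r\,\rho(f(x),f(V))$. *Homogeneous Condition.* For suitable marked points $p_\gamma\in\gamma$ $(\gamma\in\Gamma(f))$, let $\ell_x$ be the least $\ell\ge 0$ with $f^{\ell}(x)=p_{\gamma_x}$, for $x\in \mathrm{Sing}(f)$. There are a function $\varphi:\Gamma(f)\to\mathbb Z_{>0}$ and, for each $x\in\mathrm{Sing}(f)$, a nontrivial disk $V_x\ni x$ and a scaling map $T_x:V_x\to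 X$ with $T_x(x)=x$ such that 1. $f^{\ell_x}\circ T_x=f^{\varphi(\gamma_x)+\ell_x}$ on $V_x$; 2. if $j\ge 1$ and $y:=f^j(x)\in\mathrm{Sing}(f)$, then $f^j(V_x)\subseteq V_y$ and $f^j\circ T_x=T_y\circ f^j$ on $V_x$. **Theorem.** Suppose that $f$ is subhyperbolic, that $\mathcal J(f)$ is compact, that every point of $\mathrm{Sing}(f)$ is normal, and that $f$ satisfies the Homogeneous Condition. Then $\mathrm{Fix}^*(f^n)$ is finite for every $n\ge 1$. Moreover, the formal power series $$\zeta_f(t)=\exp\Bigl(\sum_{m\ge1}\#\mathrm{Fix}^*(f^m)\,\frac{t^m}{m}\Bigr)\in\mathbb{Q}[[t]]$$ equals $P(t)/Q(t)$ for some $P,Q\in\mathbb Z[t]$ with $Q\neq 0$ that are coprime (every common divisor in $\mathbb Z[t]$ is a unit), where $P$ is a (possibly empty) product of cyclotomic polynomials. In fact there are a finite square matrix $B$ with entries in $\{0,1\}$ and finitely many pairwise distinct periodic cycles, of lengths $\ell_1,\dots,\ell_{m_0}$, of the left shift on the subshift of finite type $\Sigma_B=\{(a_i)_{i\ge0}: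 B_{a_ia_{i+1}}=1 \text{ for all } i\}$, such that $$\zeta_f(t)=\frac{\prod_{m=1}^{m_0}(1-t^{\ell_m})}{\det(I-tB)}.$$ -/

import Mathlib

noncomputable section

namespace NonarchDyn

variable {X : Type*} [MetricSpace X]

/-- A nontrivial disk: an open or closed ball of positive radius. -/
def IsNontrivialDisk (U : Set X) : Prop :=
  ∃ (a : X) (r : ℝ), 0 < r ∧ (U = Metric.ball a r ∨ U = Metric.closedBall a r)

/-- A disk: a closed ball of radius `r ≥ 0` or an open ball of radius `r > 0`
(closed balls of radius `0` are the trivial disks). -/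
def IsDisk (U : Set X) : Prop :=
  (∃ (a : X) (r : ℝ), 0 ≤ r ∧ U = Metric.closedBall a r) ∨
    ∃ (a : X) (r : ℝ), 0 < r ∧ U = Metric.ball a r

/-- `g` is a (distance) scaling map on `U`: the image of `U` is a disk and distances on `U` are
multiplied by a positive constant. -/
def IsScalingOn (g : X → X) (U : Set X) : Prop :=
  IsDisk (g '' U) ∧ ∃ c : ℝ, 0 < c ∧ ∀ x ∈ U, ∀ y ∈ U, dist (g x) (g y) = c * dist x y

/-- `U` is a scaling disk for `f` (trivial disks are allowed, and always are scaling disks). -/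
def IsScalingDisk (f : X → X) (U : Set X) : Prop :=
  IsDisk U ∧ IsScalingOn f U

/-- The forward orbit of a point. -/
def forwardOrbit (f : X → X) (x : X) : Set X :=
  {y | ∃ n : ℕ, f^[n] x = y}

/-- The grand orbit of a set. -/
def grandOrbit (f : X → X) (Y : Set X) : Set X :=
  {x | ∃ n m : ℕ, ∃ y ∈ Y, f^[n] x = f^[m] y}

/-- `Fix*(f^n)`: the points `x` with `f^n x = x` (the period `n` need not be minimal) such that
`U ⊊ f^n U` for every sufficiently small nontrivial disk `U` containing `x`. -/
def fixStar (f : X → X) (n : ℕ) : Set X :=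
  {x | f^[n] x = x ∧ ∃ ε : ℝ, 0 < ε ∧
    ∀ U : Set X, IsNontrivialDisk U → x ∈ U → U ⊆ Metric.ball x ε → U ⊂ f^[n] '' U}

/-- The repelling periodic points of `f`. -/
def repellingPoints (f : X → X) : Set X :=
  {x | ∃ n : ℕ, 1 ≤ n ∧ x ∈ fixStar f n}

/-- The Julia set: the closure of the grand orbit of the repelling periodic points. -/
def juliaSet (f : X → X) : Set X :=
  closure (grandOrbit f (repellingPoints f))

/-- The singular points: those points of the Julia set which have no nontrivial disk around them
on which `f` is scaling. -/
def singularSet (f : X → X) : Set X :=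
  {x | x ∈ juliaSet f ∧ ¬ ∃ U : Set X, IsNontrivialDisk U ∧ x ∈ U ∧ IsScalingOn f U}

/-- Subhyperbolicity: there are finitely many singular points, and each of them is mapped to a
repelling periodic point by some iterate `f^k` with `k > 0`. -/
def IsSubhyperbolic (f : X → X) : Prop :=
  (singularSet f).Finite ∧
    ∀ x ∈ singularSet f, ∃ k : ℕ, 0 < k ∧ f^[k] x ∈ repellingPoints f

/-- `V` is a maximal element among the scaling disks for `f` contained in `S`. -/
def IsMaximalScalingDiskIn (f : X → X) (S V : Set X) : Prop :=
  Maximal (fun W : Set X => IsScalingDisk f W ∧ W ⊆ S) V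

/-- A point `x` (meant to be singular) is normal. -/
def IsNormalPoint (f : X → X) (x : X) : Prop :=
  ∃ (U : Set X) (r : ℝ), IsNontrivialDisk U ∧ x ∈ U ∧ 0 < r ∧ r ≤ 1 ∧
    U ∩ singularSet f = {x} ∧
    (∀ y ∈ U \ {x}, f y ≠ f x) ∧
    ∀ V : Set X, IsMaximalScalingDiskIn f (U \ {x}) V →
      r * Metric.infDist x V ≤ Metric.diam V ∧
      r * Metric.infDist (f x) (f '' V) ≤ Metric.diam (f '' V)

/-- `Γ(f)`: the repelling cycles contained in the forward orbit of some singular point. -/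
def singularCycles (f : X → X) : Set (Set X) :=
  {γ | (∃ q ∈ repellingPoints f, γ = forwardOrbit f q) ∧
    ∃ x ∈ singularSet f, γ ⊆ forwardOrbit f x}

/-- The smallest `l ≥ 0` with `f^l x = p`. It is only used for `p` in the forward orbit of `x`. -/
def landingTime (f : X → X) (x p : X) : ℕ :=
  sInf {l : ℕ | f^[l] x = p}

/-- The Homogeneous Condition. Here `p γ` is the marked point of the cycle `γ`; only the
restriction of `T x` to the disk `V x` plays a role. For a singular point `x` of a subhyperbolic
map there is exactly one `γ ∈ Γ(f)` contained in the forward orbit of `x`. -/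
def HomogeneousCondition (f : X → X) : Prop :=
  ∃ (p : singularCycles f → X) (φ : singularCycles f → ℕ) (V : X → Set X) (T : X → X → X),
    (∀ γ : singularCycles f, p γ ∈ (γ : Set X)) ∧ (∀ γ : singularCycles f, 0 < φ γ) ∧
    ∀ x ∈ singularSet f,
      (IsNontrivialDisk (V x) ∧ x ∈ V x ∧ IsScalingOn (T x) (V x) ∧ T x x = x) ∧
      (∀ γ : singularCycles f, (γ : Set X) ⊆ forwardOrbit f x → ∀ z ∈ V x,
        f^[landingTime f x (p γ)] (T x z) = f^[φ γ + landingTime f x (p γ)] z) ∧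
      (∀ j : ℕ, 1 ≤ j → f^[j] x ∈ singularSet f →
        f^[j] '' V x ⊆ V (f^[j] x) ∧ ∀ z ∈ V x, f^[j] (T x z) = T (f^[j] x) (f^[j] z))

/-- The Artin-Mazur zeta function `exp (∑_{m ≥ 1} #Fix*(f^m) t^m / m)`, as a formal power series
(the coefficient with index `0` of the series in the exponent is `0`). -/
def zeta (f : X → X) : PowerSeries ℚ :=
  (PowerSeries.exp ℚ).subst
    (PowerSeries.mk fun m : ℕ => if m = 0 then (0 : ℚ) else ((fixStar f m).ncard : ℚ) / m)

/-- An integral polynomial, as a formal power series over `ℚ`. -/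
def toSeries (P : Polynomial ℤ) : PowerSeries ℚ :=
  ((P.map (Int.castRingHom ℚ) : Polynomial ℚ) : PowerSeries ℚ)

/-- The left shift on one-sided sequences. -/
def shift {S : Type*} (a : ℕ → S) : ℕ → S :=
  fun i => a (i + 1)

/-- The subshift of finite type `Σ_B` with adjacency matrix `B`. -/
def subshift {k : ℕ} (B : Matrix (Fin k) (Fin k) ℤ) : Set (ℕ → Fin k) :=
  {a | ∀ i, B (a i) (a (i + 1)) = 1}

end NonarchDyn

end

set_option linter.unusedSectionVars false

/-! ### Maps scaling a ball. -/

noncomputable section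

namespace NonarchDyn

open Metric

variable {X : Type*} [MetricSpace X]

/-! Scaling says nothing at an isolated point, so the proof works on `coreJulia`, the compact set of
non-isolated points of the Julia set. Its engine is `not_forall_scalesBall_iterate`: no ball around
such a point is scaled by all iterates with bounded constants, because the ball meets the grand
orbit of a repelling cycle, along which the constants grow. Hence the periodic points in `coreJulia`
are exactly the repelling ones, and those of a given period are isolated (`fixStar_eq`,
`finite_fixStar`). This needs periodic points to be nonsingular, the first use of the Homogeneous
Condition (`singularSet_disjoint_repellingPoints`).

Normality says that near a singular point the scaling disks are not too small compared with the
distance to it. It yields a radius function that vanishes exactly on the finite set of forward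
images of singular points and is constant on the balls it defines (`IsTame.exists_isBaseRadius`).
Refined by itineraries, these balls become the cells of a Markov partition of the complement of a
finite set of zeros (`IsTame.exists_isMarkovRadius`). The cells may accumulate at the zeros, but
only finitely many lie outside a neighbourhood `N` of them.

Now induce on the complement of `N`. Let `w a b n` count the first returns of length `n` from the
cell `a` to the cell `b`, and let `W` be the matrix of their generating functions. Returns expand,
so each cylinder returning to its cell contains exactly one periodic point
(`IsMarkovRadius.ncard_fixed_eq`). The renewal equation and Jacobi's formula then give `zeta = 1 /
det (1 - W)` (`exp_subst_mul_det`), once the zeros of the radius are added as finitely many further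
states.

It remains to see that `W` is rational of the right form. Long returns pass close to zeros, and the
maps `T` of the Homogeneous Condition shift exit times from `N` by a constant. So `w a b n` is
eventually periodic in `n` (`IsMarkovRadius.exists_period`). A finite graph realises such numbers by
letting long returns run around loops of length `Φ` (`returnGraph`). Its determinant is `det (1 -
W)` times one factor `1 - X ^ Φ` for each loop (`det_one_sub_returnGraph`). These loops are the
cycles in the numerator, whose factors are products of cyclotomic polynomials up to sign; cancelling
the common ones gives the coprime form. -/

/-- The point `x` is not isolated. -/
def NonIsolated (x : X) : Prop :=
  ∀ ε : ℝ, 0 < ε → ∃ y, y ≠ x ∧ dist y x < ε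

/-- The map `g` multiplies distances on the open ball of radius `ρ` around `x` by `C`, and maps
this ball onto the open ball of radius `C * ρ` around `g x`. -/
def ScalesBall (g : X → X) (x : X) (ρ C : ℝ) : Prop :=
  0 < C ∧ (∀ u ∈ ball x ρ, ∀ v ∈ ball x ρ, dist (g u) (g v) = C * dist u v) ∧
    g '' ball x ρ = ball (g x) (C * ρ)

namespace ScalesBall

variable {g h : X → X} {x y : X} {ρ ρ' C C' : ℝ}

theorem pos (H : ScalesBall g x ρ C) : 0 < C := H.1

theorem dist_eq (H : ScalesBall g x ρ C) {u v : X} (hu : dist u x < ρ) (hv : dist v x < ρ) :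
    dist (g u) (g v) = C * dist u v := H.2.1 u hu v hv

theorem exists_preimage (H : ScalesBall g x ρ C) {w : X} (hw : dist w (g x) < C * ρ) :
    ∃ u, dist u x < ρ ∧ g u = w := by
  have : w ∈ g '' ball x ρ := by rw [H.2.2]; exact hw
  exact this

theorem injOn (H : ScalesBall g x ρ C) {u v : X} (hu : dist u x < ρ) (hv : dist v x < ρ)
    (huv : g u = g v) : u = v := by
  have := H.dist_eq hu hv
  rw [huv, dist_self] at this
  rcases mul_eq_zero.1 this.symm with h0 | h0
  · exact absurd h0 H.pos.ne'
  · exact dist_eq_zero.1 h0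

theorem mk' (hC : 0 < C)
    (h1 : ∀ u v, dist u x < ρ → dist v x < ρ → dist (g u) (g v) = C * dist u v)
    (h2 : ∀ w, dist w (g x) < C * ρ → ∃ u, dist u x < ρ ∧ g u = w) : ScalesBall g x ρ C := by
  refine ⟨hC, fun u hu v hv => h1 u v hu hv, Set.Subset.antisymm ?_ fun w hw => h2 w hw⟩
  rintro _ ⟨u, hu, rfl⟩
  have hu' : dist u x < ρ := hu
  have hρ : 0 < ρ := dist_nonneg.trans_lt hu'
  rw [mem_ball, h1 u x hu' (by simpa using hρ)]
  exact mul_lt_mul_of_pos_left hu' hC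

theorem dist_lt (H : ScalesBall g x ρ C) {u : X} (hu : dist u x < ρ) :
    dist (g u) (g x) < C * ρ := by
  have : g u ∈ g '' ball x ρ := ⟨u, hu, rfl⟩
  rw [H.2.2] at this
  exact this

theorem mono (H : ScalesBall g x ρ C) (hρ : ρ' ≤ ρ) : ScalesBall g x ρ' C := by
  refine mk' H.pos (fun u v hu hv => H.dist_eq (hu.trans_le hρ) (hv.trans_le hρ)) fun w hw => ?_
  have hρ' : 0 < ρ' := pos_of_mul_pos_right (dist_nonneg.trans_lt hw) H.pos.le
  obtain ⟨u, hu, rfl⟩ := H.exists_preimage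
    (hw.trans_le (mul_le_mul_of_nonneg_left hρ H.pos.le))
  refine ⟨u, ?_, rfl⟩
  rw [H.dist_eq hu (by simpa using hρ'.trans_le hρ)] at hw
  exact lt_of_mul_lt_mul_left hw H.pos.le

theorem comp (H : ScalesBall g x ρ C) (H' : ScalesBall h (g x) (C * ρ) C') :
    ScalesBall (h ∘ g) x ρ (C' * C) := by
  refine mk' (mul_pos H'.pos H.pos) (fun u v hu hv => ?_) fun w hw => ?_
  · rw [Function.comp_apply, Function.comp_apply, H'.dist_eq (H.dist_lt hu) (H.dist_lt hv),
      H.dist_eq hu hv, mul_assoc]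
  · rw [mul_assoc] at hw
    obtain ⟨v, hv, rfl⟩ := H'.exists_preimage hw
    obtain ⟨u, hu, rfl⟩ := H.exists_preimage hv
    exact ⟨u, hu, rfl⟩

protected theorem id (x : X) (ρ : ℝ) : ScalesBall (id : X → X) x ρ 1 :=
  mk' one_pos (by simp) (by simp)

/-- At an isolated point a small ball is a single point and every constant would do; this is why
`NonIsolated` is carried along. -/
theorem unique (hx : NonIsolated x) (hρ : 0 < ρ) (hρ' : 0 < ρ')
    (H : ScalesBall g x ρ C) (H' : ScalesBall g x ρ' C') : C = C' := by
  obtain ⟨y, hy, hyx⟩ := hx (min ρ ρ') (lt_min hρ hρ')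
  have h1 := H.dist_eq (hyx.trans_le (min_le_left _ _)) (by simpa using hρ : dist x x < ρ)
  have h2 := H'.dist_eq (hyx.trans_le (min_le_right _ _)) (by simpa using hρ' : dist x x < ρ')
  exact mul_right_cancel₀ (dist_ne_zero.2 hy) (h1.symm.trans h2)

theorem nonIsolated_iff (H : ScalesBall g x ρ C) (hρ : 0 < ρ) :
    NonIsolated x ↔ NonIsolated (g x) := by
  have hxx : dist x x < ρ := by simpa using hρ
  constructor
  · intro hx ε hε
    obtain ⟨y, hy, hyx⟩ := hx (min ρ (ε / C)) (lt_min hρ (div_pos hε H.pos))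
    have hyρ := hyx.trans_le (min_le_left _ _)
    refine ⟨g y, fun h => hy (H.injOn hyρ hxx h), ?_⟩
    rw [H.dist_eq hyρ hxx, mul_comm, ← lt_div_iff₀ H.pos]
    exact hyx.trans_le (min_le_right _ _)
  · intro hx ε hε
    obtain ⟨w, hw, hwx⟩ := hx (min (C * ρ) (C * ε))
      (lt_min (mul_pos H.pos hρ) (mul_pos H.pos hε))
    obtain ⟨u, hu, rfl⟩ := H.exists_preimage (hwx.trans_le (min_le_left _ _))
    refine ⟨u, fun h => hw (by rw [h]), ?_⟩
    have := hwx.trans_le (min_le_right _ _)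
    rw [H.dist_eq hu hxx] at this
    exact lt_of_mul_lt_mul_left this H.pos.le

variable [IsUltrametricDist X]

theorem recenter (H : ScalesBall g x ρ C) (hy : dist y x < ρ) : ScalesBall g y ρ C := by
  have h1 : ball y ρ = ball x ρ := (IsUltrametricDist.ball_eq_of_mem hy).symm
  have h2 : ball (g y) (C * ρ) = ball (g x) (C * ρ) :=
    (IsUltrametricDist.ball_eq_of_mem (H.dist_lt hy)).symm
  refine ⟨H.1, ?_, ?_⟩
  · rw [h1]; exact H.2.1
  · rw [h1, h2]; exact H.2.2

end ScalesBall

/-! ### Ultrametric disks and their diameters. -/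

section Disks

variable [IsUltrametricDist X]

theorem IsDisk.isBounded {U : Set X} (hU : IsDisk U) : Bornology.IsBounded U := by
  rcases hU with ⟨a, r, -, rfl⟩ | ⟨a, r, -, rfl⟩
  · exact isBounded_closedBall
  · exact isBounded_ball

theorem IsNontrivialDisk.isDisk {U : Set X} (hU : IsNontrivialDisk U) : IsDisk U := by
  obtain ⟨a, r, hr, rfl | rfl⟩ := hU
  · exact Or.inr ⟨a, r, hr, rfl⟩
  · exact Or.inl ⟨a, r, hr.le, rfl⟩

theorem IsNontrivialDisk.exists_ball_subset {U : Set X} (hU : IsNontrivialDisk U) {x : X}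
    (hx : x ∈ U) : ∃ ε : ℝ, 0 < ε ∧ ball x ε ⊆ U := by
  obtain ⟨a, r, hr, rfl | rfl⟩ := hU
  · exact ⟨r, hr, (IsUltrametricDist.ball_eq_of_mem hx).ge⟩
  · refine ⟨r, hr, ?_⟩
    rw [IsUltrametricDist.closedBall_eq_of_mem hx]
    exact ball_subset_closedBall

/-- A disk contains every point at least as close to a given point of it as some other point. -/
theorem IsDisk.mem_of_dist_le {U : Set X} (hU : IsDisk U) {x y z : X} (hx : x ∈ U) (hy : y ∈ U)
    (hz : dist z x ≤ dist y x) : z ∈ U := by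
  rcases hU with ⟨a, r, -, rfl⟩ | ⟨a, r, -, rfl⟩
  · rw [IsUltrametricDist.closedBall_eq_of_mem hx] at hy ⊢
    exact hz.trans hy
  · rw [IsUltrametricDist.ball_eq_of_mem hx] at hy ⊢
    exact lt_of_le_of_lt hz hy

/-- The diameter serves as an intrinsic radius: a point outside `U` is farther from `x` than every
point of `U`, hence at distance at least the diameter. -/
theorem IsDisk.ball_diam_subset {U : Set X} (hU : IsDisk U) {x : X} (hx : x ∈ U) :
    ball x (diam U) ⊆ U := by
  intro z hz
  by_contra hzU
  have h1 : ∀ y ∈ U, dist y x < dist z x := fun y hy => by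
    by_contra hcon
    exact hzU (hU.mem_of_dist_le hx hy (not_lt.1 hcon))
  have h2 : diam U ≤ dist z x := by
    refine diam_le_of_forall_dist_le dist_nonneg fun u hu v hv => ?_
    refine (dist_triangle_max u x v).trans (max_le (h1 u hu).le ?_)
    rw [dist_comm]; exact (h1 v hv).le
  exact absurd (mem_ball.1 hz) (not_lt.2 h2)

/-- A disk avoiding `z` has diameter at most the distance of any of its points to `z`. -/
theorem IsDisk.diam_le_of_notMem {U : Set X} (hU : IsDisk U) {x z : X} (hx : x ∈ U)
    (hz : z ∉ U) : diam U ≤ dist x z := by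
  by_contra hcon
  exact hz (hU.ball_diam_subset hx (by rw [mem_ball, dist_comm]; exact not_le.1 hcon))

theorem IsDisk.dist_eq_of_notMem {U : Set X} (hU : IsDisk U) {x y z : X} (hx : x ∈ U)
    (hy : y ∈ U) (hz : z ∉ U) : dist z x = dist z y := by
  have h : dist x y < dist z x := by
    by_contra hcon
    exact hz (hU.mem_of_dist_le hx hy (by rw [dist_comm y x]; exact not_lt.1 hcon))
  have h' : dist x y < dist z y := by
    by_contra hcon
    exact hz (hU.mem_of_dist_le hy hx (not_lt.1 hcon))
  apply le_antisymm
  · refine (dist_triangle_max z y x).trans (max_le le_rfl ?_)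
    rw [dist_comm]; exact h'.le
  · exact (dist_triangle_max z x y).trans (max_le le_rfl h.le)

theorem infDist_eq_of_notMem {U : Set X} (hU : IsDisk U) {x z : X} (hx : x ∈ U)
    (hz : z ∉ U) : infDist z U = dist z x := by
  apply le_antisymm (infDist_le_dist_of_mem hx)
  rw [le_infDist ⟨x, hx⟩]
  intro y hy
  exact (hU.dist_eq_of_notMem hx hy hz).le

theorem diam_image_of_scaling {g : X → X} {U : Set X} {C : ℝ} (hC : 0 < C)
    (hU : Bornology.IsBounded U) (hgU : Bornology.IsBounded (g '' U))
    (h : ∀ x ∈ U, ∀ y ∈ U, dist (g x) (g y) = C * dist x y) :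
    diam (g '' U) = C * diam U := by
  apply le_antisymm
  · refine diam_le_of_forall_dist_le (mul_nonneg hC.le diam_nonneg) ?_
    rintro _ ⟨u, hu, rfl⟩ _ ⟨v, hv, rfl⟩
    rw [h u hu v hv]
    exact mul_le_mul_of_nonneg_left (dist_le_diam_of_mem hU hu hv) hC.le
  · rw [← le_div_iff₀' hC]
    refine diam_le_of_forall_dist_le (div_nonneg diam_nonneg hC.le) fun u hu v hv => ?_
    rw [le_div_iff₀' hC, ← h u hu v hv]
    exact dist_le_diam_of_mem hgU ⟨u, hu, rfl⟩ ⟨v, hv, rfl⟩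

/-- Translates scaling on a disk, open or closed, into scaling of open balls, the only form used
later. -/
theorem scalesBall_of_scaling {g : X → X} {U : Set X} {x : X} {ρ C : ℝ} (hU : IsDisk U)
    (hgU : IsDisk (g '' U)) (hC : 0 < C)
    (h : ∀ x ∈ U, ∀ y ∈ U, dist (g x) (g y) = C * dist x y) (hx : x ∈ U) (hρ : ρ ≤ diam U) :
    ScalesBall g x ρ C := by
  have hsub : ball x ρ ⊆ U := (ball_subset_ball hρ).trans (hU.ball_diam_subset hx)
  refine ScalesBall.mk' hC (fun u v hu hv => h u (hsub hu) v (hsub hv)) fun w hw => ?_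
  have hd := diam_image_of_scaling hC hU.isBounded hgU.isBounded h
  have hw' : w ∈ g '' U := by
    refine hgU.ball_diam_subset ⟨x, hx, rfl⟩ ?_
    rw [hd]
    exact hw.trans_le (mul_le_mul_of_nonneg_left hρ hC.le)
  obtain ⟨u, hu, rfl⟩ := hw'
  rw [h u hu x hx] at hw
  exact ⟨u, lt_of_mul_lt_mul_left hw hC.le, rfl⟩

theorem NonIsolated.diam_pos {U : Set X} (hU : IsNontrivialDisk U) {x : X} (hx : x ∈ U)
    (hni : NonIsolated x) : 0 < diam U := by
  obtain ⟨ε, hε, hsub⟩ := hU.exists_ball_subset hx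
  obtain ⟨y, hy, hyx⟩ := hni ε hε
  exact (dist_pos.2 hy).trans_le (dist_le_diam_of_mem hU.isDisk.isBounded (hsub hyx) hx)

theorem IsScalingOn.exists_scalesBall {g : X → X} {U : Set X} {x : X} (hU : IsNontrivialDisk U)
    (hg : IsScalingOn g U) (hx : x ∈ U) (hni : NonIsolated x) :
    ∃ ρ : ℝ, 0 < ρ ∧ ∃ C, ScalesBall g x ρ C := by
  obtain ⟨hgU, C, hC, h⟩ := hg
  exact ⟨diam U, hni.diam_pos hU hx, C, scalesBall_of_scaling hU.isDisk hgU hC h hx le_rfl⟩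

theorem isNontrivialDisk_ball (x : X) {r : ℝ} (hr : 0 < r) : IsNontrivialDisk (ball x r) :=
  ⟨x, r, hr, Or.inl rfl⟩

theorem ScalesBall.isScalingOn {g : X → X} {x : X} {ρ C : ℝ} (hρ : 0 < ρ)
    (H : ScalesBall g x ρ C) : IsScalingOn g (ball x ρ) :=
  ⟨by rw [H.2.2]; exact (isNontrivialDisk_ball _ (mul_pos H.pos hρ)).isDisk, C, H.1, H.2.1⟩

end Disks

/-! ### The non-isolated part of the Julia set. -/

section Julia

variable {f : X → X}

theorem mem_grandOrbit_iff {A : Set X} (x : X) : x ∈ grandOrbit f A ↔ f x ∈ grandOrbit f A := by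
  constructor
  · rintro ⟨n, m, y, hy, h⟩
    refine ⟨n, m + 1, y, hy, ?_⟩
    rw [← Function.iterate_succ_apply, Function.iterate_succ_apply', h,
      Function.iterate_succ_apply']
  · rintro ⟨n, m, y, hy, h⟩
    exact ⟨n + 1, m, y, hy, by rw [Function.iterate_succ_apply, h]⟩

theorem iterate_mem_grandOrbit_iff {A : Set X} (n : ℕ) (x : X) :
    x ∈ grandOrbit f A ↔ f^[n] x ∈ grandOrbit f A := by
  induction n generalizing x with
  | zero => rfl
  | succ n ih => rw [Function.iterate_succ_apply, ← ih, mem_grandOrbit_iff]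

/-- The points of the Julia set that are not isolated in the ambient space. -/
def coreJulia (f : X → X) : Set X := {x | x ∈ juliaSet f ∧ NonIsolated x}

theorem isClosed_setOf_nonIsolated : IsClosed {x : X | NonIsolated x} := by
  rw [← isOpen_compl_iff, Metric.isOpen_iff]
  intro x hx
  simp only [NonIsolated, Set.mem_compl_iff, Set.mem_ofPred_eq, not_forall, not_exists, not_and,
    not_lt] at hx
  obtain ⟨ε, hε, h⟩ := hx
  refine ⟨ε, hε, fun y hy hni => ?_⟩
  have hyx : y = x := by
    by_contra hne
    exact absurd (mem_ball.1 hy) (not_lt.2 (h y hne))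
  subst hyx
  obtain ⟨z, hz, hzy⟩ := hni ε hε
  exact absurd hzy (not_lt.2 (h z hz))

theorem isCompact_coreJulia (hJ : IsCompact (juliaSet f)) : IsCompact (coreJulia f) :=
  hJ.inter_right isClosed_setOf_nonIsolated

theorem subset_grandOrbit (A : Set X) : A ⊆ grandOrbit f A :=
  fun x hx => ⟨0, 0, x, hx, rfl⟩

variable [IsUltrametricDist X]

/-- The map `g` is kept general so that the result covers both `f` and the maps `T` of the
Homogeneous Condition, which also respect the grand orbit. -/
theorem ScalesBall.mem_coreJulia_iff {g : X → X} {x : X} {ρ C : ℝ} (H : ScalesBall g x ρ C)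
    (hgo : ∀ u, dist u x < ρ →
      (u ∈ grandOrbit f (repellingPoints f) ↔ g u ∈ grandOrbit f (repellingPoints f)))
    {u : X} (hu : dist u x < ρ) : u ∈ coreJulia f ↔ g u ∈ coreJulia f := by
  have hρ : 0 < ρ := dist_nonneg.trans_lt hu
  have Hu := H.recenter hu
  refine and_congr ?_ (Hu.nonIsolated_iff hρ)
  simp only [juliaSet, Metric.mem_closure_iff]
  have huu : dist u u < ρ := by simpa using hρ
  have htr : ∀ {v}, dist v u < ρ → dist v x < ρ := fun {v} hv =>
    (dist_triangle_max v u x).trans_lt (max_lt hv hu)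
  constructor
  · intro h ε hε
    obtain ⟨b, hb, hub⟩ := h (min ρ (ε / C)) (lt_min hρ (div_pos hε H.pos))
    have hbu : dist b u < ρ := by rw [dist_comm]; exact hub.trans_le (min_le_left _ _)
    refine ⟨g b, (hgo b (htr hbu)).1 hb, ?_⟩
    rw [Hu.dist_eq huu hbu, mul_comm, ← lt_div_iff₀ H.pos]
    exact hub.trans_le (min_le_right _ _)
  · intro h ε hε
    obtain ⟨b, hb, hub⟩ := h (min (C * ρ) (C * ε))
      (lt_min (mul_pos H.pos hρ) (mul_pos H.pos hε))
    obtain ⟨v, hv, rfl⟩ := Hu.exists_preimage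
      (by rw [dist_comm]; exact hub.trans_le (min_le_left _ _))
    refine ⟨v, (hgo v (htr hv)).2 hb, ?_⟩
    have := hub.trans_le (min_le_right _ _)
    rw [Hu.dist_eq huu hv] at this
    exact lt_of_mul_lt_mul_left this H.pos.le

theorem ScalesBall.mem_coreJulia_iff_of_self {x : X} {ρ C : ℝ} (H : ScalesBall f x ρ C)
    {u : X} (hu : dist u x < ρ) : u ∈ coreJulia f ↔ f u ∈ coreJulia f :=
  H.mem_coreJulia_iff (fun u _ => mem_grandOrbit_iff u) hu

theorem exists_scalesBall {x : X} (hx : x ∈ coreJulia f) (hs : x ∉ singularSet f) :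
    ∃ ρ : ℝ, 0 < ρ ∧ ∃ C, ScalesBall f x ρ C := by
  have : ∃ U : Set X, IsNontrivialDisk U ∧ x ∈ U ∧ IsScalingOn f U := by
    by_contra hcon
    exact hs ⟨hx.1, hcon⟩
  obtain ⟨U, hU, hxU, hsc⟩ := this
  exact hsc.exists_scalesBall hU hxU hx.2

/-- On a ball reduced to its centre every map is scaling, with a trivial disk as image. -/
theorem singularSet_subset_coreJulia : singularSet f ⊆ coreJulia f := by
  rintro x ⟨hx, hs⟩
  refine ⟨hx, ?_⟩
  by_contra hni
  simp only [NonIsolated, not_forall, not_exists, not_and, not_lt] at hni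
  obtain ⟨ε, hε, h⟩ := hni
  have hb : ball x ε = {x} := by
    ext y
    constructor
    · intro hy
      by_contra hne
      exact absurd (mem_ball.1 hy) (not_lt.2 (h y hne))
    · rintro rfl
      exact mem_ball_self hε
  refine hs ⟨ball x ε, isNontrivialDisk_ball x hε, mem_ball_self hε, ?_, 1, one_pos, ?_⟩
  · rw [hb, Set.image_singleton]
    exact Or.inl ⟨f x, 0, le_rfl, by simp⟩
  · rw [hb]
    rintro u rfl v rfl
    simp

theorem nonIsolated_of_mem_fixStar {n : ℕ} {x : X} (hx : x ∈ fixStar f n) : NonIsolated x := by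
  obtain ⟨hfix, ε, hε, h⟩ := hx
  by_contra hni
  simp only [NonIsolated, not_forall, not_exists, not_and, not_lt] at hni
  obtain ⟨ε', hε', h'⟩ := hni
  have hb : ball x (min ε ε') = {x} := by
    ext y
    constructor
    · intro hy
      by_contra hne
      exact absurd ((mem_ball.1 hy).trans_le (min_le_right _ _)) (not_lt.2 (h' y hne))
    · rintro rfl
      exact mem_ball_self (lt_min hε hε')
  have := h _ (isNontrivialDisk_ball x (lt_min hε hε')) (mem_ball_self (lt_min hε hε'))
    (ball_subset_ball (min_le_left _ _))
  rw [hb, Set.image_singleton, hfix] at this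
  exact this.2 subset_rfl

theorem repellingPoints_subset_coreJulia : repellingPoints f ⊆ coreJulia f := by
  rintro x ⟨n, hn, hx⟩
  exact ⟨subset_closure (subset_grandOrbit _ ⟨n, hn, hx⟩), nonIsolated_of_mem_fixStar hx⟩

theorem map_mem_juliaSet (hf : Continuous f) {x : X} (hx : x ∈ juliaSet f) :
    f x ∈ juliaSet f :=
  map_mem_closure hf hx fun y hy => (mem_grandOrbit_iff y).1 hy

/-- At a singular point the image could become isolated if `f` were locally constant; normality
prevents this, since `f` takes the value `f x` near `x` only at `x`. -/
theorem map_mem_coreJulia (hf : Continuous f)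
    (hnormal : ∀ x ∈ singularSet f, IsNormalPoint f x) {x : X} (hx : x ∈ coreJulia f) :
    f x ∈ coreJulia f := by
  by_cases hs : x ∈ singularSet f
  · refine ⟨map_mem_juliaSet hf hx.1, fun ε hε => ?_⟩
    obtain ⟨U, r, hU, hxU, -, -, -, hne, -⟩ := hnormal x hs
    obtain ⟨δ, hδ, hsub⟩ := hU.exists_ball_subset hxU
    obtain ⟨δ', hδ', hcont⟩ := Metric.continuousAt_iff.1 hf.continuousAt ε hε
    obtain ⟨y, hy, hyx⟩ := hx.2 (min δ δ') (lt_min hδ hδ')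
    exact ⟨f y, hne y ⟨hsub (hyx.trans_le (min_le_left _ _)), hy⟩,
      hcont (hyx.trans_le (min_le_right _ _))⟩
  · obtain ⟨ρ, hρ, C, H⟩ := exists_scalesBall hx hs
    exact (H.mem_coreJulia_iff_of_self (by simpa using hρ)).1 hx

theorem iterate_mem_coreJulia (hf : Continuous f)
    (hnormal : ∀ x ∈ singularSet f, IsNormalPoint f x) {x : X} (hx : x ∈ coreJulia f) (n : ℕ) :
    f^[n] x ∈ coreJulia f := by
  induction n with
  | zero => exact hx
  | succ n ih => rw [Function.iterate_succ_apply']; exact map_mem_coreJulia hf hnormal ih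

end Julia

end NonarchDyn

end
-- Multipliers along orbits and repelling periodic points.
noncomputable section

namespace NonarchDyn

open Metric

variable {X : Type*} [MetricSpace X] {f : X → X}

theorem finite_of_isCompact_of_isolated {K : Set X} (hK : IsCompact K)
    (h : ∀ x ∈ K, ∃ ε : ℝ, 0 < ε ∧ ∀ y ∈ K, dist y x < ε → y = x) : K.Finite := by
  choose! ε hε hiso using h
  obtain ⟨t, htK, hcov⟩ := hK.elim_nhds_subcover (fun x => ball x (ε x))
    fun x hx => ball_mem_nhds x (hε x hx)
  refine t.finite_toSet.subset fun y hy => ?_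
  obtain ⟨x, hx, hyx⟩ := Set.mem_iUnion₂.1 (hcov hy)
  rw [hiso x (htK x hx) y hy hyx]
  exact hx

open Classical in
/-- The local scaling constant of `f` at `x`, or `1` if `f` is not scaling near `x`. -/
def localScale (f : X → X) (x : X) : ℝ :=
  if h : ∃ C ρ : ℝ, 0 < ρ ∧ ScalesBall f x ρ C then h.choose else 1

theorem localScale_pos (f : X → X) (x : X) : 0 < localScale f x := by
  unfold localScale
  split_ifs with h
  · obtain ⟨ρ, -, H⟩ := h.choose_spec
    exact H.pos
  · exact one_pos

theorem ScalesBall.localScale_eq {x : X} {ρ C : ℝ} (H : ScalesBall f x ρ C) (hρ : 0 < ρ)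
    (hx : NonIsolated x) : localScale f x = C := by
  have h : ∃ C ρ : ℝ, 0 < ρ ∧ ScalesBall f x ρ C := ⟨C, ρ, hρ, H⟩
  have h1 : localScale f x = h.choose := dif_pos h
  obtain ⟨ρ', hρ', H'⟩ := h.choose_spec
  rw [h1]
  exact H'.unique hx hρ' hρ H

/-- The product of the local scaling constants of `f` along the first `n` points of an orbit. -/
def iterScale (f : X → X) (n : ℕ) (x : X) : ℝ :=
  ∏ i ∈ Finset.range n, localScale f (f^[i] x)

theorem iterScale_zero (x : X) : iterScale f 0 x = 1 := Finset.prod_range_zero _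

theorem iterScale_succ (n : ℕ) (x : X) :
    iterScale f (n + 1) x = localScale f (f^[n] x) * iterScale f n x := by
  rw [iterScale, Finset.prod_range_succ, mul_comm]; rfl

theorem iterScale_succ' (n : ℕ) (x : X) :
    iterScale f (n + 1) x = iterScale f n (f x) * localScale f x := by
  rw [iterScale, Finset.prod_range_succ']; rfl

theorem iterScale_pos (n : ℕ) (x : X) : 0 < iterScale f n x :=
  Finset.prod_pos fun _ _ => localScale_pos _ _

theorem ScalesBall.iterate_succ {x : X} {ρ C C' : ℝ} {n : ℕ} (H : ScalesBall f^[n] x ρ C)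
    (H' : ScalesBall f (f^[n] x) (C * ρ) C') : ScalesBall f^[n + 1] x ρ (C' * C) := by
  rw [Function.iterate_succ']
  exact H.comp H'

theorem ScalesBall.iterate_add {x : X} {ρ C C' : ℝ} {n m : ℕ} (H : ScalesBall f^[n] x ρ C)
    (H' : ScalesBall f^[m] (f^[n] x) (C * ρ) C') : ScalesBall f^[m + n] x ρ (C' * C) := by
  rw [Function.iterate_add]
  exact H.comp H'

theorem ScalesBall.iterate_mul {x : X} {ρ C : ℝ} {n : ℕ} (H : ScalesBall f^[n] x ρ C)
    (hx : f^[n] x = x) (hC : C ≤ 1) (hρ : 0 < ρ) (k : ℕ) :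
    ScalesBall f^[n * k] x ρ (C ^ k) := by
  induction k with
  | zero => simpa using ScalesBall.id x ρ
  | succ k ih =>
    have hk : f^[n * k] x = x := by
      rw [Function.iterate_mul]; exact Function.iterate_fixed hx k
    have := ih.iterate_add (m := n) (C' := C) (by
      rw [hk]
      exact H.mono (mul_le_of_le_one_left hρ.le (pow_le_one₀ H.pos.le hC)))
    rwa [add_comm, ← Nat.mul_succ, ← pow_succ'] at this

variable [IsUltrametricDist X]

theorem exists_scalesBall_localScale {x : X} (hx : x ∈ coreJulia f) (hs : x ∉ singularSet f) :
    ∃ ρ : ℝ, 0 < ρ ∧ ScalesBall f x ρ (localScale f x) := by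
  obtain ⟨ρ, hρ, C, H⟩ := exists_scalesBall hx hs
  exact ⟨ρ, hρ, by rwa [H.localScale_eq hρ hx.2]⟩

theorem exists_scalesBall_iterate {x : X} (n : ℕ)
    (h : ∀ i < n, f^[i] x ∈ coreJulia f ∧ f^[i] x ∉ singularSet f) :
    ∃ ρ : ℝ, 0 < ρ ∧ ∀ i ≤ n, ScalesBall f^[i] x ρ (iterScale f i x) := by
  induction n with
  | zero =>
    refine ⟨1, one_pos, fun i hi => ?_⟩
    obtain rfl : i = 0 := Nat.le_zero.1 hi
    exact ScalesBall.id x 1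
  | succ n ih =>
    obtain ⟨ρ, hρ, H⟩ := ih fun i hi => h i (hi.trans n.lt_succ_self)
    obtain ⟨ρ', hρ', H'⟩ := exists_scalesBall_localScale (h n n.lt_succ_self).1
      (h n n.lt_succ_self).2
    have hp := iterScale_pos (f := f) n x
    refine ⟨min ρ (ρ' / iterScale f n x), lt_min hρ (div_pos hρ' hp), fun i hi => ?_⟩
    rcases Nat.of_le_succ hi with hi | rfl
    · exact (H i hi).mono (min_le_left _ _)
    · rw [iterScale_succ]
      refine ((H n le_rfl).mono (min_le_left _ _)).iterate_succ (H'.mono ?_)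
      calc _ ≤ iterScale f n x * (ρ' / iterScale f n x) :=
            mul_le_mul_of_nonneg_left (min_le_right _ _) hp.le
        _ = ρ' := mul_div_cancel₀ _ hp.ne'

theorem IsNontrivialDisk.eq_ball_or {U : Set X} (hU : IsNontrivialDisk U) {x : X} (hx : x ∈ U) :
    ∃ r : ℝ, 0 < r ∧ (U = ball x r ∨ U = closedBall x r) := by
  obtain ⟨a, r, hr, rfl | rfl⟩ := hU
  · exact ⟨r, hr, Or.inl (IsUltrametricDist.ball_eq_of_mem hx)⟩
  · exact ⟨r, hr, Or.inr (IsUltrametricDist.closedBall_eq_of_mem hx)⟩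

/-- The preimage under a scaling map of a disk around the image of the centre. -/
theorem ScalesBall.isNontrivialDisk_preimage {g : X → X} {x : X} {ρ C : ℝ}
    (H : ScalesBall g x ρ C) (hρ : 0 < ρ) {U : Set X} (hU : IsNontrivialDisk U) (hx : g x ∈ U) :
    IsNontrivialDisk (ball x ρ ∩ g ⁻¹' U) := by
  have hxx : dist x x < ρ := by simpa using hρ
  obtain ⟨r, hr, rfl | rfl⟩ := hU.eq_ball_or hx
  · refine ⟨x, min ρ (r / C), lt_min hρ (div_pos hr H.pos), Or.inl ?_⟩
    ext y
    simp only [Set.mem_inter_iff, mem_ball, Set.mem_preimage, lt_min_iff]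
    refine and_congr_right fun hy => ?_
    rw [H.dist_eq hy hxx, lt_div_iff₀ H.pos, mul_comm]
  · by_cases hr' : r / C < ρ
    · refine ⟨x, r / C, div_pos hr H.pos, Or.inr ?_⟩
      ext y
      simp only [Set.mem_inter_iff, mem_ball, Set.mem_preimage, mem_closedBall]
      constructor
      · rintro ⟨hy, hy'⟩
        rwa [H.dist_eq hy hxx, mul_comm, ← le_div_iff₀ H.pos] at hy'
      · intro hy
        refine ⟨hy.trans_lt hr', ?_⟩
        rwa [H.dist_eq (hy.trans_lt hr') hxx, mul_comm, ← le_div_iff₀ H.pos]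
    · refine ⟨x, ρ, hρ, Or.inl ?_⟩
      ext y
      simp only [Set.mem_inter_iff, mem_ball, Set.mem_preimage, mem_closedBall,
        and_iff_left_iff_imp]
      intro hy
      rw [H.dist_eq hy hxx, mul_comm, ← le_div_iff₀ H.pos]
      exact hy.le.trans (not_lt.1 hr')

/-- A disk around `f x` is pulled back by the local scaling, expanded there by `f^[n]`, and pushed
forward. Injectivity of `f` near `x` keeps the inclusion strict. -/
theorem map_mem_fixStar (hf : Continuous f) {n : ℕ} {x : X} (hx : x ∈ fixStar f n) {ρ C : ℝ}
    (hρ : 0 < ρ) (H : ScalesBall f x ρ C) : f x ∈ fixStar f n := by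
  obtain ⟨hfix, ε, hε, hU⟩ := hx
  have hcomm : ∀ y, f^[n] (f y) = f (f^[n] y) := fun y => by
    rw [← Function.iterate_succ_apply, Function.iterate_succ_apply']
  obtain ⟨δ₀, hδ₀, hcont⟩ := Metric.continuousAt_iff.1
    ((hf.iterate n).continuousAt (x := x)) ρ hρ
  rw [hfix] at hcont
  set δ := min ρ (min ε δ₀) with hδdef
  have hδ : 0 < δ := lt_min hρ (lt_min hε hδ₀)
  have hδρ : δ ≤ ρ := min_le_left _ _
  have H' := H.mono hδρ
  refine ⟨by rw [hcomm, hfix], C * δ, mul_pos H.pos hδ, fun U hdisk hxU hsub => ?_⟩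
  set V := ball x δ ∩ f ⁻¹' U with hV
  have hVU : f '' V = U := by
    ext w
    constructor
    · rintro ⟨v, hv, rfl⟩; exact hv.2
    · intro hw
      obtain ⟨v, hv, rfl⟩ := H'.exists_preimage (hsub hw)
      exact ⟨v, ⟨hv, hw⟩, rfl⟩
  have hss := hU V (H'.isNontrivialDisk_preimage hδ hdisk hxU) ⟨mem_ball_self hδ, hxU⟩
    (Set.inter_subset_left.trans
      (ball_subset_ball ((min_le_right _ _).trans (min_le_left _ _))))
  have himg : f '' (f^[n] '' V) = f^[n] '' U := by
    rw [← hVU, Set.image_image, Set.image_image]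
    simp only [hcomm]
  refine ⟨?_, fun hcon => hss.2 ?_⟩
  · rw [← himg]; conv_lhs => rw [← hVU]
    exact Set.image_mono hss.1
  · rintro _ ⟨v, hv, rfl⟩
    have hvδ : dist v x < δ := hv.1
    have h1 : dist (f^[n] v) x < ρ :=
      hcont (hvδ.trans_le ((min_le_right _ _).trans (min_le_right _ _)))
    have h2 : f (f^[n] v) ∈ f '' V := by
      rw [hVU, ← hcomm]
      exact hcon ⟨f v, hv.2, rfl⟩
    obtain ⟨v', hv', he⟩ := h2
    have hv'ρ : dist v' x < ρ := (mem_ball.1 hv'.1).trans_le hδρ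
    rw [← H.injOn hv'ρ h1 he]
    exact hv'

/-- On a singular repelling cycle the map `T` would coincide near `x` with an iterate `f^[φ]` that
preserves a bounded set and multiplies distances to `x` by a constant `c`. Both `c ≤ 1` and `1 < c`
are absurd for a repelling point. -/
theorem singularSet_disjoint_repellingPoints (hhom : HomogeneousCondition f) {x : X}
    (hx : x ∈ singularSet f) : x ∉ repellingPoints f := by
  rintro hrep
  obtain ⟨n, hn, hfix, ε, hε, hU⟩ := id hrep
  obtain ⟨p, φ, V, T, -, hφ, hmain⟩ := hhom
  obtain ⟨⟨hVd, hxV, ⟨-, c, hc, hT⟩, hTx⟩, h1, h2⟩ := hmain x hx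
  have hγ : forwardOrbit f x ∈ singularCycles f := ⟨⟨x, hrep, rfl⟩, x, hx, subset_rfl⟩
  have h1 := h1 ⟨_, hγ⟩ subset_rfl
  have hφ := hφ ⟨_, hγ⟩
  generalize φ ⟨_, hγ⟩ = φ at h1 hφ
  generalize landingTime f x _ = l at h1
  have hmul : ∀ k, f^[n * k] x = x := fun k => by
    rw [Function.iterate_mul]; exact Function.iterate_fixed hfix k
  have hφx : f^[φ] x = x := by
    have e := h1 x hxV
    rw [hTx] at e
    have hle : l ≤ n * l := Nat.le_mul_of_pos_left l hn
    have e' := congrArg f^[n * l - l] e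
    rw [← Function.iterate_add_apply, ← Function.iterate_add_apply, Nat.sub_add_cancel hle,
      show n * l - l + (φ + l) = φ + n * l by omega, Function.iterate_add_apply, hmul] at e'
    exact e'.symm
  -- A positive multiple of the period that is at least `l`: the second part of the condition
  -- applies with `j = N`, and `f^[l] ∘ T` can be continued to `f^[N] ∘ T`.
  set N := n * (l + 1) with hN
  have hlN : l ≤ N := by nlinarith
  have hN1 : 1 ≤ N := Nat.mul_pos hn l.succ_pos
  have hNx : f^[N] x = x := hmul _
  have hNV : ∀ z ∈ V x, f^[N] z ∈ V x ∧ f^[N] (T x z) = T x (f^[N] z) := fun z hz => by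
    obtain ⟨ha, hb⟩ := h2 N hN1 (by rwa [hNx])
    rw [hNx] at ha hb
    exact ⟨ha ⟨z, hz, rfl⟩, hb z hz⟩
  have hφV : ∀ z ∈ V x, f^[φ] z ∈ V x := fun z hz => by
    obtain ⟨ha, -⟩ := h2 φ hφ (by rwa [hφx])
    rw [hφx] at ha
    exact ha ⟨z, hz, rfl⟩
  set W := f^[N] '' V x with hW
  have hWV : W ⊆ V x := by rintro _ ⟨z, hz, rfl⟩; exact (hNV z hz).1
  have hTW : ∀ w ∈ W, T x w = f^[φ] w := by
    rintro _ ⟨z, hz, rfl⟩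
    rw [← (hNV z hz).2]
    have e' := congrArg f^[N - l] (h1 z hz)
    rwa [← Function.iterate_add_apply, ← Function.iterate_add_apply, Nat.sub_add_cancel hlN,
      show N - l + (φ + l) = φ + N by omega, Function.iterate_add_apply] at e'
  have hfW : ∀ w ∈ W, f^[φ] w ∈ W := by
    rintro _ ⟨z, hz, rfl⟩
    refine ⟨f^[φ] z, hφV z hz, ?_⟩
    rw [← Function.iterate_add_apply, ← Function.iterate_add_apply, add_comm]
  have hfWi : ∀ i, ∀ w ∈ W, f^[φ * i] w ∈ W ∧ dist (f^[φ * i] w) x = c ^ i * dist w x := by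
    intro i
    induction i with
    | zero => intro w hw; simpa using hw
    | succ i ih =>
      intro w hw
      obtain ⟨ih1, ih2⟩ := ih w hw
      rw [Nat.mul_succ, add_comm, Function.iterate_add_apply]
      refine ⟨hfW _ ih1, ?_⟩
      rw [← hTW _ ih1, pow_succ', mul_assoc, ← ih2]
      have := hT _ (hWV ih1) _ hxV
      rwa [hTx] at this
  obtain ⟨ε₀, hε₀, hsub₀⟩ := hVd.exists_ball_subset hxV
  set U := ball x (min ε ε₀) with hUdef
  have hpos : 0 < min ε ε₀ := lt_min hε hε₀
  have hUss := hU U (isNontrivialDisk_ball x hpos) (mem_ball_self hpos)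
    (ball_subset_ball (min_le_left _ _))
  have hUk : ∀ k, f^[n * k] '' U ⊆ f^[n * (k + 1)] '' U := fun k => by
    rw [Nat.mul_succ, Function.iterate_add, Set.image_comp]
    exact Set.image_mono hUss.1
  have hUmono : Monotone fun k => f^[n * k] '' U := monotone_nat_of_le_succ hUk
  -- Repulsion puts small disks inside the image `W`, where `T = f^[φ]` is available.
  have hU0 : U ⊆ W := by
    have h0 : U ⊆ f^[N] '' U := by simpa using hUmono (Nat.zero_le (l + 1))
    exact h0.trans (Set.image_mono ((ball_subset_ball (min_le_right _ _)).trans hsub₀))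
  -- If `c ≤ 1`, then `f^[φ * n]` maps `U` into itself although its image contains `f^[n] '' U`. If
  -- `1 < c`, iterates of a point `u ≠ x` leave the bounded set `V x`.
  rcases le_or_gt c 1 with hc1 | hc1
  · apply hUss.2
    have h3 : f^[n] '' U ⊆ f^[φ * n] '' U := by
      have := hUmono (show 1 ≤ φ from hφ)
      simpa [mul_comm] using this
    refine h3.trans ?_
    rintro _ ⟨u, hu, rfl⟩
    rw [hUdef, mem_ball, (hfWi n u (hU0 hu)).2]
    exact (mul_le_of_le_one_left dist_nonneg (pow_le_one₀ hc.le hc1)).trans_lt hu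
  · obtain ⟨u, hu, hux⟩ := nonIsolated_of_mem_fixStar (f := f) (n := n) ⟨hfix, ε, hε, hU⟩ _ hpos
    have hbdd := hVd.isDisk.isBounded
    have hd : 0 < dist u x := dist_pos.2 hu
    obtain ⟨i, hi⟩ := pow_unbounded_of_one_lt (diam (V x) / dist u x) hc1
    obtain ⟨h3, h4⟩ := hfWi i u (hU0 hux)
    have h5 := dist_le_diam_of_mem hbdd (hWV h3) hxV
    rw [h4] at h5
    rw [div_lt_iff₀ hd] at hi
    exact absurd h5 (not_le.2 hi)

theorem iterate_repelling (hf : Continuous f)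
    (hreg : ∀ x ∈ singularSet f, x ∉ repellingPoints f) {q : X} {n : ℕ} (hn : 1 ≤ n)
    (hq : q ∈ fixStar f n) (i : ℕ) :
    f^[i] q ∈ fixStar f n ∧ f^[i] q ∈ coreJulia f ∧ f^[i] q ∉ singularSet f := by
  have key : ∀ y, y ∈ fixStar f n → y ∈ coreJulia f ∧ y ∉ singularSet f := fun y hy =>
    ⟨repellingPoints_subset_coreJulia ⟨n, hn, hy⟩, fun hs => hreg y hs ⟨n, hn, hy⟩⟩
  have : f^[i] q ∈ fixStar f n := by
    induction i with
    | zero => exact hq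
    | succ i ih =>
      rw [Function.iterate_succ_apply']
      obtain ⟨ρ, hρ, C, H⟩ := exists_scalesBall (key _ ih).1 (key _ ih).2
      exact map_mem_fixStar hf ih hρ H
  exact ⟨this, key _ this⟩

theorem one_lt_of_mem_fixStar {n : ℕ} {q : X} (hq : q ∈ fixStar f n) {ρ C : ℝ} (hρ : 0 < ρ)
    (H : ScalesBall f^[n] q ρ C) : 1 < C := by
  obtain ⟨hfix, ε, hε, hU⟩ := hq
  by_contra hC
  have hpos : 0 < min ε ρ := lt_min hε hρ
  have hss := hU _ (isNontrivialDisk_ball q hpos) (mem_ball_self hpos)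
    (ball_subset_ball (min_le_left _ _))
  apply hss.2
  rw [(H.mono (min_le_right ε ρ)).2.2, hfix]
  exact ball_subset_ball (mul_le_of_le_one_left hpos.le (not_lt.1 hC))

theorem mem_fixStar_of_scalesBall {n : ℕ} {x : X} (hx : NonIsolated x) (hfix : f^[n] x = x)
    {ρ C : ℝ} (hρ : 0 < ρ) (H : ScalesBall f^[n] x ρ C) (hC : 1 < C) : x ∈ fixStar f n := by
  refine ⟨hfix, ρ, hρ, fun U hU hxU hsub => ?_⟩
  have hxx : dist x x < ρ := by simpa using hρ
  have hdist : ∀ v, dist v x < ρ → dist (f^[n] v) x = C * dist v x := fun v hv => by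
    have := H.dist_eq hv hxx
    rwa [hfix] at this
  refine ⟨fun u hu => ?_, fun hcon => ?_⟩
  · have hu' : dist u x < ρ := hsub hu
    obtain ⟨v, hv, rfl⟩ := H.exists_preimage (w := u) (by
      rw [hfix]; exact hu'.trans (lt_mul_of_one_lt_left hρ hC))
    refine ⟨v, hU.isDisk.mem_of_dist_le hxU hu ?_, rfl⟩
    rw [hdist v hv]
    exact le_mul_of_one_le_left dist_nonneg hC.le
  · obtain ⟨ε, hε, hball⟩ := hU.exists_ball_subset hxU
    obtain ⟨u, hu, hux⟩ := hx ε hε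
    have hi : ∀ i : ℕ, (f^[n])^[i] u ∈ U ∧ dist ((f^[n])^[i] u) x = C ^ i * dist u x := by
      intro i
      induction i with
      | zero => simpa using hball hux
      | succ i ih =>
        rw [Function.iterate_succ_apply']
        refine ⟨hcon ⟨_, ih.1, rfl⟩, ?_⟩
        rw [hdist _ (hsub ih.1), ih.2, pow_succ', mul_assoc]
    have hd : 0 < dist u x := dist_pos.2 hu
    obtain ⟨i, hlt⟩ := pow_unbounded_of_one_lt (ρ / dist u x) hC
    rw [div_lt_iff₀ hd, ← (hi i).2] at hlt
    exact absurd (mem_ball.1 (hsub (hi i).1)) (not_lt.2 hlt.le)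

/-- A ball around a point of the Julia set cannot be scaled by all iterates of the map with
bounded constants. -/
theorem not_forall_scalesBall_iterate (hf : Continuous f)
    (hreg : ∀ x ∈ singularSet f, x ∉ repellingPoints f) {x : X} (hx : x ∈ coreJulia f) {ρ M : ℝ}
    (hρ : 0 < ρ) (H : ∀ n, ∃ C ≤ M, ScalesBall f^[n] x ρ C) : False := by
  -- Density of the grand orbit gives a point `g` of the ball that lands on a repelling cycle.
  obtain ⟨g, ⟨k, j, y, ⟨n, hn, hy⟩, hg⟩, hgx⟩ := Metric.mem_closure_iff.1 hx.1 ρ hρ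
  rw [dist_comm] at hgx
  have horb := fun i => iterate_repelling hf hreg hn hy (i + j)
  set q := f^[j] y with hq
  have horb : ∀ i, f^[i] q ∈ fixStar f n ∧ f^[i] q ∈ coreJulia f ∧ f^[i] q ∉ singularSet f :=
    fun i => by have := horb i; rwa [Function.iterate_add_apply] at this
  have hqn : f^[n] q = q := (horb 0).1.1
  obtain ⟨Ck, -, Hk⟩ := H k
  have Hg := Hk.recenter hgx
  have hgni : NonIsolated g := by
    rw [Hg.nonIsolated_iff hρ, hg]
    exact nonIsolated_of_mem_fixStar (horb 0).1
  obtain ⟨ρ₁, hρ₁, H₁⟩ := exists_scalesBall_iterate (f := f) (x := q) n fun i _ => (horb i).2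
  set lam := iterScale f n q
  have hlam : 1 < lam := one_lt_of_mem_fixStar (horb 0).1 hρ₁ (H₁ n le_rfl)
  have Hi : ∀ i : ℕ, ∃ r, 0 < r ∧ ScalesBall f^[n * i] q r (lam ^ i) := by
    intro i
    induction i with
    | zero => exact ⟨1, one_pos, by simpa using ScalesBall.id q 1⟩
    | succ i ih =>
      obtain ⟨r, hr, hi⟩ := ih
      have hp : 0 < lam ^ i := hi.pos
      have hqi : f^[n * i] q = q := by
        rw [Function.iterate_mul]; exact Function.iterate_fixed hqn i
      refine ⟨min r (ρ₁ / lam ^ i), lt_min hr (div_pos hρ₁ hp), ?_⟩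
      have := (hi.mono (min_le_left r (ρ₁ / lam ^ i))).iterate_add (m := n) (C' := lam) (by
        rw [hqi]
        refine (H₁ n le_rfl).mono ?_
        calc _ ≤ lam ^ i * (ρ₁ / lam ^ i) :=
              mul_le_mul_of_nonneg_left (min_le_right _ _) hp.le
          _ = ρ₁ := mul_div_cancel₀ _ hp.ne')
      rwa [add_comm, ← Nat.mul_succ, ← pow_succ'] at this
  -- Going from `g` to the cycle and `i` times around it has the constant `lam ^ i * Ck`, which
  -- exceeds `M` for this `i`. By uniqueness it is also the constant of `f^[n * i + k]` on the whole
  -- ball.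
  obtain ⟨i, hlt⟩ := pow_unbounded_of_one_lt (M / Ck) hlam
  obtain ⟨C', hC', H'⟩ := H (n * i + k)
  obtain ⟨r, hr, hir⟩ := Hi i
  have hcomp : ScalesBall f^[n * i + k] g (min ρ (r / Ck)) (lam ^ i * Ck) := by
    refine (Hg.mono (min_le_left _ _)).iterate_add ?_
    rw [hg]
    refine hir.mono ?_
    calc _ ≤ Ck * (r / Ck) := mul_le_mul_of_nonneg_left (min_le_right _ _) Hg.pos.le
      _ = r := mul_div_cancel₀ _ Hg.pos.ne'
  have heq := (H'.recenter hgx).unique hgni hρ (lt_min hρ (div_pos hr Hg.pos)) hcomp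
  rw [div_lt_iff₀ Hg.pos, ← heq] at hlt
  exact absurd hC' (not_le.2 hlt)

section Periodic

variable (hf : Continuous f) (hreg : ∀ x ∈ singularSet f, x ∉ repellingPoints f)
  (hsub : IsSubhyperbolic f) (hnormal : ∀ x ∈ singularSet f, IsNormalPoint f x)

include hf hreg hsub in
-- A periodic point that lands on a repelling cycle lies on it, and those cycles contain no singular
-- points.
theorem periodic_notMem_singularSet {x : X} {m : ℕ} (hm : 1 ≤ m) (hx : f^[m] x = x) :
    x ∉ singularSet f := by
  intro hs
  obtain ⟨k, -, n, hn, hk⟩ := hsub.2 x hs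
  have hmk : f^[m * k] x = x := by
    rw [Function.iterate_mul]; exact Function.iterate_fixed hx k
  have h2 := (iterate_repelling hf hreg hn hk (m * k - k)).2.2
  rw [← Function.iterate_add_apply, Nat.sub_add_cancel (Nat.le_mul_of_pos_left k hm), hmk] at h2
  exact h2 hs

include hf hreg hsub hnormal in
-- Were the multiplier at most `1`, a fixed ball would be scaled by all iterates, with constants
-- bounded by those of the first period.
theorem one_lt_iterScale_of_periodic {x : X} (hx : x ∈ coreJulia f) {m : ℕ} (hm : 1 ≤ m)
    (hfix : f^[m] x = x) :
    ∃ ρ : ℝ, 0 < ρ ∧ ScalesBall f^[m] x ρ (iterScale f m x) ∧ 1 < iterScale f m x := by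
  have hper : ∀ i, f^[m] (f^[i] x) = f^[i] x := fun i => by
    rw [← Function.iterate_add_apply, add_comm, Function.iterate_add_apply, hfix]
  obtain ⟨ρ, hρ, H⟩ := exists_scalesBall_iterate (f := f) (x := x) m fun i _ =>
    ⟨iterate_mem_coreJulia hf hnormal hx i,
      periodic_notMem_singularSet hf hreg hsub hm (hper i)⟩
  refine ⟨ρ, hρ, H m le_rfl, ?_⟩
  by_contra hC
  have hC := not_lt.1 hC
  refine not_forall_scalesBall_iterate hf hreg hx hρ
    (M := ∑ i ∈ Finset.range (m + 1), iterScale f i x) fun n => ?_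
  have hmod : n % m ≤ m := (Nat.mod_lt n hm).le
  have h1 := (H m le_rfl).iterate_mul hfix hC hρ (n / m)
  have hL := pow_le_one₀ (n := n / m) (iterScale_pos m x).le hC
  have h2 := h1.iterate_add (m := n % m) (C' := iterScale f (n % m) x) (by
    rw [Function.iterate_mul, Function.iterate_fixed hfix]
    exact (H _ hmod).mono (mul_le_of_le_one_left hρ.le hL))
  rw [Nat.mod_add_div] at h2
  refine ⟨_, ?_, h2⟩
  calc _ ≤ iterScale f (n % m) x := mul_le_of_le_one_right (iterScale_pos _ x).le hL
    _ ≤ _ := Finset.single_le_sum (f := fun i => iterScale f i x)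
      (fun i _ => (iterScale_pos i x).le) (Finset.mem_range.2 (Nat.lt_succ_of_le hmod))

include hf hreg hsub hnormal in
/-- All periodic points in the Julia set that are not isolated in the space are repelling. -/
theorem fixStar_eq {m : ℕ} (hm : 1 ≤ m) : fixStar f m = {x | x ∈ coreJulia f ∧ f^[m] x = x} := by
  ext x
  constructor
  · intro hx
    exact ⟨repellingPoints_subset_coreJulia ⟨m, hm, hx⟩, hx.1⟩
  · rintro ⟨hx, hfix⟩
    obtain ⟨ρ, hρ, H, h1⟩ := one_lt_iterScale_of_periodic hf hreg hsub hnormal hx hm hfix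
    exact mem_fixStar_of_scalesBall hx.2 hfix hρ H h1

include hf hreg hsub hnormal in
-- Expansion isolates each fixed point of `f^[m]` in the compact set of all of them.
theorem finite_fixStar (hJ : IsCompact (juliaSet f)) {m : ℕ} (hm : 1 ≤ m) :
    (fixStar f m).Finite := by
  rw [fixStar_eq hf hreg hsub hnormal hm]
  refine finite_of_isCompact_of_isolated ((isCompact_coreJulia hJ).inter_right
    (isClosed_eq (hf.iterate m) continuous_id)) ?_
  rintro x ⟨hx, hfix⟩
  obtain ⟨ρ, hρ, H, h1⟩ := one_lt_iterScale_of_periodic hf hreg hsub hnormal hx hm hfix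
  refine ⟨ρ, hρ, ?_⟩
  rintro y ⟨-, hy⟩ hyx
  have := H.dist_eq hyx (by simpa using hρ : dist x x < ρ)
  rw [show f^[m] y = y from hy, show f^[m] x = x from hfix] at this
  by_contra hne
  have hd : 0 < dist y x := dist_pos.2 hne
  nlinarith

end Periodic

end NonarchDyn

end
-- Normality and a radius function vanishing on the postsingular set.
noncomputable section

namespace NonarchDyn

open Metric

variable {X : Type*} [MetricSpace X] {f : X → X}

/-- The standing assumptions on `f`: those of the main theorem except the Homogeneous Condition,
of which only the consequence is kept that no singular point is repelling. -/
structure IsTame (f : X → X) : Prop where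
  cont : Continuous f
  subhyp : IsSubhyperbolic f
  compact : IsCompact (juliaSet f)
  normal : ∀ x ∈ singularSet f, IsNormalPoint f x
  reg : ∀ x ∈ singularSet f, x ∉ repellingPoints f

/-- Uniform control of `f` in the punctured ball of radius `t` around `z`. -/
def Control (f : X → X) (z : X) (t : ℝ) : Prop :=
  ∀ y ∈ coreJulia f, dist y z < t → y ≠ z → y ∉ singularSet f ∧ f y ≠ f z ∧
    ScalesBall f y (t * dist (f y) (f z) / localScale f y) (localScale f y) ∧
    t * dist (f y) (f z) ≤ localScale f y * dist y z ∧
    (z ∉ singularSet f → dist (f y) (f z) = localScale f y * dist y z)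

theorem exists_pos_forall_of_finite {α : Type*} {Z : Set α} (hZ : Z.Finite) {P : α → ℝ → Prop}
    (hP : ∀ z s t, P z t → s ≤ t → P z s) (h : ∀ z ∈ Z, ∃ t : ℝ, 0 < t ∧ P z t) :
    ∃ t : ℝ, 0 < t ∧ ∀ z ∈ Z, P z t := by
  induction Z, hZ using Set.Finite.induction_on with
  | empty => exact ⟨1, one_pos, by simp⟩
  | @insert a s _ _ ih =>
    obtain ⟨t, ht, H⟩ := ih fun z hz => h z (Set.mem_insert_of_mem _ hz)
    obtain ⟨t', ht', H'⟩ := h a (Set.mem_insert _ _)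
    refine ⟨min t t', lt_min ht ht', fun z hz => ?_⟩
    rcases Set.mem_insert_iff.1 hz with rfl | hz
    · exact hP _ _ _ H' (min_le_right _ _)
    · exact hP _ _ _ (H z hz) (min_le_left _ _)

theorem Control.mono {z : X} {s t : ℝ} (H : Control f z t) (hst : s ≤ t) : Control f z s := by
  intro y hy hyz hne
  obtain ⟨h1, h2, h3, h4, h5⟩ := H y hy (hyz.trans_le hst) hne
  have h6 : s * dist (f y) (f z) ≤ t * dist (f y) (f z) :=
    mul_le_mul_of_nonneg_right hst dist_nonneg
  exact ⟨h1, h2, h3.mono (div_le_div_of_nonneg_right h6 h3.pos.le), h6.trans h4, h5⟩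

variable [IsUltrametricDist X]

/-- The disk is closed or open according to whether the supremum of the distances to `a` is
attained. This shows that unions of chains of disks are disks. -/
theorem isDisk_of_forall_dist_le {D : Set X} {a : X} (ha : a ∈ D) (hD : Bornology.IsBounded D)
    (h : ∀ u ∈ D, ∀ z, dist z a ≤ dist u a → z ∈ D) : IsDisk D := by
  obtain ⟨M, hM⟩ := hD.subset_closedBall a
  set A := (fun u => dist u a) '' D with hA
  have hbdd : BddAbove A := ⟨M, by rintro _ ⟨u, hu, rfl⟩; exact hM hu⟩
  have hle : ∀ u ∈ D, dist u a ≤ sSup A := fun u hu => le_csSup hbdd ⟨u, hu, rfl⟩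
  by_cases hatt : ∃ u ∈ D, dist u a = sSup A
  · obtain ⟨u, hu, hua⟩ := hatt
    refine Or.inl ⟨a, sSup A, hua ▸ dist_nonneg, ?_⟩
    ext y
    exact ⟨fun hy => hle y hy, fun hy => h u hu y (by rw [hua]; exact hy)⟩
  · have hlt : ∀ u ∈ D, dist u a < sSup A := fun u hu =>
      lt_of_le_of_ne (hle u hu) fun he => hatt ⟨u, hu, he⟩
    refine Or.inr ⟨a, sSup A, by simpa using hlt a ha, ?_⟩
    ext y
    refine ⟨fun hy => hlt y hy, fun hy => ?_⟩
    obtain ⟨_, ⟨u, hu, rfl⟩, hlt'⟩ := exists_lt_of_lt_csSup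
      (⟨_, a, ha, rfl⟩ : A.Nonempty) (mem_ball.1 hy)
    exact h u hu y hlt'.le

/-- A scaling ball in `S` is contained in a maximal scaling disk in `S`. -/
theorem exists_isMaximalScalingDiskIn {S : Set X} (hS : Bornology.IsBounded S) {y : X} {ρ C : ℝ}
    (hρ : 0 < ρ) (hy : NonIsolated y) (H : ScalesBall f y ρ C) (hsub : ball y ρ ⊆ S) :
    ∃ V, y ∈ V ∧ IsMaximalScalingDiskIn f S V ∧
      ∀ u ∈ V, ∀ v ∈ V, dist (f u) (f v) = C * dist u v := by
  -- All members of a chain contain the same ball around a non-isolated point, hence share the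
  -- constant `C`; otherwise their union need not be scaling.
  have hconst : ∀ W, IsScalingDisk f W → ball y ρ ⊆ W →
      ∀ u ∈ W, ∀ v ∈ W, dist (f u) (f v) = C * dist u v := by
    rintro W ⟨-, -, c, hc, hW⟩ hWb
    obtain ⟨u, hu, huy⟩ := hy ρ hρ
    have hyy : dist y y < ρ := by simpa using hρ
    have h1 := hW u (hWb huy) y (hWb hyy)
    rw [H.dist_eq huy hyy] at h1
    rw [mul_right_cancel₀ (dist_ne_zero.2 hu) h1]
    exact hW
  obtain ⟨V, hbV, hmax⟩ := zorn_subset_nonempty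
    {W | (IsScalingDisk f W ∧ W ⊆ S) ∧ ball y ρ ⊆ W} (by
      intro c hc hchain hne
      obtain ⟨W₀, hW₀⟩ := hne
      have hyU : ∀ W ∈ c, y ∈ W := fun W hW => (hc hW).2 (mem_ball_self hρ)
      have hUS : ⋃₀ c ⊆ S := Set.sUnion_subset fun W hW => (hc hW).1.2
      have hbU : ball y ρ ⊆ ⋃₀ c := (hc hW₀).2.trans (Set.subset_sUnion_of_mem hW₀)
      have hdist : ∀ u ∈ ⋃₀ c, ∀ v ∈ ⋃₀ c, dist (f u) (f v) = C * dist u v := by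
        rintro u ⟨W, hW, hu⟩ v ⟨W', hW', hv⟩
        rcases hchain.total hW hW' with hle | hle
        · exact hconst W' (hc hW').1.1 (hc hW').2 u (hle hu) v hv
        · exact hconst W (hc hW).1.1 (hc hW).2 u hu v (hle hv)
      refine ⟨⋃₀ c, ⟨⟨⟨?_, ?_, C, H.pos, hdist⟩, hUS⟩, hbU⟩,
        fun W hW => Set.subset_sUnion_of_mem hW⟩
      · refine isDisk_of_forall_dist_le ⟨W₀, hW₀, hyU _ hW₀⟩ (hS.subset hUS) ?_
        rintro u ⟨W, hW, hu⟩ z hz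
        exact ⟨W, hW, (hc hW).1.1.1.mem_of_dist_le (hyU W hW) hu hz⟩
      · refine isDisk_of_forall_dist_le (a := f y) ⟨y, ⟨W₀, hW₀, hyU _ hW₀⟩, rfl⟩ ?_ ?_
        · obtain ⟨M, hM⟩ := Metric.isBounded_iff.1 (hS.subset hUS)
          refine Metric.isBounded_iff.2 ⟨C * M, ?_⟩
          rintro _ ⟨u, hu, rfl⟩ _ ⟨v, hv, rfl⟩
          rw [hdist u hu v hv]
          exact mul_le_mul_of_nonneg_left (hM hu hv) H.pos.le
        · rintro _ ⟨u, ⟨W, hW, hu⟩, rfl⟩ z hz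
          obtain ⟨w, hw, rfl⟩ := (hc hW).1.1.2.1.mem_of_dist_le ⟨y, hyU W hW, rfl⟩
            ⟨u, hu, rfl⟩ hz
          exact ⟨w, ⟨W, hW, hw⟩, rfl⟩)
    (ball y ρ)
    ⟨⟨⟨(isNontrivialDisk_ball y hρ).isDisk, H.isScalingOn hρ⟩, hsub⟩, subset_rfl⟩
  refine ⟨V, hbV (mem_ball_self hρ), ⟨hmax.prop.1, fun W hW hVW => ?_⟩,
    hconst V hmax.prop.1.1 hmax.prop.2⟩
  exact hmax.le_of_ge ⟨hW, hmax.prop.2.trans hVW⟩ hVW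

theorem ScalesBall.notMem_singularSet {x y : X} {ρ C : ℝ} (H : ScalesBall f x ρ C)
    (hy : dist y x < ρ) : y ∉ singularSet f := fun hs =>
  hs.2 ⟨ball x ρ, isNontrivialDisk_ball x (dist_nonneg.trans_lt hy), hy,
    H.isScalingOn (dist_nonneg.trans_lt hy)⟩

/-- At a singular `z`, let `V` be a maximal scaling disk containing `y` and avoiding `z`. Normality
bounds `diam (f '' V)` below by `r * dist (f y) (f z)`, while `diam V` is at most `dist y z` because
`z ∉ V`. At a nonsingular `z` the local scaling gives everything. -/
theorem exists_control (hnormal : ∀ x ∈ singularSet f, IsNormalPoint f x) {z : X}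
    (hz : z ∈ coreJulia f) : ∃ t : ℝ, 0 < t ∧ t ≤ 1 ∧ Control f z t := by
  by_cases hs : z ∈ singularSet f
  · obtain ⟨U, r, hU, hzU, hr, hr1, hUs, hne, hmax⟩ := hnormal z hs
    obtain ⟨ε, hε, hεU⟩ := hU.exists_ball_subset hzU
    refine ⟨min r ε, lt_min hr hε, (min_le_left _ _).trans hr1, ?_⟩
    suffices h : ∀ y ∈ coreJulia f, dist y z < ε → y ≠ z → y ∉ singularSet f ∧ f y ≠ f z ∧
        ScalesBall f y (r * dist (f y) (f z) / localScale f y) (localScale f y) ∧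
        r * dist (f y) (f z) ≤ localScale f y * dist y z by
      intro y hy hyz hyne
      obtain ⟨h1, h2, h3, h4⟩ := h y hy (hyz.trans_le (min_le_right _ _)) hyne
      have h6 : min r ε * dist (f y) (f z) ≤ r * dist (f y) (f z) :=
        mul_le_mul_of_nonneg_right (min_le_left _ _) dist_nonneg
      exact ⟨h1, h2, h3.mono (div_le_div_of_nonneg_right h6 h3.pos.le), h6.trans h4,
        fun h => absurd hs h⟩
    intro y hy hyz hyne
    have hyU : y ∈ U := hεU hyz
    have hys : y ∉ singularSet f := fun h => hyne (by
      have : y ∈ U ∩ singularSet f := ⟨hyU, h⟩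
      rwa [hUs] at this)
    refine ⟨hys, hne y ⟨hyU, hyne⟩, ?_⟩
    obtain ⟨ρ, hρ, H⟩ := exists_scalesBall_localScale hy hys
    have hd : 0 < dist y z := dist_pos.2 hyne
    have hρ' : 0 < min ρ (dist y z) := lt_min hρ hd
    have hsub : ball y (min ρ (dist y z)) ⊆ U \ {z} := by
      intro w hw
      have hw' : dist w y < dist y z := (mem_ball.1 hw).trans_le (min_le_right _ _)
      refine ⟨hU.isDisk.mem_of_dist_le hyU hzU ?_, ?_⟩
      · rw [dist_comm z y]; exact hw'.le
      · rintro rfl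
        rw [dist_comm] at hw'
        exact lt_irrefl _ hw'
    obtain ⟨V, hyV, hVmax, hVc⟩ := exists_isMaximalScalingDiskIn (f := f)
      (hU.isDisk.isBounded.subset Set.sdiff_subset) hρ' hy.2 (H.mono (min_le_left _ _)) hsub
    obtain ⟨-, h2⟩ := hmax V hVmax
    obtain ⟨⟨hVd, hfVd, -⟩, hVU⟩ := hVmax.prop
    have hzV : z ∉ V := fun h => (hVU h).2 rfl
    have hfzV : f z ∉ f '' V := by
      rintro ⟨v, hv, hvz⟩
      exact hne v (hVU hv) hvz
    rw [infDist_eq_of_notMem hfVd ⟨y, hyV, rfl⟩ hfzV,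
      diam_image_of_scaling H.pos hVd.isBounded hfVd.isBounded hVc, dist_comm] at h2
    refine ⟨scalesBall_of_scaling hVd hfVd H.pos hVc hyV ?_, h2.trans ?_⟩
    · rw [div_le_iff₀ H.pos, mul_comm (diam V)]
      exact h2
    · exact mul_le_mul_of_nonneg_left (hVd.diam_le_of_notMem hyV hzV) H.pos.le
  · obtain ⟨ρ, hρ, H⟩ := exists_scalesBall_localScale hz hs
    refine ⟨min 1 ρ, lt_min one_pos hρ, min_le_left _ _, fun y hy hyz hyne => ?_⟩
    have hyρ : dist y z < ρ := hyz.trans_le (min_le_right _ _)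
    have Hy := H.recenter hyρ
    have hsy := Hy.localScale_eq hρ hy.2
    have hdist := H.dist_eq hyρ (by simpa using hρ : dist z z < ρ)
    rw [hsy, hdist]
    have h1 : min 1 ρ * (localScale f z * dist y z) ≤ localScale f z * dist y z :=
      mul_le_of_le_one_left (mul_nonneg H.pos.le dist_nonneg) (min_le_left _ _)
    refine ⟨H.notMem_singularSet hyρ, fun h => ?_, Hy.mono ?_, h1, fun _ => rfl⟩
    · exact hyne (H.injOn hyρ (by simpa using hρ) h)
    · rw [div_le_iff₀ H.pos]
      refine h1.trans ?_
      rw [mul_comm]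
      exact mul_le_mul_of_nonneg_right hyρ.le H.pos.le

/-- The first `m` points of the orbit of `y` shadow those of `z` in the controlled balls. -/
def Shadows (f : X → X) (t : ℝ) (m : ℕ) (y z : X) : Prop :=
  ∀ i < m, Control f (f^[i] z) t ∧ f^[i] y ∈ coreJulia f ∧ dist (f^[i] y) (f^[i] z) < t

theorem Shadows.tail {t : ℝ} {m : ℕ} {y z : X} (H : Shadows f t (m + 1) y z) :
    Shadows f t m (f y) (f z) := fun i hi => by
  simpa only [Function.iterate_succ_apply] using H (i + 1) (Nat.succ_lt_succ hi)

theorem Shadows.iterate_ne {t : ℝ} {m : ℕ} {y z : X} (H : Shadows f t m y z) (hne : y ≠ z) :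
    f^[m] y ≠ f^[m] z := by
  induction m generalizing y z with
  | zero => exact hne
  | succ m ih =>
    obtain ⟨h1, h2, h3⟩ := H 0 m.succ_pos
    exact ih H.tail (h1 y h2 h3 hne).2.1

theorem Shadows.dist_iterate_le {t : ℝ} {m : ℕ} {y z : X} (H : Shadows f t m y z) (ht : 0 < t)
    (hne : y ≠ z) : t ^ m * dist (f^[m] y) (f^[m] z) ≤ iterScale f m y * dist y z := by
  induction m generalizing y z with
  | zero => simp [iterScale_zero]
  | succ m ih =>
    obtain ⟨h1, h2, h3⟩ := H 0 m.succ_pos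
    obtain ⟨-, hfne, -, h4, -⟩ := h1 y h2 h3 hne
    rw [Function.iterate_succ_apply, Function.iterate_succ_apply, iterScale_succ']
    calc _ = t * (t ^ m * dist (f^[m] (f y)) (f^[m] (f z))) := by ring
      _ ≤ t * (iterScale f m (f y) * dist (f y) (f z)) :=
        mul_le_mul_of_nonneg_left (ih H.tail hfne) ht.le
      _ = iterScale f m (f y) * (t * dist (f y) (f z)) := by ring
      _ ≤ iterScale f m (f y) * (localScale f y * dist y z) :=
        mul_le_mul_of_nonneg_left h4 (iterScale_pos _ _).le
      _ = _ := by ring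

/-- The radius at `y` obtained by pulling back the distance of the `m`-th images of `y` and `z`. -/
def pullRadius (f : X → X) (t : ℝ) (m : ℕ) (y z : X) : ℝ :=
  t ^ m * dist (f^[m] y) (f^[m] z) / iterScale f m y

theorem localScale_mul_pullRadius {t : ℝ} {m : ℕ} {y z : X} :
    localScale f y * pullRadius f t (m + 1) y z = t * pullRadius f t m (f y) (f z) := by
  have h1 := (localScale_pos f y).ne'
  have h2 := (iterScale_pos (f := f) m (f y)).ne'
  rw [pullRadius, pullRadius, iterScale_succ', Function.iterate_succ_apply,
    Function.iterate_succ_apply, pow_succ]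
  field_simp

theorem Shadows.pullRadius_le {t : ℝ} {m : ℕ} {y z : X} (H : Shadows f t m y z) (ht : 0 < t)
    (hne : y ≠ z) : pullRadius f t m y z ≤ dist y z := by
  rw [pullRadius, div_le_iff₀ (iterScale_pos _ _), mul_comm (dist y z)]
  exact H.dist_iterate_le ht hne

theorem Shadows.scalesBall {t : ℝ} {m : ℕ} {y z : X} (H : Shadows f t (m + 1) y z) (ht : 0 < t)
    (hne : y ≠ z) : ScalesBall f y (pullRadius f t (m + 1) y z) (localScale f y) := by
  obtain ⟨h1, h2, h3⟩ := H 0 m.succ_pos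
  obtain ⟨-, hfne, h4, -⟩ := h1 y h2 h3 hne
  refine h4.mono ?_
  rw [le_div_iff₀ (localScale_pos _ _), mul_comm, localScale_mul_pullRadius]
  exact mul_le_mul_of_nonneg_left (H.tail.pullRadius_le ht hfne) ht.le

/-- Induction works because `f` maps the ball at `y` into the corresponding ball at `f y` for one
step less; the spare factor `t ≤ 1` absorbs the change of radius. -/
theorem Shadows.iterScale_eq {t : ℝ} {m : ℕ} {y y' z : X} (H : Shadows f t m y z) (ht : 0 < t)
    (ht1 : t ≤ 1) (hne : y ≠ z) (hy' : y' ∈ coreJulia f)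
    (hyy' : dist y' y < pullRadius f t m y z) :
    iterScale f m y' = iterScale f m y ∧
      dist (f^[m] y') (f^[m] y) = iterScale f m y * dist y' y := by
  induction m generalizing y y' z with
  | zero => simp [iterScale_zero]
  | succ m ih =>
    have hsc := H.scalesBall ht hne
    have hpos := dist_nonneg.trans_lt hyy'
    have hd := hsc.dist_eq hyy' (by simpa using hpos : dist y y < _)
    have hl := (hsc.recenter hyy').localScale_eq hpos hy'.2
    obtain ⟨h1, h2, h3⟩ := H 0 m.succ_pos
    obtain ⟨-, hfne, -⟩ := h1 y h2 h3 hne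
    have hp : 0 ≤ pullRadius f t m (f y) (f z) :=
      div_nonneg (mul_nonneg (pow_nonneg ht.le _) dist_nonneg) (iterScale_pos _ _).le
    obtain ⟨h5, h6⟩ := ih (y' := f y') H.tail hfne ((hsc.mem_coreJulia_iff_of_self hyy').1 hy') (by
      rw [hd]
      refine (mul_lt_mul_of_pos_left hyy' hsc.pos).trans_le ?_
      rw [localScale_mul_pullRadius]
      exact mul_le_of_le_one_left hp ht1)
    rw [iterScale_succ', iterScale_succ', hl, h5, Function.iterate_succ_apply,
      Function.iterate_succ_apply, h6, hd, mul_assoc]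
    exact ⟨rfl, rfl⟩

/-- The forward orbits of the singular points. -/
def postSingular (f : X → X) : Set X := {z | ∃ x ∈ singularSet f, ∃ i : ℕ, f^[i] x = z}

theorem singularSet_subset_postSingular : singularSet f ⊆ postSingular f :=
  fun x hx => ⟨x, hx, 0, rfl⟩

theorem map_mem_postSingular {z : X} (hz : z ∈ postSingular f) : f z ∈ postSingular f := by
  obtain ⟨x, hx, i, rfl⟩ := hz
  exact ⟨x, hx, i + 1, Function.iterate_succ_apply' f i x⟩

theorem iterate_mem_postSingular {z : X} (hz : z ∈ postSingular f) (n : ℕ) :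
    f^[n] z ∈ postSingular f := by
  induction n with
  | zero => exact hz
  | succ n ih => rw [Function.iterate_succ_apply']; exact map_mem_postSingular ih

theorem IsTame.postSingular_subset (h : IsTame f) : postSingular f ⊆ coreJulia f := by
  rintro _ ⟨x, hx, i, rfl⟩
  exact iterate_mem_coreJulia h.cont h.normal (singularSet_subset_coreJulia hx) i

theorem finite_orbit {x : X} {k n : ℕ} (hn : 1 ≤ n) (h : f^[n] (f^[k] x) = f^[k] x) :
    {z | ∃ i : ℕ, f^[i] x = z}.Finite := by
  refine ((Set.finite_Iio (k + n)).image fun i => f^[i] x).subset ?_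
  rintro _ ⟨i, rfl⟩
  induction i using Nat.strong_induction_on with
  | _ i ih =>
    by_cases hi : i < k + n
    · exact ⟨i, hi, rfl⟩
    · have h1 : f^[i] x = f^[i - n] x := by
        have e := congrArg f^[i - (k + n)] h
        rw [← Function.iterate_add_apply, ← Function.iterate_add_apply,
          ← Function.iterate_add_apply] at e
        rwa [show i - (k + n) + n + k = i by omega,
          show i - (k + n) + k = i - n by omega] at e
      rw [h1]
      exact ih _ (by omega)

theorem IsTame.finite_postSingular (h : IsTame f) : (postSingular f).Finite := by
  have : postSingular f = ⋃ x ∈ singularSet f, {z | ∃ i : ℕ, f^[i] x = z} := by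
    ext z; simp [postSingular]
  rw [this]
  refine h.subhyp.1.biUnion fun x hx => ?_
  obtain ⟨k, -, n, hn, hk⟩ := h.subhyp.2 x hx
  exact finite_orbit hn hk.1

theorem IsTame.map_mem (h : IsTame f) {x : X} (hx : x ∈ coreJulia f) : f x ∈ coreJulia f :=
  map_mem_coreJulia h.cont h.normal hx

theorem IsTame.iterate_mem (h : IsTame f) {x : X} (hx : x ∈ coreJulia f) (n : ℕ) :
    f^[n] x ∈ coreJulia f :=
  iterate_mem_coreJulia h.cont h.normal hx n

/-- From some time on, singular orbits run on repelling cycles, which avoid singular points. The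
time `k + 1` is where the distances defining the base radius are measured. -/
theorem IsTame.exists_landing (h : IsTame f) :
    ∃ k : ℕ, ∀ z ∈ postSingular f, f^[k + 1] z ∉ singularSet f := by
  have : ∀ x ∈ singularSet f, ∃ k : ℕ, ∀ j ≥ k, f^[j] x ∉ singularSet f := fun x hx => by
    obtain ⟨k, -, n, hn, hk⟩ := h.subhyp.2 x hx
    refine ⟨k, fun j hj => ?_⟩
    have := (iterate_repelling h.cont h.reg hn hk (j - k)).2.2
    rwa [← Function.iterate_add_apply, Nat.sub_add_cancel hj] at this
  choose! k hk using this
  obtain ⟨K, hK⟩ := (h.subhyp.1.image k).bddAbove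
  refine ⟨K, ?_⟩
  rintro _ ⟨x, hx, i, rfl⟩
  rw [← Function.iterate_add_apply]
  have := hK ⟨x, hx, rfl⟩
  exact hk x hx _ (by omega)

/-- A radius function `r` that vanishes exactly at the postsingular points, is constant on the
balls it defines and such that `f` is scaling on these balls; the map `f` rescales `r` exactly
near the postsingular points. -/
structure IsBaseRadius (f : X → X) (r : X → ℝ) (δ M : ℝ) : Prop where
  pos : 0 < δ
  bound : ∀ y ∈ coreJulia f, 0 ≤ r y ∧ r y ≤ M ∧ (r y = 0 ↔ y ∈ postSingular f)
  scales : ∀ y ∈ coreJulia f, y ∉ postSingular f → ScalesBall f y (r y) (localScale f y)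
  const : ∀ y ∈ coreJulia f, ∀ y' ∈ coreJulia f, dist y' y < r y → r y' = r y
  rescale : ∀ z ∈ postSingular f, ∀ y ∈ coreJulia f, dist y z < δ → y ∉ postSingular f →
    r (f y) = localScale f y * r y

/-- Near a postsingular `z` the radius is the distance of the orbits of `y` and `z` after `k + 1`
steps, pulled back to `y` and shrunk by `t ^ (k + 1)`; away from these points it is a constant `r₁`.
Measuring only after passing all singular points makes the rescaling under `f` exact. -/
theorem IsTame.exists_isBaseRadius (h : IsTame f) :
    ∃ (r : X → ℝ) (δ M : ℝ), IsBaseRadius f r δ M := by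
  classical
  set Z := postSingular f with hZ
  have hZfin := h.finite_postSingular
  obtain ⟨k, hk⟩ := h.exists_landing
  obtain ⟨t, ht, ht1, hctl⟩ : ∃ t : ℝ, 0 < t ∧ t ≤ 1 ∧ ∀ z ∈ Z, Control f z t := by
    obtain ⟨t, ht, H⟩ := exists_pos_forall_of_finite hZfin
      (P := fun z t => Control f z t) (fun z s t H hst => H.mono hst) fun z hz => by
        obtain ⟨t, ht, -, H⟩ := exists_control h.normal (h.postSingular_subset hz)
        exact ⟨t, ht, H⟩
    exact ⟨min t 1, lt_min ht one_pos, min_le_right _ _,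
      fun z hz => (H z hz).mono (min_le_left _ _)⟩
  -- a radius at which the balls around the postsingular points are separated and shadowing holds
  obtain ⟨δ, hδ, hδP⟩ := exists_pos_forall_of_finite hZfin
    (P := fun z δ => (∀ z' ∈ Z, dist z' z < δ → z' = z) ∧
      ∀ i ≤ k + 1, ∀ y, dist y z < δ → dist (f^[i] y) (f^[i] z) < t)
    (fun z s t' H hst => ⟨fun z' hz' hd => H.1 z' hz' (hd.trans_le hst),
      fun i hi y hy => H.2 i hi y (hy.trans_le hst)⟩) fun z hz => by
      obtain ⟨δ₁, hδ₁, H₁⟩ := exists_pos_forall_of_finite hZfin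
        (P := fun z' δ => dist z' z < δ → z' = z) (fun z' s t' H hst hd => H (hd.trans_le hst))
        fun z' hz' => by
          by_cases he : z' = z
          · exact ⟨1, one_pos, fun _ => he⟩
          · exact ⟨dist z' z, dist_pos.2 he, fun hd => absurd hd (lt_irrefl _)⟩
      obtain ⟨δ₂, hδ₂, H₂⟩ := exists_pos_forall_of_finite (Set.finite_Iic (k + 1))
        (P := fun i δ => ∀ y, dist y z < δ → dist (f^[i] y) (f^[i] z) < t)
        (fun z' s t' H hst y hy => H y (hy.trans_le hst)) fun i _ => by
          obtain ⟨δ, hδ, H⟩ := Metric.continuousAt_iff.1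
            ((h.cont.iterate i).continuousAt (x := z)) t ht
          exact ⟨δ, hδ, fun y hy => H hy⟩
      exact ⟨min δ₁ δ₂, lt_min hδ₁ hδ₂,
        fun z' hz' hd => H₁ z' hz' (hd.trans_le (min_le_left _ _)),
        fun i hi y hy => H₂ i hi y (hy.trans_le (min_le_right _ _))⟩
  have hsep : ∀ z ∈ Z, ∀ z' ∈ Z, ∀ y, dist y z < δ → dist y z' < δ → z = z' := by
    intro z hz z' hz' y hyz hyz'
    refine (hδP z' hz').1 z hz ((dist_triangle_max z y z').trans_lt (max_lt ?_ hyz'))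
    rwa [dist_comm]
  have hshadow : ∀ z ∈ Z, ∀ y ∈ coreJulia f, dist y z < δ → Shadows f t (k + 2) y z :=
    fun z hz y hy hyz i hi => ⟨hctl _ (iterate_mem_postSingular hz i), h.iterate_mem hy i,
      (hδP z hz).2 i (Nat.lt_succ_iff.1 hi) y hyz⟩
  have hshadow' : ∀ z ∈ Z, ∀ y ∈ coreJulia f, dist y z < δ → Shadows f t (k + 1) y z :=
    fun z hz y hy hyz i hi => hshadow z hz y hy hyz i (hi.trans (Nat.lt_succ_self _))
  -- a uniform radius away from the postsingular points
  obtain ⟨r₁, hr₁, hr₁δ, hr₁P⟩ : ∃ r₁ : ℝ, 0 < r₁ ∧ r₁ ≤ δ ∧ ∀ y ∈ coreJulia f,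
      (∀ z ∈ Z, δ ≤ dist y z) → ScalesBall f y r₁ (localScale f y) := by
    set K := coreJulia f ∩ ⋂ z ∈ Z, {y | δ ≤ dist y z} with hK
    have hKc : IsCompact K := (isCompact_coreJulia h.compact).inter_right
      (isClosed_biInter fun z _ => isClosed_le continuous_const (by fun_prop))
    have hKloc : ∀ x ∈ K, ∃ ρ : ℝ, 0 < ρ ∧ ScalesBall f x ρ (localScale f x) := by
      rintro x ⟨hx, hxZ⟩
      refine exists_scalesBall_localScale hx fun hs => ?_
      have := Set.mem_iInter₂.1 hxZ x (singularSet_subset_postSingular hs)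
      simp only [Set.mem_ofPred_eq, dist_self] at this
      exact absurd hδ (not_lt.2 this)
    choose! ρ hρ Hρ using hKloc
    obtain ⟨s, hsK, hcov⟩ := hKc.elim_nhds_subcover (fun x => ball x (ρ x))
      fun x hx => ball_mem_nhds x (hρ x hx)
    obtain ⟨r₁, hr₁, H₁⟩ := exists_pos_forall_of_finite s.finite_toSet
      (P := fun x r => r ≤ ρ x) (fun _ _ _ H hst => hst.trans H)
      fun x hx => ⟨ρ x, hρ x (hsK x hx), le_rfl⟩
    refine ⟨min r₁ δ, lt_min hr₁ hδ, min_le_right _ _, fun y hy hyZ => ?_⟩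
    obtain ⟨x, hx, hyx⟩ := Set.mem_iUnion₂.1 (hcov ⟨hy, Set.mem_iInter₂.2 hyZ⟩)
    have Hy := (Hρ x (hsK x hx)).recenter hyx
    rw [Hy.localScale_eq (hρ x (hsK x hx)) hy.2]
    exact Hy.mono ((min_le_left _ _).trans (H₁ x hx))
  obtain ⟨δ', hδ', hδ'δ, hδ'P⟩ : ∃ δ' : ℝ, 0 < δ' ∧ δ' ≤ δ ∧ ∀ z ∈ Z, ∀ y, dist y z < δ' →
      dist (f y) (f z) < δ := by
    obtain ⟨δ', hδ', H⟩ := exists_pos_forall_of_finite hZfin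
      (P := fun z δ' => ∀ y, dist y z < δ' → dist (f y) (f z) < δ)
      (fun z' s t' H hst y hy => H y (hy.trans_le hst)) fun z _ => by
        obtain ⟨δ', hδ', H⟩ := Metric.continuousAt_iff.1 (h.cont.continuousAt (x := z)) δ hδ
        exact ⟨δ', hδ', fun y hy => H hy⟩
    exact ⟨min δ' δ, lt_min hδ' hδ, min_le_right _ _,
      fun z hz y hy => H z hz y (hy.trans_le (min_le_left _ _))⟩
  set r : X → ℝ := fun y => if hy : ∃ z ∈ Z, dist y z < δ then
    pullRadius f t (k + 1) y hy.choose else r₁ with hr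
  have hnear : ∀ z ∈ Z, ∀ y, dist y z < δ → r y = pullRadius f t (k + 1) y z := by
    intro z hz y hyz
    have hex : ∃ z ∈ Z, dist y z < δ := ⟨z, hz, hyz⟩
    rw [hr]
    simp only [dif_pos hex]
    rw [hsep _ hex.choose_spec.1 z hz y hex.choose_spec.2 hyz]
  have hfar : ∀ y, (∀ z ∈ Z, δ ≤ dist y z) → r y = r₁ := by
    intro y hy
    rw [hr]
    refine dif_neg ?_
    rintro ⟨z, hz, hyz⟩
    exact absurd hyz (not_lt.2 (hy z hz))
  have hcases : ∀ y, (∃ z ∈ Z, dist y z < δ) ∨ ∀ z ∈ Z, δ ≤ dist y z := by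
    intro y
    by_cases hex : ∃ z ∈ Z, dist y z < δ
    · exact Or.inl hex
    · push Not at hex
      exact Or.inr hex
  have hpull : ∀ z ∈ Z, ∀ y ∈ coreJulia f, dist y z < δ → y ≠ z →
      0 < pullRadius f t (k + 1) y z := fun z hz y hy hyz hne =>
    div_pos (mul_pos (pow_pos ht _) (dist_pos.2 ((hshadow' z hz y hy hyz).iterate_ne hne)))
      (iterScale_pos _ _)
  have hself : ∀ z, pullRadius f t (k + 1) z z = 0 := fun z => by simp [pullRadius]
  refine ⟨r, δ', max δ r₁, hδ', fun y hy => ?_, fun y hy hyZ => ?_, fun y hy y' hy' hyy' => ?_,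
    fun z hz y hy hyz hyZ => ?_⟩
  · rcases hcases y with ⟨z, hz, hyz⟩ | hyf
    · rw [hnear z hz y hyz]
      rcases eq_or_ne y z with rfl | hne
      · rw [hself]
        exact ⟨le_rfl, hδ.le.trans (le_max_left _ _), by simpa using hz⟩
      · have hp := hpull z hz y hy hyz hne
        refine ⟨hp.le, (((hshadow' z hz y hy hyz).pullRadius_le ht hne).trans hyz.le).trans
          (le_max_left _ _), iff_of_false hp.ne' fun hyZ => ?_⟩
        exact hne (hsep y hyZ z hz y (by simpa using hδ) hyz)
    · rw [hfar y hyf]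
      refine ⟨hr₁.le, le_max_right _ _, iff_of_false hr₁.ne' fun hyZ => ?_⟩
      have := hyf y hyZ
      rw [dist_self] at this
      exact absurd hδ (not_lt.2 this)
  · rcases hcases y with ⟨z, hz, hyz⟩ | hyf
    · rw [hnear z hz y hyz]
      exact (hshadow' z hz y hy hyz).scalesBall ht fun he => hyZ (he ▸ hz)
    · rw [hfar y hyf]
      exact hr₁P y hy hyf
  · rcases hcases y with ⟨z, hz, hyz⟩ | hyf
    · rw [hnear z hz y hyz] at hyy' ⊢
      rcases eq_or_ne y z with rfl | hne
      · rw [hself] at hyy'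
        exact absurd hyy' (not_lt.2 dist_nonneg)
      have hS := hshadow' z hz y hy hyz
      have hle := hS.pullRadius_le ht hne
      have hy'z : dist y' z < δ := (dist_triangle_max y' y z).trans_lt
        (max_lt ((hyy'.trans_le hle).trans hyz) hyz)
      obtain ⟨h1, h2⟩ := hS.iterScale_eq ht ht1 hne hy' hyy'
      rw [hnear z hz y' hy'z, pullRadius, h1, pullRadius]
      -- Isosceles triangles: moving `y` by less than its radius does not change the distance of the
      -- `(k + 1)`-st image to that of `z`.
      have hlt : dist (f^[k + 1] y') (f^[k + 1] y) < dist (f^[k + 1] y) (f^[k + 1] z) := by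
        rw [h2, mul_comm, ← lt_div_iff₀ (iterScale_pos _ _)]
        refine hyy'.trans_le ?_
        exact div_le_div_of_nonneg_right
          (mul_le_of_le_one_left dist_nonneg (pow_le_one₀ ht.le ht1)) (iterScale_pos _ _).le
      have heq : dist (f^[k + 1] y') (f^[k + 1] z) = dist (f^[k + 1] y) (f^[k + 1] z) := by
        rw [IsUltrametricDist.dist_eq_max_of_dist_ne_dist _ _ _ hlt.ne, max_eq_right hlt.le]
      rw [heq]
    -- Since `r₁ ≤ δ`, the ball of a far point contains no near point.
    · rw [hfar y hyf] at hyy' ⊢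
      refine hfar y' fun z hz => ?_
      by_contra hcon
      refine absurd (hyf z hz) (not_le.2 ((dist_triangle_max y y' z).trans_lt
        (max_lt ?_ (not_le.1 hcon))))
      rw [dist_comm]
      exact hyy'.trans_le hr₁δ
  · have hyδ := hyz.trans_le hδ'δ
    have hne : y ≠ z := fun he => hyZ (he ▸ hz)
    rw [hnear z hz y hyδ, hnear (f z) (map_mem_postSingular hz) (f y) (hδ'P z hz y hyz)]
    have hS := hshadow z hz y hy hyδ (k + 1) (Nat.lt_succ_self _)
    -- By the choice of `k`, the point `f^[k + 1] z` is nonsingular, so the next distance is scaled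
    -- exactly; comparing the two factorisations of `iterScale f (k + 2) y` turns this into the
    -- rescaling of `r`.
    have h5 := (hS.1 _ hS.2.1 hS.2.2 ((hshadow' z hz y hy hyδ).iterate_ne hne)).2.2.2.2 (hk z hz)
    have h6 := (iterScale_succ (f := f) (k + 1) y).symm.trans (iterScale_succ' (k + 1) y)
    have e1 := (iterScale_pos (f := f) (k + 1) (f y)).ne'
    have e2 := (iterScale_pos (f := f) (k + 1) y).ne'
    have hcomm : ∀ w, f^[k + 1] (f w) = f (f^[k + 1] w) := fun w => by
      rw [← Function.iterate_succ_apply, Function.iterate_succ_apply']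
    rw [pullRadius, pullRadius, hcomm, hcomm, h5, ← mul_div_assoc, div_eq_div_iff e1 e2]
    linear_combination (t ^ (k + 1) * dist (f^[k + 1] y) (f^[k + 1] z)) * h6

end NonarchDyn

end
-- Refinement to a Markov partition.
noncomputable section

namespace NonarchDyn

open Metric

variable {X : Type*} [MetricSpace X] [IsUltrametricDist X] {f : X → X}

/-- By `exists_control`, fibres of `f` in the compact set `coreJulia` are discrete. -/
theorem IsTame.finite_preimage (h : IsTame f) {A : Set X} (hA : A.Finite) :
    {y | y ∈ coreJulia f ∧ f y ∈ A}.Finite := by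
  have : {y | y ∈ coreJulia f ∧ f y ∈ A} = ⋃ w ∈ A, {y | y ∈ coreJulia f ∧ f y = w} := by
    ext y; simp
  rw [this]
  refine hA.biUnion fun w _ => finite_of_isCompact_of_isolated
    ((isCompact_coreJulia h.compact).inter_right (isClosed_eq h.cont continuous_const)) ?_
  rintro x ⟨hx, hxw⟩
  obtain ⟨t, ht, -, hc⟩ := exists_control h.normal hx
  refine ⟨t, ht, ?_⟩
  rintro y ⟨hy, hyw⟩ hyx
  by_contra hne
  exact (hc y hy hyx hne).2.1 (hyw.trans hxw.symm)

theorem IsTame.finite_iterate_preimage (h : IsTame f) {A : Set X} (hA : A.Finite) (n : ℕ) :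
    {y | y ∈ coreJulia f ∧ f^[n] y ∈ A}.Finite := by
  induction n with
  | zero => exact hA.subset fun y hy => hy.2
  | succ n ih =>
    refine (h.finite_preimage ih).subset ?_
    rintro y ⟨hy, hyA⟩
    exact ⟨hy, h.map_mem hy, by rwa [Function.iterate_succ_apply] at hyA⟩

open Classical in
/-- Radii of the cylinders of points with the same itinerary of length `n + 1` with respect to the
balls defined by the radius function `r`. -/
def refineRadius (f : X → X) (r : X → ℝ) : ℕ → X → ℝ
  | 0 => r
  | n + 1 => fun y => if y ∈ postSingular f then 0 else
      min (r y) (refineRadius f r n (f y) / localScale f y)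

theorem refineRadius_succ_of_mem {r : X → ℝ} {n : ℕ} {y : X} (hy : y ∈ postSingular f) :
    refineRadius f r (n + 1) y = 0 := if_pos hy

theorem refineRadius_succ {r : X → ℝ} {n : ℕ} {y : X} (hy : y ∉ postSingular f) :
    refineRadius f r (n + 1) y = min (r y) (refineRadius f r n (f y) / localScale f y) :=
  if_neg hy

section

variable {r : X → ℝ} {δ M : ℝ}

theorem IsBaseRadius.pos_of_notMem (B : IsBaseRadius f r δ M) {y : X} (hy : y ∈ coreJulia f)
    (hyZ : y ∉ postSingular f) : 0 < r y :=
  lt_of_le_of_ne (B.bound y hy).1 fun he => hyZ ((B.bound y hy).2.2.1 he.symm)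

theorem IsBaseRadius.refine_nonneg (B : IsBaseRadius f r δ M) (h : IsTame f) (n : ℕ) {y : X}
    (hy : y ∈ coreJulia f) :
    0 ≤ refineRadius f r n y ∧ (refineRadius f r n y = 0 ↔ f^[n] y ∈ postSingular f) := by
  induction n generalizing y with
  | zero => exact ⟨(B.bound y hy).1, (B.bound y hy).2.2⟩
  | succ n ih =>
    by_cases hyZ : y ∈ postSingular f
    · rw [refineRadius_succ_of_mem hyZ]
      exact ⟨le_rfl, iff_of_true rfl (iterate_mem_postSingular hyZ _)⟩
    · rw [refineRadius_succ hyZ, Function.iterate_succ_apply]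
      obtain ⟨h1, h2⟩ := ih (h.map_mem hy)
      have hpos := B.pos_of_notMem hy hyZ
      have hs := localScale_pos f y
      refine ⟨le_min hpos.le (div_nonneg h1 hs.le), ?_⟩
      rw [← h2]
      constructor
      · intro he
        rcases min_choice (r y) (refineRadius f r n (f y) / localScale f y) with hm | hm
        · rw [hm] at he; exact absurd he hpos.ne'
        · rw [hm] at he
          exact (div_eq_zero_iff.1 he).resolve_right hs.ne'
      · intro he
        rw [he, zero_div, min_eq_right hpos.le]

theorem IsBaseRadius.refine_succ_le (B : IsBaseRadius f r δ M) (h : IsTame f) (n : ℕ) {y : X}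
    (hy : y ∈ coreJulia f) : refineRadius f r (n + 1) y ≤ refineRadius f r n y := by
  induction n generalizing y with
  | zero =>
    by_cases hyZ : y ∈ postSingular f
    · rw [refineRadius_succ_of_mem hyZ]; exact (B.bound y hy).1
    · rw [refineRadius_succ hyZ]; exact min_le_left _ _
  | succ n ih =>
    by_cases hyZ : y ∈ postSingular f
    · rw [refineRadius_succ_of_mem hyZ, refineRadius_succ_of_mem hyZ]
    · rw [refineRadius_succ hyZ, refineRadius_succ hyZ]
      exact min_le_min_left _ (div_le_div_of_nonneg_right (ih (h.map_mem hy))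
        (localScale_pos f y).le)

theorem IsBaseRadius.refine_anti (B : IsBaseRadius f r δ M) (h : IsTame f) {n m : ℕ}
    (hnm : n ≤ m) {y : X} (hy : y ∈ coreJulia f) :
    refineRadius f r m y ≤ refineRadius f r n y :=
  antitone_nat_of_succ_le (f := fun n => refineRadius f r n y)
    (fun n => B.refine_succ_le h n hy) hnm

theorem IsBaseRadius.localScale_eq (B : IsBaseRadius f r δ M) {y y' : X} (hy : y ∈ coreJulia f)
    (hy' : y' ∈ coreJulia f) (hyZ : y ∉ postSingular f) (hd : dist y' y < r y) :
    localScale f y' = localScale f y :=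
  ((B.scales y hy hyZ).recenter hd).localScale_eq (B.pos_of_notMem hy hyZ) hy'.2

theorem IsBaseRadius.refine_const (B : IsBaseRadius f r δ M) (h : IsTame f) (n : ℕ) {y y' : X}
    (hy : y ∈ coreJulia f) (hy' : y' ∈ coreJulia f) (hd : dist y' y < refineRadius f r n y) :
    refineRadius f r n y' = refineRadius f r n y := by
  induction n generalizing y y' with
  | zero => exact B.const y hy y' hy' hd
  | succ n ih =>
    by_cases hyZ : y ∈ postSingular f
    · rw [refineRadius_succ_of_mem hyZ] at hd
      exact absurd hd (not_lt.2 dist_nonneg)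
    · rw [refineRadius_succ hyZ] at hd ⊢
      have hd1 := hd.trans_le (min_le_left _ _)
      have hr := B.const y hy y' hy' hd1
      have hpos := B.pos_of_notMem hy hyZ
      have hy'Z : y' ∉ postSingular f := fun hm => by
        rw [← (B.bound y' hy').2.2, hr] at hm
        exact hpos.ne' hm
      have hs := B.localScale_eq hy hy' hyZ hd1
      rw [refineRadius_succ hy'Z, hr, hs, ih (h.map_mem hy) (h.map_mem hy')]
      rw [(B.scales y hy hyZ).dist_eq hd1 (by simpa using hpos), mul_comm,
        ← lt_div_iff₀ (localScale_pos f y)]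
      exact hd.trans_le (min_le_right _ _)

theorem IsBaseRadius.scalesBall_iterate (B : IsBaseRadius f r δ M) (h : IsTame f) (n : ℕ) {y : X}
    (hy : y ∈ coreJulia f) {ρ : ℝ} (hρ : 0 < ρ) (hle : ρ ≤ refineRadius f r n y) :
    ScalesBall f^[n + 1] y ρ (iterScale f (n + 1) y) ∧
      iterScale f n y * ρ ≤ r (f^[n] y) := by
  induction n generalizing y ρ with
  | zero =>
    have hle' : ρ ≤ r y := hle
    have hyZ : y ∉ postSingular f := fun hm => by
      rw [← (B.bound y hy).2.2] at hm
      linarith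
    refine ⟨?_, by simpa [iterScale_zero] using hle'⟩
    rw [iterScale_succ, iterScale_zero, mul_one]
    exact (B.scales y hy hyZ).mono hle'
  | succ n ih =>
    have hyZ : y ∉ postSingular f := fun hm => by
      rw [refineRadius_succ_of_mem hm] at hle
      linarith
    rw [refineRadius_succ hyZ] at hle
    have hs := localScale_pos f y
    have h1 := (B.scales y hy hyZ).mono (hle.trans (min_le_left _ _))
    have h2 : localScale f y * ρ ≤ refineRadius f r n (f y) := by
      rw [mul_comm, ← le_div_iff₀ hs]
      exact hle.trans (min_le_right _ _)
    obtain ⟨h3, h4⟩ := ih (h.map_mem hy) (mul_pos hs hρ) h2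
    rw [iterScale_succ' (n + 1) y, iterScale_succ' n y, Function.iterate_succ_apply, mul_assoc]
    exact ⟨h1.comp h3, h4⟩

/-- If the refined radii at a point all exceeded `ε`, its `ε`-ball would be scaled by every iterate,
with constants bounded by means of `M / ε`. Compactness makes the order of refinement uniform. -/
theorem IsBaseRadius.exists_refine_le (B : IsBaseRadius f r δ M) (h : IsTame f) {ε : ℝ}
    (hε : 0 < ε) : ∃ n, ∀ y ∈ coreJulia f, refineRadius f r n y ≤ ε := by
  have hloc : ∀ y ∈ coreJulia f, ∃ n, refineRadius f r n y ≤ ε := by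
    intro y hy
    by_contra hcon
    push Not at hcon
    have hb : ∀ n, iterScale f n y ≤ M / ε := fun n => by
      rw [le_div_iff₀ hε]
      exact (B.scalesBall_iterate h n hy hε (hcon n).le).2.trans
        (B.bound _ (h.iterate_mem hy n)).2.1
    refine not_forall_scalesBall_iterate h.cont h.reg hy hε (M := max 1 (M / ε)) fun n => ?_
    cases n with
    | zero => exact ⟨1, le_max_left _ _, ScalesBall.id y ε⟩
    | succ n => exact ⟨_, (hb _).trans (le_max_right _ _),
        (B.scalesBall_iterate h n hy hε (hcon n).le).1⟩
  choose! n hn using hloc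
  obtain ⟨s, hs, hcov⟩ := (isCompact_coreJulia h.compact).elim_nhds_subcover (fun x => ball x ε)
    fun x _ => ball_mem_nhds x hε
  refine ⟨s.sup n, fun y hy => ?_⟩
  obtain ⟨x, hx, hyx⟩ := Set.mem_iUnion₂.1 (hcov hy)
  refine (B.refine_anti h (Finset.le_sup hx) hy).trans ?_
  -- If the radius at `y` exceeded `ε`, then `x` would lie in the ball of `y` and have the same
  -- radius, which is at most `ε`.
  by_contra hcon
  have hlt := not_le.1 hcon
  have := B.refine_const h (n x) hy (hs x hx) (by
    rw [dist_comm]; exact (mem_ball.1 hyx).trans hlt)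
  rw [← this] at hlt
  exact absurd hlt (not_lt.2 (hn x (hs x hx)))

end

/-- A radius function `r` whose balls are the cells of a Markov partition of the complement of the
finite set of its zeros; the set `N` is a neighbourhood of this finite set, consisting of cells,
that traps no other orbits. -/
structure IsMarkovRadius (f : X → X) (r : X → ℝ) (N : Set X) : Prop where
  nonneg : ∀ y ∈ coreJulia f, 0 ≤ r y
  scales : ∀ y ∈ coreJulia f, r y ≠ 0 → ScalesBall f y (r y) (localScale f y)
  const : ∀ y ∈ coreJulia f, ∀ y' ∈ coreJulia f, dist y' y < r y → r y' = r y
  markov : ∀ y ∈ coreJulia f, r y ≠ 0 → r (f y) ≤ localScale f y * r y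
  zero_map : ∀ y ∈ coreJulia f, r y = 0 → r (f y) = 0
  finite_zero : {y | y ∈ coreJulia f ∧ r y = 0}.Finite
  singular : ∀ y ∈ singularSet f, r y = 0
  mem_iff : ∀ y ∈ coreJulia f, ∀ y' ∈ coreJulia f, dist y' y < r y → (y' ∈ N ↔ y ∈ N)
  nhds : ∀ z ∈ coreJulia f, r z = 0 → ∃ ε : ℝ, 0 < ε ∧ ∀ y ∈ coreJulia f, dist y z < ε → y ∈ N
  compact : IsCompact (coreJulia f \ N)
  trapped : ∀ y ∈ coreJulia f, (∀ i : ℕ, f^[i] y ∈ N) → r y = 0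

/-- The base radius satisfies the Markov inequality near the postsingular set, by exact rescaling.
Elsewhere the images of its balls have radius at least some `ε`, so cutting into cylinders smaller
than `ε` makes the inequality hold everywhere. -/
theorem IsTame.exists_isMarkovRadius (h : IsTame f) :
    ∃ (r : X → ℝ) (N : Set X), IsMarkovRadius f r N := by
  obtain ⟨r, δ, M, B⟩ := h.exists_isBaseRadius
  set N₀ : Set X := ⋃ z ∈ postSingular f, ball z δ with hN₀
  have hN₀open : IsOpen N₀ := isOpen_biUnion fun z _ => isOpen_ball
  have hN₀Z : postSingular f ⊆ N₀ := fun z hz =>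
    Set.mem_iUnion₂.2 ⟨z, hz, mem_ball_self B.pos⟩
  obtain ⟨ε, hε, hεP⟩ : ∃ ε : ℝ, 0 < ε ∧ ∀ x ∈ coreJulia f, x ∉ N₀ →
      ε ≤ localScale f x * r x := by
    have hK : IsCompact (coreJulia f ∩ N₀ᶜ) :=
      (isCompact_coreJulia h.compact).inter_right hN₀open.isClosed_compl
    have hp : ∀ x ∈ coreJulia f ∩ N₀ᶜ, 0 < r x := fun x hx =>
      B.pos_of_notMem hx.1 fun hm => hx.2 (hN₀Z hm)
    obtain ⟨s, hs, hcov⟩ := hK.elim_nhds_subcover (fun x => ball x (r x))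
      fun x hx => ball_mem_nhds x (hp x hx)
    obtain ⟨ε, hε, H⟩ := exists_pos_forall_of_finite s.finite_toSet
      (P := fun x ε => ε ≤ localScale f x * r x) (fun _ _ _ H hst => hst.trans H)
      fun x hx => ⟨_, mul_pos (localScale_pos f x) (hp x (hs x hx)), le_rfl⟩
    refine ⟨ε, hε, fun y hy hyN => ?_⟩
    obtain ⟨x, hx, hyx⟩ := Set.mem_iUnion₂.1 (hcov ⟨hy, hyN⟩)
    have hx' := hs x hx
    rw [B.localScale_eq hx'.1 hy (fun hm => hx'.2 (hN₀Z hm)) hyx, B.const x hx'.1 y hy hyx]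
    exact H x hx
  obtain ⟨n, hn⟩ := B.exists_refine_le h hε
  have hkey : ∀ x ∈ coreJulia f, x ∉ postSingular f →
      refineRadius f r n (f x) ≤ localScale f x * r x := by
    intro x hx hxZ
    by_cases hxN : x ∈ N₀
    · obtain ⟨z, hz, hxz⟩ := Set.mem_iUnion₂.1 hxN
      rw [← B.rescale z hz x hx hxz hxZ]
      exact B.refine_anti h (Nat.zero_le n) (h.map_mem hx)
    · exact (hn _ (h.map_mem hx)).trans (hεP x hx hxN)
  -- The minimum in the refinement is always its second entry, so a ball of order `n + 1` maps
  -- exactly onto a ball of order `n`, which contains the one of order `n + 1`.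
  have hsucc : ∀ x ∈ coreJulia f, x ∉ postSingular f →
      refineRadius f r (n + 1) x = refineRadius f r n (f x) / localScale f x := by
    intro x hx hxZ
    rw [refineRadius_succ hxZ, min_eq_right]
    rw [div_le_iff₀ (localScale_pos f x), mul_comm]
    exact hkey x hx hxZ
  have hzero : ∀ y ∈ coreJulia f,
      (refineRadius f r (n + 1) y = 0 ↔ f^[n + 1] y ∈ postSingular f) :=
    fun y hy => (B.refine_nonneg h (n + 1) hy).2
  have hnotZ : ∀ y, refineRadius f r (n + 1) y ≠ 0 → y ∉ postSingular f := fun y hy hm =>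
    hy (refineRadius_succ_of_mem hm)
  have hN₀cell : ∀ y ∈ coreJulia f, ∀ y' ∈ coreJulia f, dist y' y < r y → (y' ∈ N₀ ↔ y ∈ N₀) := by
    have : ∀ y ∈ coreJulia f, ∀ y' ∈ coreJulia f, dist y' y < r y → y ∈ N₀ → y' ∈ N₀ := by
      intro y hy y' hy' hd hyN
      obtain ⟨z, hz, hyz⟩ := Set.mem_iUnion₂.1 hyN
      refine Set.mem_iUnion₂.2 ⟨z, hz, (dist_triangle_max y' y z).trans_lt (max_lt ?_ hyz)⟩
      -- Otherwise `z` lies in the ball of `y`, so that `r y = r z = 0`.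
      by_contra hcon
      have hzy : dist z y < r y := by
        rw [dist_comm]
        exact (mem_ball.1 hyz).trans_le ((not_lt.1 hcon).trans hd.le)
      have h1 := B.const y hy z (h.postSingular_subset hz) hzy
      rw [((B.bound z (h.postSingular_subset hz)).2.2).2 hz] at h1
      rw [← h1] at hd
      exact absurd hd (not_lt.2 dist_nonneg)
    refine fun y hy y' hy' hd => ⟨fun hm => ?_, this y hy y' hy' hd⟩
    refine this y' hy' y hy ?_ hm
    rw [B.const y hy y' hy' hd, dist_comm]
    exact hd
  refine ⟨refineRadius f r (n + 1), {y | f^[n + 1] y ∈ N₀},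
    { nonneg := fun y hy => (B.refine_nonneg h (n + 1) hy).1
      scales := fun y hy hy0 => (B.scales y hy (hnotZ y hy0)).mono
        (B.refine_anti h (Nat.zero_le _) hy)
      const := fun y hy y' hy' hd => B.refine_const h _ hy hy' hd
      markov := fun y hy hy0 => ?_
      zero_map := fun y hy hy0 => ?_
      finite_zero := ?_
      singular := fun y hy =>
        refineRadius_succ_of_mem (singularSet_subset_postSingular hy)
      mem_iff := fun y hy y' hy' hd => ?_
      nhds := fun z hz hz0 => ?_
      compact := ?_
      trapped := fun y hy hN => ?_ }⟩
  · rw [hsucc y hy (hnotZ y hy0), mul_div_cancel₀ _ (localScale_pos f y).ne']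
    exact B.refine_succ_le h n (h.map_mem hy)
  · rw [hzero y hy] at hy0
    rw [hzero _ (h.map_mem hy), ← Function.iterate_succ_apply, Function.iterate_succ_apply']
    exact map_mem_postSingular hy0
  · refine (h.finite_iterate_preimage h.finite_postSingular (n + 1)).subset ?_
    rintro y ⟨hy, hy0⟩
    exact ⟨hy, (hzero y hy).1 hy0⟩
  · have hpos := dist_nonneg.trans_lt hd
    obtain ⟨h1, h2⟩ := B.scalesBall_iterate h (n + 1) hy hpos le_rfl
    have h3 := (B.scalesBall_iterate h n hy hpos (B.refine_succ_le h n hy)).1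
    refine hN₀cell _ (h.iterate_mem hy _) _ (h.iterate_mem hy' _) ?_
    rw [h3.dist_eq hd (by simpa using hpos)]
    exact (mul_lt_mul_of_pos_left hd (iterScale_pos _ _)).trans_le h2
  · have hm := hN₀Z ((hzero z hz).1 hz0)
    obtain ⟨ε', hε', hsub⟩ := Metric.isOpen_iff.1
      (hN₀open.preimage (h.cont.iterate (n + 1))) z hm
    exact ⟨ε', hε', fun y _ hyz => hsub hyz⟩
  · exact (isCompact_coreJulia h.compact).inter_right
      (hN₀open.preimage (h.cont.iterate (n + 1))).isClosed_compl
  · rw [hzero y hy]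
    by_contra hw
    set w := f^[n + 1] y with hwdef
    have hwN : ∀ i, f^[i] w ∈ N₀ := fun i => by
      have : f^[n + 1] (f^[i] y) ∈ N₀ := hN i
      rwa [← Function.iterate_add_apply, add_comm, Function.iterate_add_apply] at this
    have hwY : w ∈ coreJulia f := h.iterate_mem hy _
    have hpos := B.pos_of_notMem hwY hw
    -- While the orbit stays near the postsingular set, `r` is multiplied by the scaling constants.
    -- Boundedness of `r` thus bounds these constants, contradicting
    -- `not_forall_scalesBall_iterate`.
    have hi : ∀ i, r (f^[i] w) = iterScale f i w * r w ∧
        ScalesBall f^[i] w (r w) (iterScale f i w) := by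
      intro i
      induction i with
      | zero => simpa [iterScale_zero] using ScalesBall.id w (r w)
      | succ i ih =>
        have hYi := h.iterate_mem hwY i
        have hZi : f^[i] w ∉ postSingular f := fun hm => by
          rw [← (B.bound _ hYi).2.2, ih.1] at hm
          exact (mul_pos (iterScale_pos i w) hpos).ne' hm
        obtain ⟨z, hz, hwz⟩ := Set.mem_iUnion₂.1 (hwN i)
        refine ⟨?_, ?_⟩
        · rw [Function.iterate_succ_apply', B.rescale z hz _ hYi hwz hZi, ih.1, iterScale_succ,
            mul_assoc]
        · rw [iterScale_succ]
          refine ih.2.iterate_succ ?_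
          rw [← ih.1]
          exact B.scales _ hYi hZi
    refine not_forall_scalesBall_iterate h.cont h.reg hwY hpos (M := M / r w) fun i =>
      ⟨_, ?_, (hi i).2⟩
    rw [le_div_iff₀ hpos, ← (hi i).1]
    exact (B.bound _ (h.iterate_mem hwY i)).2.1

end NonarchDyn

end
-- Itineraries, and periodic points in returning cylinders.
noncomputable section

namespace NonarchDyn

open Metric

variable {X : Type*} [MetricSpace X] {f : X → X} {r : X → ℝ} {N : Set X}

/-- The points `x` and `x'` have the same itinerary of length `n + 1` with respect to the cells. -/
def SameItinerary (f : X → X) (r : X → ℝ) (n : ℕ) (x x' : X) : Prop :=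
  ∀ i ≤ n, dist (f^[i] x') (f^[i] x) < r (f^[i] x)

theorem sameItinerary_succ {n : ℕ} {x x' : X} :
    SameItinerary f r (n + 1) x x' ↔ dist x' x < r x ∧ SameItinerary f r n (f x) (f x') := by
  constructor
  · intro H
    exact ⟨H 0 (Nat.zero_le _), fun i hi => by
      simpa only [Function.iterate_succ_apply] using H (i + 1) (Nat.succ_le_succ hi)⟩
  · rintro ⟨h0, H⟩ i hi
    cases i with
    | zero => exact h0
    | succ i => exact H i (Nat.le_of_succ_le_succ hi)

/-- `n` is the first return time of `x` to the complement of `N`. -/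
def IsReturnTime (f : X → X) (N : Set X) (n : ℕ) (x : X) : Prop :=
  1 ≤ n ∧ (∀ i, 0 < i → i < n → f^[i] x ∈ N) ∧ f^[n] x ∉ N

theorem IsReturnTime.unique {n m : ℕ} {x : X} (hn : IsReturnTime f N n x)
    (hm : IsReturnTime f N m x) : n = m := by
  rcases lt_trichotomy n m with h | h | h
  · exact absurd (hm.2.1 n hn.1 h) hn.2.2
  · exact h
  · exact absurd (hn.2.1 m hm.1 h) hm.2.2

theorem exists_isReturnTime {m : ℕ} {x : X} (hm : 1 ≤ m) (h : f^[m] x ∉ N) :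
    ∃ n, n ≤ m ∧ IsReturnTime f N n x := by
  classical
  have hex : ∃ n, 1 ≤ n ∧ f^[n] x ∉ N := ⟨m, hm, h⟩
  refine ⟨Nat.find hex, Nat.find_min' hex ⟨hm, h⟩, (Nat.find_spec hex).1, fun i hi hlt => ?_,
    (Nat.find_spec hex).2⟩
  by_contra hcon
  exact Nat.find_min hex hlt ⟨hi, hcon⟩

variable [IsUltrametricDist X]

namespace IsMarkovRadius

variable (h : IsTame f) (R : IsMarkovRadius f r N)

include R in
theorem pos_of_dist_lt {x y : X} (_ : dist y x < r x) : 0 < r x :=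
  dist_nonneg.trans_lt ‹_›

include R in
theorem symm_dist {x x' : X} (hx : x ∈ coreJulia f) (hx' : x' ∈ coreJulia f)
    (hd : dist x' x < r x) : dist x x' < r x' := by
  rw [R.const x hx x' hx' hd, dist_comm]
  exact hd

include R in
theorem trans_dist {x x' x'' : X} (hx : x ∈ coreJulia f) (hx' : x' ∈ coreJulia f)
    (hd : dist x' x < r x) (hd' : dist x'' x' < r x') : dist x'' x < r x := by
  rw [R.const x hx x' hx' hd] at hd'
  exact (dist_triangle_max x'' x' x).trans_lt (max_lt hd' hd)

include h R in
theorem same_symm {n : ℕ} {x x' : X} (hx : x ∈ coreJulia f) (hx' : x' ∈ coreJulia f)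
    (H : SameItinerary f r n x x') : SameItinerary f r n x' x := fun i hi =>
  R.symm_dist (h.iterate_mem hx i) (h.iterate_mem hx' i) (H i hi)

include h R in
theorem same_trans {n : ℕ} {x x' x'' : X} (hx : x ∈ coreJulia f) (hx' : x' ∈ coreJulia f)
    (H : SameItinerary f r n x x') (H' : SameItinerary f r n x' x'') :
    SameItinerary f r n x x'' := fun i hi =>
  R.trans_dist (h.iterate_mem hx i) (h.iterate_mem hx' i) (H i hi) (H' i hi)

include h R in
theorem ne_zero_of_map {x : X} (hx : x ∈ coreJulia f) {n : ℕ} (hn : r (f^[n] x) ≠ 0) {i : ℕ}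
    (hi : i ≤ n) : r (f^[i] x) ≠ 0 := by
  intro h0
  apply hn
  obtain ⟨k, rfl⟩ := Nat.exists_eq_add_of_le hi
  clear hn hi
  induction k with
  | zero => exact h0
  | succ k ih =>
    rw [← Nat.add_assoc, Function.iterate_succ_apply']
    exact R.zero_map _ (h.iterate_mem hx _) ih

include h R in
-- The Markov inequality allows pulling back one cell at a time: the image of each cell contains the
-- whole next cell of the itinerary. With `same_inj` this gives inverse branches of `f^[n]`.
theorem exists_same {n : ℕ} {x y : X} (hx : x ∈ coreJulia f) (hy : y ∈ coreJulia f)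
    (hd : dist y (f^[n] x) < r (f^[n] x)) :
    ∃ x' ∈ coreJulia f, SameItinerary f r n x x' ∧ f^[n] x' = y := by
  induction n generalizing x with
  | zero =>
    refine ⟨y, hy, fun i hi => ?_, rfl⟩
    obtain rfl := Nat.le_zero.1 hi
    exact hd
  | succ n ih =>
    have hx0 : r x ≠ 0 := R.ne_zero_of_map h hx (R.pos_of_dist_lt hd).ne' (Nat.zero_le _)
    obtain ⟨w, hw, hsame, hwy⟩ := ih (h.map_mem hx) hd
    have hS := R.scales x hx hx0
    obtain ⟨x', hx', rfl⟩ := hS.exists_preimage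
      ((hsame 0 (Nat.zero_le _)).trans_le (R.markov x hx hx0))
    exact ⟨x', (hS.mem_coreJulia_iff_of_self hx').2 hw, sameItinerary_succ.2 ⟨hx', hsame⟩, hwy⟩

include h R in
theorem same_inj {n : ℕ} {x x' x'' : X} (hx : x ∈ coreJulia f)
    (H' : SameItinerary f r n x x') (H'' : SameItinerary f r n x x'')
    (he : f^[n] x' = f^[n] x'') : x' = x'' := by
  induction n generalizing x x' x'' with
  | zero => exact he
  | succ n ih =>
    rw [sameItinerary_succ] at H' H''
    exact (R.scales x hx (R.pos_of_dist_lt H'.1).ne').injOn H'.1 H''.1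
      (ih (h.map_mem hx) H'.2 H''.2 he)

include h R in
theorem same_dist {n : ℕ} {x x' : X} (hx : x ∈ coreJulia f) (H : SameItinerary f r n x x') :
    dist (f^[n] x') (f^[n] x) = iterScale f n x * dist x' x := by
  induction n generalizing x x' with
  | zero => simp [iterScale_zero]
  | succ n ih =>
    rw [sameItinerary_succ] at H
    have hpos := R.pos_of_dist_lt H.1
    rw [Function.iterate_succ_apply, Function.iterate_succ_apply, ih (h.map_mem hx) H.2,
      iterScale_succ', (R.scales x hx hpos.ne').dist_eq H.1 (by simpa using hpos), mul_assoc]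

include h R in
theorem same_iterScale {n : ℕ} {x x' : X} (hx : x ∈ coreJulia f) (hx' : x' ∈ coreJulia f)
    (H : SameItinerary f r n x x') : iterScale f n x' = iterScale f n x := by
  induction n generalizing x x' with
  | zero => simp [iterScale_zero]
  | succ n ih =>
    rw [sameItinerary_succ] at H
    have hpos := R.pos_of_dist_lt H.1
    rw [iterScale_succ', iterScale_succ', ih (h.map_mem hx) (h.map_mem hx') H.2,
      ((R.scales x hx hpos.ne').recenter H.1).localScale_eq hpos hx'.2]

include h R in
theorem le_iterScale_mul {n : ℕ} {x : X} (hx : x ∈ coreJulia f) (hn : r (f^[n] x) ≠ 0) :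
    r (f^[n] x) ≤ iterScale f n x * r x := by
  induction n with
  | zero => simp [iterScale_zero]
  | succ n ih =>
    have h0 := R.ne_zero_of_map h hx hn (Nat.le_succ n)
    rw [Function.iterate_succ_apply', iterScale_succ, mul_assoc]
    exact (R.markov _ (h.iterate_mem hx n) h0).trans
      (mul_le_mul_of_nonneg_left (ih h0) (localScale_pos _ _).le)

include h R in
theorem scalesBall_iterate {n : ℕ} {x : X} (hx : x ∈ coreJulia f) (hn : r (f^[n] x) ≠ 0) :
    ScalesBall f^[n] x (r (f^[n] x) / iterScale f n x) (iterScale f n x) := by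
  induction n with
  | zero => simpa [iterScale_zero] using ScalesBall.id x (r x)
  | succ n ih =>
    have h0 := R.ne_zero_of_map h hx hn (Nat.le_succ n)
    have hY := h.iterate_mem hx n
    have hm := R.markov _ hY h0
    have hp := iterScale_pos (f := f) n x
    have hs := localScale_pos f (f^[n] x)
    rw [Function.iterate_succ_apply'] at hn ⊢
    rw [iterScale_succ]
    have hle : r (f (f^[n] x)) / (localScale f (f^[n] x) * iterScale f n x) ≤
        r (f^[n] x) / iterScale f n x := by
      rw [div_le_div_iff₀ (mul_pos hs hp) hp]
      calc _ ≤ (localScale f (f^[n] x) * r (f^[n] x)) * iterScale f n x :=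
            mul_le_mul_of_nonneg_right hm hp.le
        _ = _ := by ring
    refine ((ih h0).mono hle).iterate_succ ((R.scales _ hY h0).mono ?_)
    calc _ ≤ iterScale f n x * (r (f^[n] x) / iterScale f n x) :=
          mul_le_mul_of_nonneg_left hle hp.le
      _ = _ := mul_div_cancel₀ _ hp.ne'

include R in
theorem notMem_ne_zero {y : X} (hy : y ∈ coreJulia f) (hyN : y ∉ N) : r y ≠ 0 := by
  intro h0
  obtain ⟨ε, hε, H⟩ := R.nhds y hy h0
  exact hyN (H y hy (by simpa using hε))

include R in
theorem pos_of_notMem {y : X} (hy : y ∈ coreJulia f) (hyN : y ∉ N) : 0 < r y :=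
  lt_of_le_of_ne (R.nonneg y hy) (R.notMem_ne_zero hy hyN).symm

include h R in
theorem isReturnTime_iff {n m : ℕ} (hnm : n ≤ m) {x x' : X} (hx : x ∈ coreJulia f)
    (hx' : x' ∈ coreJulia f) (H : SameItinerary f r m x x') :
    IsReturnTime f N n x' ↔ IsReturnTime f N n x := by
  have hN : ∀ i ≤ n, (f^[i] x' ∈ N ↔ f^[i] x ∈ N) := fun i hi =>
    R.mem_iff _ (h.iterate_mem hx i) _ (h.iterate_mem hx' i) (H i (hi.trans hnm))
  refine and_congr_right fun _ => and_congr ?_ (not_congr (hN n le_rfl))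
  exact forall_congr' fun i => forall_congr' fun _ => forall_congr' fun hi => hN i hi.le

include R in
theorem dist_lt_iff {a x x' : X} (ha : a ∈ coreJulia f) (hx : x ∈ coreJulia f)
    (hx' : x' ∈ coreJulia f) (hd : dist x' x < r x) : dist x' a < r a ↔ dist x a < r a :=
  ⟨fun H => R.trans_dist ha hx' H (R.symm_dist hx hx' hd), fun H => R.trans_dist ha hx H hd⟩

include h R in
/-- The number of preimages of a point satisfying a property that depends only on the itinerary
does not change within a cell. -/
theorem ncard_preimage_eq {n : ℕ} {P : X → Prop} {b y : X} (hb : b ∈ coreJulia f)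
    (hy : y ∈ coreJulia f) (hd : dist y b < r b)
    (hP : ∀ x ∈ coreJulia f, ∀ x' ∈ coreJulia f, SameItinerary f r n x x' → (P x' ↔ P x)) :
    {x | x ∈ coreJulia f ∧ P x ∧ f^[n] x = y}.ncard =
      {x | x ∈ coreJulia f ∧ P x ∧ f^[n] x = b}.ncard := by
  have hd' := R.symm_dist hb hy hd
  have hex : ∀ x ∈ {x | x ∈ coreJulia f ∧ P x ∧ f^[n] x = y}, ∃ x' ∈ coreJulia f,
      SameItinerary f r n x x' ∧ f^[n] x' = b := by
    rintro x ⟨hx, -, rfl⟩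
    exact R.exists_same h hx hb hd'
  choose! g hgY hgS hgb using hex
  refine Set.ncard_congr (fun x _ => g x) (fun x hx => ?_) (fun x x' hx hx' he => ?_) ?_
  · exact ⟨hgY x hx, (hP x hx.1 _ (hgY x hx) (hgS x hx)).2 hx.2.1, hgb x hx⟩
  · refine R.same_inj h (hgY x hx) (R.same_symm h hx.1 (hgY x hx) (hgS x hx)) ?_
      (hx.2.2.trans hx'.2.2.symm)
    have := R.same_symm h hx'.1 (hgY x' hx') (hgS x' hx')
    rwa [← he] at this
  · rintro x' ⟨hx', hPx', rfl⟩
    obtain ⟨x, hx, hS, rfl⟩ := R.exists_same h hx' hy hd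
    have hxm : x ∈ {x_1 | x_1 ∈ coreJulia f ∧ P x_1 ∧ f^[n] x_1 = f^[n] x} :=
      ⟨hx, (hP x' hx' x hx hS).2 hPx', rfl⟩
    exact ⟨x, hxm, R.same_inj h hx (hgS x hxm) (R.same_symm h hx' hx hS) (hgb x hxm)⟩

include h R in
-- The Markov inequality gives a constant at least `1`. Equality would make `f^[m]` preserve
-- distances on the cell and map it to itself, so all iterates would scale it with bounded
-- constants.
theorem one_lt_iterScale_of_return {m : ℕ} (hm : 1 ≤ m) {x a : X} (hx : x ∈ coreJulia f)
    (ha : a ∈ coreJulia f) (hxa : dist x a < r a) (hmx : f^[m] x = a) : 1 < iterScale f m x := by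
  have ha0 : 0 < r a := R.pos_of_dist_lt hxa
  have hrx : r x = r a := R.const a ha x hx hxa
  have hne : r (f^[m] x) ≠ 0 := by rw [hmx]; exact ha0.ne'
  have h1 : 1 ≤ iterScale f m x := by
    have := R.le_iterScale_mul h hx hne
    rw [hmx, hrx] at this
    exact (le_mul_iff_one_le_left ha0).1 this
  refine lt_of_le_of_ne h1 fun heq => ?_
  -- The constants of the two pieces `f^[i]` and `f^[m - i]` of the return multiply to `1`; the
  -- Markov inequality for the second piece then shows that the first scales the full radius `r a`.
  have Hi : ∀ i ≤ m, ScalesBall f^[i] x (r a) (iterScale f i x) := by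
    intro i hi
    have hi0 := R.ne_zero_of_map h hx hne hi
    refine (R.scalesBall_iterate h hx hi0).mono ?_
    obtain ⟨k, rfl⟩ := Nat.exists_eq_add_of_le' hi
    have h2 : r (f^[k] (f^[i] x)) ≤ iterScale f k (f^[i] x) * r (f^[i] x) :=
      R.le_iterScale_mul h (h.iterate_mem hx i)
        (by rw [← Function.iterate_add_apply]; exact hne)
    rw [← Function.iterate_add_apply, hmx] at h2
    have h3 : iterScale f k (f^[i] x) * iterScale f i x = 1 := by
      rw [heq]
      clear * -
      induction k with
      | zero => simp [iterScale_zero]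
      | succ k ih =>
        rw [iterScale_succ, mul_assoc, ih, ← Function.iterate_add_apply, ← iterScale_succ,
          Nat.add_right_comm]
    rw [le_div_iff₀ (iterScale_pos _ _)]
    calc _ ≤ iterScale f k (f^[i] x) * r (f^[i] x) * iterScale f i x :=
          mul_le_mul_of_nonneg_right h2 (iterScale_pos _ _).le
      _ = iterScale f k (f^[i] x) * iterScale f i x * r (f^[i] x) := by ring
      _ = _ := by rw [h3, one_mul]
  have hax : dist a x < r a := by rw [dist_comm]; exact hxa
  have hm1 : ∀ u, dist u a < r a → ScalesBall f^[m] u (r a) 1 := fun u hu => by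
    have := (Hi m le_rfl).recenter ((dist_triangle_max u a x).trans_lt (max_lt hu hax))
    rwa [← heq] at this
  have hball : ∀ u, dist u a < r a → dist (f^[m] u) a < r a := fun u hu => by
    have := (Hi m le_rfl).dist_lt ((dist_triangle_max u a x).trans_lt (max_lt hu hax))
    rwa [← heq, hmx, one_mul] at this
  have hk : ∀ k, ScalesBall f^[m * k] a (r a) 1 ∧ dist (f^[m * k] a) a < r a := by
    intro k
    induction k with
    | zero => exact ⟨by simpa using ScalesBall.id a (r a), by simpa using ha0⟩
    | succ k ih =>
      have := ih.1.iterate_add (m := m) (C' := 1) (by rw [one_mul]; exact hm1 _ ih.2)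
      rw [add_comm, ← Nat.mul_succ, one_mul] at this
      refine ⟨this, ?_⟩
      rw [Nat.mul_succ, add_comm, Function.iterate_add_apply]
      exact hball _ ih.2
  refine not_forall_scalesBall_iterate h.cont h.reg ha ha0
    (M := ∑ i ∈ Finset.range (m + 1), iterScale f i x) fun n => ?_
  have hmod : n % m ≤ m := (Nat.mod_lt n hm).le
  have h2 := (hk (n / m)).1.iterate_add (m := n % m) (C' := iterScale f (n % m) x) (by
    rw [one_mul]
    exact (Hi _ hmod).recenter
      ((dist_triangle_max _ a x).trans_lt (max_lt (hk (n / m)).2 hax)))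
  rw [Nat.mod_add_div, mul_one] at h2
  exact ⟨_, Finset.single_le_sum (f := fun i => iterScale f i x)
      (fun i _ => (iterScale_pos i x).le) (Finset.mem_range.2 (Nat.lt_succ_of_le hmod)), h2⟩

include h R in
-- The inverse branch of the return is a strict contraction of the compact cylinder, so a point
-- minimising `dist (f^[m] y) y` is fixed: its image under that branch would otherwise do better.
theorem exists_fixed_same {m : ℕ} (hm : 1 ≤ m) {x a : X} (hx : x ∈ coreJulia f)
    (ha : a ∈ coreJulia f) (hxa : dist x a < r a) (hmx : f^[m] x = a) :
    ∃ y ∈ coreJulia f, SameItinerary f r m x y ∧ f^[m] y = y := by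
  have ha0 : 0 < r a := R.pos_of_dist_lt hxa
  have hne : r (f^[m] x) ≠ 0 := by rw [hmx]; exact ha0.ne'
  set C : Set X := coreJulia f ∩
    ⋂ i ∈ Set.Iic m, f^[i] ⁻¹' ball (f^[i] x) (r (f^[i] x)) with hC
  have hCmem : ∀ y, y ∈ C ↔ y ∈ coreJulia f ∧ SameItinerary f r m x y := fun y =>
    and_congr_right fun _ => Set.mem_iInter₂
  have hCc : IsCompact C := (isCompact_coreJulia h.compact).inter_right
    (isClosed_biInter fun i _ => (IsUltrametricDist.isClosed_ball _ _).preimage (h.cont.iterate i))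
  have hxC : x ∈ C := (hCmem x).2 ⟨hx, fun i hi => by
    rw [dist_self]
    exact lt_of_le_of_ne (R.nonneg _ (h.iterate_mem hx i)) (R.ne_zero_of_map h hx hne hi).symm⟩
  have hcont : Continuous fun y => dist (f^[m] y) y := (h.cont.iterate m).dist continuous_id
  obtain ⟨y, hyC, hmin⟩ := hCc.exists_isMinOn ⟨x, hxC⟩ hcont.continuousOn
  obtain ⟨hy, hyS⟩ := (hCmem y).1 hyC
  refine ⟨y, hy, hyS, ?_⟩
  have hya : dist y (f^[m] x) < r (f^[m] x) := by
    rw [hmx]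
    exact R.trans_dist ha hx hxa (hyS 0 (Nat.zero_le _))
  obtain ⟨y', hy', hS', he⟩ := R.exists_same h hx hy hya
  have hle : dist (f^[m] y) y ≤ dist (f^[m] y') y' := hmin ((hCmem y').2 ⟨hy', hS'⟩)
  have hd := R.same_dist h hy' (R.same_trans h hy' hx (R.same_symm h hx hy' hS') hyS)
  have hL := R.one_lt_iterScale_of_return h hm hx ha hxa hmx
  rw [R.same_iterScale h hx hy' hS', he, dist_comm y y'] at hd
  rw [he, dist_comm y y'] at hle
  by_contra hcon
  have hpos : 0 < dist (f^[m] y) y := dist_pos.2 hcon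
  nlinarith [dist_nonneg (x := y') (y := y)]

include h R in
/-- In each cylinder returning to its cell there is exactly one periodic point. -/
theorem ncard_fixed_eq {m n : ℕ} (hm : 1 ≤ m) (hnm : n ≤ m) {a : X} (ha : a ∈ coreJulia f) :
    {x | x ∈ coreJulia f ∧ dist x a < r a ∧ IsReturnTime f N n x ∧ f^[m] x = x}.ncard =
      {x | x ∈ coreJulia f ∧ dist x a < r a ∧ IsReturnTime f N n x ∧ f^[m] x = a}.ncard := by
  have hex : ∀ x ∈ {x | x ∈ coreJulia f ∧ dist x a < r a ∧ IsReturnTime f N n x ∧ f^[m] x = x},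
      ∃ x' ∈ coreJulia f, SameItinerary f r m x x' ∧ f^[m] x' = a := by
    rintro x ⟨hx, hxa, -, hfix⟩
    refine R.exists_same h hx ha ?_
    rw [hfix]
    exact R.symm_dist ha hx hxa
  choose! g hgY hgS hga using hex
  refine Set.ncard_congr (fun x _ => g x) (fun x hx => ?_) (fun x x' hx hx' he => ?_) ?_
  · exact ⟨hgY x hx, (R.dist_lt_iff ha hx.1 (hgY x hx) (hgS x hx 0 (Nat.zero_le _))).2 hx.2.1,
      (R.isReturnTime_iff h hnm hx.1 (hgY x hx) (hgS x hx)).2 hx.2.2.1, hga x hx⟩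
  · have h1 := R.same_symm h hx'.1 (hgY x' hx') (hgS x' hx')
    rw [← he] at h1
    have h2 := R.same_dist h hx.1 (R.same_trans h hx.1 (hgY x hx) (hgS x hx) h1)
    rw [hx.2.2.2, hx'.2.2.2] at h2
    obtain ⟨-, -, -, h3⟩ := one_lt_iterScale_of_periodic h.cont h.reg h.subhyp h.normal hx.1 hm
      hx.2.2.2
    by_contra hne
    have hpos : 0 < dist x' x := dist_pos.2 fun e => hne e.symm
    nlinarith
  · rintro x' ⟨hx', hx'a, hret, hfa⟩
    obtain ⟨y, hy, hyS, hfix⟩ := R.exists_fixed_same h hm hx' ha hx'a hfa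
    have hym : y ∈ {x | x ∈ coreJulia f ∧ dist x a < r a ∧ IsReturnTime f N n x ∧ f^[m] x = x} :=
      ⟨hy, (R.dist_lt_iff ha hx' hy (hyS 0 (Nat.zero_le _))).2 hx'a,
        (R.isReturnTime_iff h hnm hx' hy hyS).2 hret, hfix⟩
    exact ⟨y, hym, R.same_inj h hy (hgS y hym) (R.same_symm h hx' hy hyS)
      ((hga y hym).trans hfa.symm)⟩

end IsMarkovRadius

end NonarchDyn

end
-- Counting transitions and periodic points by first returns.
noncomputable section

namespace NonarchDyn

open Metric Finset

theorem sum_eq_sum_sum_filter {α β : Type*} {S : Finset α} {T : Finset β} (P : α → β → Prop)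
    [∀ x p, Decidable (P x p)] (h : ∀ x ∈ S, ∃ p ∈ T, P x p ∧ ∀ p' ∈ T, P x p' → p' = p)
    (g : α → ℕ) : ∑ x ∈ S, g x = ∑ p ∈ T, ∑ x ∈ S with P x p, g x := by
  simp_rw [sum_filter]
  rw [sum_comm]
  refine sum_congr rfl fun x hx => ?_
  obtain ⟨p, hp, hP, huniq⟩ := h x hx
  rw [sum_eq_single p (fun p' hp' hne => if_neg fun hP' => hne (huniq p' hp' hP'))
    fun hn => absurd hp hn, if_pos hP]

theorem card_eq_sum_card_filter {α β : Type*} {S : Finset α} {T : Finset β} (P : α → β → Prop)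
    [∀ x p, Decidable (P x p)] (h : ∀ x ∈ S, ∃ p ∈ T, P x p ∧ ∀ p' ∈ T, P x p' → p' = p) :
    S.card = ∑ p ∈ T, (S.filter (P · p)).card := by
  simpa using sum_eq_sum_sum_filter P h fun _ => 1

variable {X : Type*} [MetricSpace X] {f : X → X} {r : X → ℝ} {N : Set X}

/-- A representative of the cell of `y`, depending only on the cell. -/
def cellRep (f : X → X) (r : X → ℝ) (y : X) : X :=
  @Classical.epsilon X ⟨y⟩ fun u => u ∈ {u | u ∈ coreJulia f ∧ dist u y < r y}

/-- The points of the cell of `a` with first return time `n` whose `n`-th image is `b`. -/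
def returnSet (f : X → X) (r : X → ℝ) (N : Set X) (a b : X) (n : ℕ) : Set X :=
  {x | x ∈ coreJulia f ∧ (dist x a < r a ∧ IsReturnTime f N n x) ∧ f^[n] x = b}

/-- The points of the cell of `a` whose `m`-th image is `b`. -/
def transitSet (f : X → X) (r : X → ℝ) (a b : X) (m : ℕ) : Set X :=
  {x | x ∈ coreJulia f ∧ dist x a < r a ∧ f^[m] x = b}

variable [IsUltrametricDist X]

namespace IsMarkovRadius

variable (h : IsTame f) (R : IsMarkovRadius f r N)

include R in
theorem cellRep_spec {y : X} (hy : y ∈ coreJulia f) (hy0 : 0 < r y) :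
    cellRep f r y ∈ coreJulia f ∧ dist (cellRep f r y) y < r y :=
  Classical.epsilon_spec (p := fun u => u ∈ {u | u ∈ coreJulia f ∧ dist u y < r y})
    ⟨y, hy, by simpa using hy0⟩

include R in
theorem cellRep_eq {y y' : X} (hy : y ∈ coreJulia f) (hy' : y' ∈ coreJulia f)
    (hd : dist y' y < r y) : cellRep f r y' = cellRep f r y := by
  have : {u | u ∈ coreJulia f ∧ dist u y' < r y'} = {u | u ∈ coreJulia f ∧ dist u y < r y} := by
    ext u
    refine and_congr_right fun _ => ⟨fun hu => R.trans_dist hy hy' hd hu, fun hu =>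
      R.trans_dist hy' hy (R.symm_dist hy hy' hd) hu⟩
  unfold cellRep
  rw [this]

include h R in
theorem finite_cellRep : (cellRep f r '' (coreJulia f \ N)).Finite := by
  obtain ⟨s, hs, hcov⟩ := R.compact.elim_nhds_subcover (fun x => ball x (r x))
    fun x hx => ball_mem_nhds x (R.pos_of_notMem hx.1 hx.2)
  refine (s.finite_toSet.image (cellRep f r)).subset ?_
  rintro _ ⟨y, hy, rfl⟩
  obtain ⟨x, hx, hyx⟩ := Set.mem_iUnion₂.1 (hcov hy)
  exact ⟨x, hx, (R.cellRep_eq (hs x hx).1 hy.1 hyx).symm⟩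

/-- The finite set of representatives of the cells outside `N`. -/
def cells : Finset X := (R.finite_cellRep h).toFinset

include h R in
theorem mem_cells {a : X} (ha : a ∈ R.cells h) :
    a ∈ coreJulia f ∧ a ∉ N ∧ 0 < r a ∧ cellRep f r a = a := by
  obtain ⟨y, ⟨hy, hyN⟩, rfl⟩ := (Set.Finite.mem_toFinset _).1 ha
  obtain ⟨h1, h2⟩ := R.cellRep_spec hy (R.pos_of_notMem hy hyN)
  have h3 := (R.mem_iff y hy _ h1 h2).not.2 hyN
  exact ⟨h1, h3, R.pos_of_notMem h1 h3, R.cellRep_eq hy h1 h2⟩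

include h R in
theorem cellRep_mem {y : X} (hy : y ∈ coreJulia f) (hyN : y ∉ N) :
    cellRep f r y ∈ R.cells h ∧ dist y (cellRep f r y) < r (cellRep f r y) := by
  obtain ⟨h1, h2⟩ := R.cellRep_spec hy (R.pos_of_notMem hy hyN)
  exact ⟨(Set.Finite.mem_toFinset _).2 ⟨y, ⟨hy, hyN⟩, rfl⟩, R.symm_dist hy h1 h2⟩

include h R in
theorem cellRep_eq_iff {y a : X} (hy : y ∈ coreJulia f) (hyN : y ∉ N) (ha : a ∈ R.cells h) :
    cellRep f r y = a ↔ dist y a < r a := by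
  obtain ⟨ha1, -, -, ha3⟩ := R.mem_cells h ha
  constructor
  · rintro rfl
    exact (R.cellRep_mem h hy hyN).2
  · intro hd
    rw [R.cellRep_eq ha1 hy hd, ha3]

include h R in
theorem notMem_of_dist_lt {y a : X} (hy : y ∈ coreJulia f) (ha : a ∈ R.cells h)
    (hd : dist y a < r a) : y ∉ N := by
  obtain ⟨ha1, ha2, -⟩ := R.mem_cells h ha
  exact (R.mem_iff a ha1 y hy hd).not.2 ha2

include h in
theorem finite_transitSet (a b : X) (m : ℕ) : (transitSet f r a b m).Finite :=
  (h.finite_iterate_preimage (Set.finite_singleton b) m).subset fun _ hx => ⟨hx.1, hx.2.2⟩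

include h R in
theorem ncard_returnSet_eq {a b y : X} {n : ℕ} (ha : a ∈ coreJulia f) (hb : b ∈ coreJulia f)
    (hy : y ∈ coreJulia f) (hd : dist y b < r b) :
    (returnSet f r N a y n).ncard = (returnSet f r N a b n).ncard :=
  R.ncard_preimage_eq h (P := fun x => dist x a < r a ∧ IsReturnTime f N n x) hb hy hd
    fun _ hx _ hx' hS => and_congr (R.dist_lt_iff ha hx hx' (hS 0 (Nat.zero_le _)))
      (R.isReturnTime_iff h le_rfl hx hx' hS)

include h R in
-- Cut the orbit at the first return: the number of ways to reach `f^[n] x` depends only on its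
-- cell, so the point may be replaced by the representative `e`.
theorem ncard_transit_return {a b : X} (ha : a ∈ R.cells h) {n m : ℕ}
    (hnm : n ≤ m) :
    {x | x ∈ coreJulia f ∧ dist x a < r a ∧ IsReturnTime f N n x ∧ f^[m] x = b}.ncard =
      ∑ e ∈ R.cells h, (returnSet f r N a e n).ncard * (transitSet f r e b (m - n)).ncard := by
  classical
  obtain ⟨k, rfl⟩ := Nat.exists_eq_add_of_le' hnm
  rw [Nat.add_sub_cancel]
  have ha1 := (R.mem_cells h ha).1
  have hSfin : {x | x ∈ coreJulia f ∧ dist x a < r a ∧ IsReturnTime f N n x ∧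
      f^[k + n] x = b}.Finite :=
    (finite_transitSet h a b (k + n)).subset fun x hx => ⟨hx.1, hx.2.1, hx.2.2.2⟩
  have hTfin : {y | y ∈ coreJulia f ∧ y ∉ N ∧ f^[k] y = b}.Finite :=
    (h.finite_iterate_preimage (Set.finite_singleton b) k).subset fun _ hx => ⟨hx.1, hx.2.2⟩
  rw [Set.ncard_eq_toFinset_card _ hSfin,
    card_eq_sum_card_fiberwise (f := f^[n]) (t := hTfin.toFinset) (by
      intro x hx
      obtain ⟨h1, h2, h3, h4⟩ := (Set.Finite.mem_toFinset _).1 (mem_coe.1 hx)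
      rw [Function.iterate_add_apply] at h4
      exact mem_coe.2 ((Set.Finite.mem_toFinset _).2 ⟨h.iterate_mem h1 n, h3.2.2, h4⟩))]
  have hfib : ∀ y ∈ hTfin.toFinset, (hSfin.toFinset.filter fun x => f^[n] x = y).card =
      (returnSet f r N a (cellRep f r y) n).ncard := by
    intro y hy
    obtain ⟨h1, h2, h3⟩ := (Set.Finite.mem_toFinset _).1 hy
    obtain ⟨h4, h5⟩ := R.cellRep_mem h h1 h2
    rw [← R.ncard_returnSet_eq h ha1 (R.mem_cells h h4).1 h1 h5, ← Set.ncard_coe_finset]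
    congr 1
    ext x
    simp only [coe_filter, Set.Finite.mem_toFinset, Set.mem_ofPred_eq, returnSet]
    constructor
    · rintro ⟨⟨g1, g2, g3, -⟩, g4⟩
      exact ⟨g1, ⟨g2, g3⟩, g4⟩
    · rintro ⟨g1, ⟨g2, g3⟩, g4⟩
      exact ⟨⟨g1, g2, g3, by rw [Function.iterate_add_apply, g4, h3]⟩, g4⟩
  rw [sum_congr rfl hfib, ← sum_fiberwise_of_maps_to (t := R.cells h) (g := cellRep f r)]
  · refine sum_congr rfl fun e he => ?_
    rw [sum_congr rfl (g := fun _ => (returnSet f r N a e n).ncard) fun y hy => by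
      rw [(mem_filter.1 hy).2], sum_const, smul_eq_mul, mul_comm]
    congr 1
    rw [← Set.ncard_coe_finset]
    congr 1
    ext y
    simp only [coe_filter, Set.Finite.mem_toFinset, Set.mem_ofPred_eq, transitSet]
    constructor
    · rintro ⟨⟨g1, g2, g3⟩, g4⟩
      exact ⟨g1, (R.cellRep_eq_iff h g1 g2 he).1 g4, g3⟩
    · rintro ⟨g1, g2, g3⟩
      have g4 := R.notMem_of_dist_lt h g1 he g2
      exact ⟨⟨g1, g4, g3⟩, (R.cellRep_eq_iff h g1 g4 he).2 g2⟩
  · intro y hy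
    obtain ⟨h1, h2, -⟩ := (Set.Finite.mem_toFinset _).1 hy
    exact (R.cellRep_mem h h1 h2).1

include h R in
/-- Decomposition of transitions according to the first return. -/
theorem ncard_transitSet_eq {a b : X} (ha : a ∈ R.cells h) (hb : b ∈ R.cells h) {m : ℕ}
    (hm : 1 ≤ m) :
    (transitSet f r a b m).ncard = ∑ n ∈ Icc 1 m, ∑ e ∈ R.cells h,
      (returnSet f r N a e n).ncard * (transitSet f r e b (m - n)).ncard := by
  classical
  have hfin := finite_transitSet (r := r) h a b m
  rw [Set.ncard_eq_toFinset_card _ hfin,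
    card_eq_sum_card_filter (T := Icc 1 m) (fun x n => IsReturnTime f N n x)]
  · refine sum_congr rfl fun n hn => ?_
    rw [← R.ncard_transit_return h ha (mem_Icc.1 hn).2, ← Set.ncard_coe_finset]
    congr 1
    ext x
    simp only [coe_filter, Set.Finite.mem_toFinset, Set.mem_ofPred_eq, transitSet]
    tauto
  · intro x hx
    obtain ⟨-, -, hxb⟩ := (Set.Finite.mem_toFinset _).1 hx
    obtain ⟨n, hnm, hn⟩ := exists_isReturnTime (f := f) (N := N) (x := x) hm (by
      rw [hxb]; exact (R.mem_cells h hb).2.1)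
    exact ⟨n, mem_Icc.2 ⟨hn.1, hnm⟩, hn, fun p _ hp => hp.unique hn⟩

include h R in
theorem ncard_transitSet_zero {a b : X} (ha : a ∈ R.cells h) (hb : b ∈ R.cells h)
    [Decidable (a = b)] :
    (transitSet f r a b 0).ncard = if a = b then 1 else 0 := by
  obtain ⟨hb1, hb2, hb3, hb4⟩ := R.mem_cells h hb
  split_ifs with hab
  · subst hab
    rw [Set.ncard_eq_one]
    refine ⟨a, Set.eq_singleton_iff_unique_mem.2 ⟨⟨hb1, by simpa using hb3, rfl⟩, ?_⟩⟩
    rintro x ⟨-, -, rfl⟩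
    rfl
  · have : transitSet f r a b 0 = ∅ := by
      refine Set.eq_empty_of_forall_notMem ?_
      rintro x ⟨-, hd, rfl⟩
      refine hab ?_
      have h1 := (R.cellRep_eq_iff h hb1 hb2 ha).2 hd
      exact h1.symm.trans hb4
    rw [this, Set.ncard_empty]

include h R in
-- One application of `f` is injective on a cell. Hence direct edges between cells have multiplicity
-- at most one and need no auxiliary vertices in the final graph.
theorem ncard_returnSet_one_le {a b : X} (ha : a ∈ R.cells h) :
    (returnSet f r N a b 1).ncard ≤ 1 := by
  obtain ⟨ha1, ha2, ha3, -⟩ := R.mem_cells h ha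
  refine (Set.ncard_le_one (Set.Finite.subset (finite_transitSet (r := r) h a b 1)
    fun x hx => ⟨hx.1, hx.2.1.1, hx.2.2⟩)).2 ?_
  rintro x ⟨-, ⟨hx, -⟩, hxb⟩ x' ⟨-, ⟨hx', -⟩, hxb'⟩
  exact (R.scales a ha1 ha3.ne').injOn hx hx' (hxb.trans hxb'.symm)

theorem returnSet_zero (a b : X) : returnSet f r N a b 0 = ∅ := by
  refine Set.eq_empty_of_forall_notMem ?_
  rintro x ⟨-, ⟨-, hx⟩, -⟩
  exact absurd hx.1 (by norm_num)

include h R in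
/-- The periodic points off the zero set of `r`, counted along their returns. -/
theorem ncard_periodic_eq {m : ℕ} (hm : 1 ≤ m) :
    {x | x ∈ coreJulia f ∧ r x ≠ 0 ∧ f^[m] x = x}.ncard = ∑ n ∈ Icc 1 m, ∑ a ∈ R.cells h,
      n * {x | x ∈ coreJulia f ∧ dist x a < r a ∧ IsReturnTime f N n x ∧ f^[m] x = a}.ncard := by
  classical
  have hfin : {x | x ∈ coreJulia f ∧ r x ≠ 0 ∧ f^[m] x = x}.Finite :=
    (finite_fixStar h.cont h.reg h.subhyp h.normal h.compact hm).subset fun x hx => by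
      rw [fixStar_eq h.cont h.reg h.subhyp h.normal hm]
      exact ⟨hx.1, hx.2.2⟩
  set F := hfin.toFinset with hF
  have hFmem : ∀ x, x ∈ F ↔ x ∈ coreJulia f ∧ r x ≠ 0 ∧ f^[m] x = x := fun x =>
    Set.Finite.mem_toFinset _
  set K := F.filter fun x => x ∉ N with hK
  have hret : ∀ x ∈ K, ∃ n, n ≤ m ∧ IsReturnTime f N n x := fun x hx => by
    obtain ⟨hx1, hx2⟩ := mem_filter.1 hx
    exact exists_isReturnTime hm (by rw [((hFmem x).1 hx1).2.2]; exact hx2)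
  have hFiter : ∀ x ∈ F, ∀ i, f^[i] x ∈ F := by
    intro x hx i
    obtain ⟨h1, h2, h3⟩ := (hFmem x).1 hx
    refine (hFmem _).2 ⟨h.iterate_mem h1 i, ?_, ?_⟩
    · refine R.ne_zero_of_map h h1 (n := m * i) ?_ (Nat.le_mul_of_pos_left i hm)
      rw [Function.iterate_mul, Function.iterate_fixed h3]
      exact h2
    · rw [← Function.iterate_add_apply, add_comm, Function.iterate_add_apply, h3]
  have hFinj : ∀ i, ∀ x ∈ F, ∀ y ∈ F, f^[i] x = f^[i] y → x = y := by
    intro i x hx y hy he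
    have e := congrArg f^[m * i - i] he
    rw [← Function.iterate_add_apply, ← Function.iterate_add_apply,
      Nat.sub_add_cancel (Nat.le_mul_of_pos_left i hm), Function.iterate_mul,
      Function.iterate_fixed ((hFmem x).1 hx).2.2, Function.iterate_fixed ((hFmem y).1 hy).2.2] at e
    exact e
  -- a periodic point is determined by its last visit to the complement of `N`
  set P := (K ×ˢ range m).filter fun p => ∀ j, 0 < j → j ≤ p.2 → f^[j] p.1 ∈ N with hP
  have hcardP : P.card = F.card := by
    -- A pair consists of a point outside `N` and a time before its next visit there. Injectivity
    -- compares last visits; surjectivity holds since only zeros of `r` are trapped in `N`.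
    refine card_bij (fun p _ => f^[p.2] p.1) ?_ ?_ ?_
    · rintro ⟨x, i⟩ hp
      have hx := (mem_product.1 (mem_filter.1 hp).1).1
      exact hFiter x (mem_filter.1 hx).1 i
    · have key : ∀ p ∈ P, ∀ q ∈ P, f^[p.2] p.1 = f^[q.2] q.1 → p.2 ≤ q.2 → p = q := by
        rintro ⟨x, i⟩ hp ⟨y, j⟩ hq he hij
        obtain ⟨hp1, hp2⟩ := mem_filter.1 hp
        obtain ⟨hq1, hq2⟩ := mem_filter.1 hq
        obtain ⟨hx, hxN⟩ := mem_filter.1 (mem_product.1 hp1).1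
        obtain ⟨hy, hyN⟩ := mem_filter.1 (mem_product.1 hq1).1
        simp only at he hij hxN hyN hp2 hq2 hx hy
        obtain ⟨k, rfl⟩ := Nat.exists_eq_add_of_le hij
        rw [Function.iterate_add_apply] at he
        have hxy := hFinj i x hx _ (hFiter y hy k) he
        rcases Nat.eq_zero_or_pos k with rfl | hk
        · rw [hxy]; rfl
        · exact absurd (hxy ▸ hq2 k hk (Nat.le_add_left _ _)) hxN
      rintro p hp q hq he
      rcases le_total p.2 q.2 with hle | hle
      · exact key p hp q hq he hle
      · exact (key q hq p hp he.symm hle).symm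
    · intro y hy
      obtain ⟨hy1, hy2, hy3⟩ := (hFmem y).1 hy
      have hex : ∃ i, ∃ x ∈ K, f^[i] x = y := by
        by_contra hcon
        push Not at hcon
        refine hy2 (R.trapped y hy1 fun i => ?_)
        by_contra hiN
        refine hcon (m * i - i) (f^[i] y) (mem_filter.2 ⟨hFiter y hy i, hiN⟩) ?_
        rw [← Function.iterate_add_apply, Nat.sub_add_cancel (Nat.le_mul_of_pos_left i hm),
          Function.iterate_mul, Function.iterate_fixed hy3]
      obtain ⟨x, hx, hxy⟩ := Nat.find_spec hex
      have hmin : ∀ j, 0 < j → j ≤ Nat.find hex → f^[j] x ∈ N := by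
        intro j hj hjle
        by_contra hjN
        refine Nat.find_min hex (m := Nat.find hex - j) (by omega)
          ⟨f^[j] x, mem_filter.2 ⟨hFiter x (mem_filter.1 hx).1 j, hjN⟩, ?_⟩
        rw [← Function.iterate_add_apply, Nat.sub_add_cancel hjle, hxy]
      obtain ⟨n, hnm, hn⟩ := hret x hx
      have hlt : Nat.find hex < n := by
        by_contra hcon
        exact hn.2.2 (hmin n hn.1 (not_lt.1 hcon))
      exact ⟨(x, Nat.find hex), mem_filter.2 ⟨mem_product.2 ⟨hx, mem_range.2 (hlt.trans_le hnm)⟩,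
        hmin⟩, hxy⟩
  have hcardP' : P.card = ∑ x ∈ K,
      ((range m).filter fun i => ∀ j, 0 < j → j ≤ i → f^[j] x ∈ N).card := by
    rw [hP, card_filter, sum_product]
    exact sum_congr rfl fun x _ => (card_filter _ _).symm
  rw [Set.ncard_eq_toFinset_card _ hfin, ← hF, ← hcardP, hcardP',
    sum_eq_sum_sum_filter (T := Icc 1 m ×ˢ R.cells h)
      (fun x p => IsReturnTime f N p.1 x ∧ dist x p.2 < r p.2), sum_product]
  · refine sum_congr rfl fun n hn => sum_congr rfl fun a ha => ?_
    have hnm := (mem_Icc.1 hn).2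
    rw [sum_congr rfl (g := fun _ => n) fun x hx => ?_, sum_const, smul_eq_mul, mul_comm,
      ← R.ncard_fixed_eq h hm hnm (R.mem_cells h ha).1, ← Set.ncard_coe_finset]
    · congr 2
      ext x
      simp only [coe_filter, Set.mem_ofPred_eq, hK, mem_filter, hFmem]
      constructor
      · rintro ⟨⟨⟨g1, g2, g3⟩, g4⟩, g5, g6⟩
        exact ⟨g1, g6, g5, g3⟩
      · rintro ⟨g1, g2, g3, g4⟩
        have g5 := R.notMem_of_dist_lt h g1 ha g2
        exact ⟨⟨⟨g1, R.notMem_ne_zero g1 g5, g4⟩, g5⟩, g3, g2⟩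
    · obtain ⟨-, hxn, -⟩ := mem_filter.1 hx
      -- A point with first return time `n` accounts for the `n` points of its orbit before the
      -- return, whence the weight `n`.
      have : ((range m).filter fun i => ∀ j, 0 < j → j ≤ i → f^[j] x ∈ N) = range n := by
        ext i
        rw [mem_filter, mem_range, mem_range]
        constructor
        · rintro ⟨-, hi⟩
          by_contra hcon
          exact hxn.2.2 (hi n hxn.1 (not_lt.1 hcon))
        · intro hi
          exact ⟨hi.trans_le hnm, fun j hj hji => hxn.2.1 j hj (hji.trans_lt hi)⟩
      rw [this, card_range]
  · intro x hx
    obtain ⟨n, hnm, hn⟩ := hret x hx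
    obtain ⟨hx1, hx2⟩ := mem_filter.1 hx
    have hxY := ((hFmem x).1 hx1).1
    obtain ⟨g1, g2⟩ := R.cellRep_mem h hxY hx2
    refine ⟨(n, cellRep f r x), mem_product.2 ⟨mem_Icc.2 ⟨hn.1, hnm⟩, g1⟩, ⟨hn, g2⟩, ?_⟩
    rintro ⟨n', a⟩ hp ⟨h1, h2⟩
    exact Prod.ext (h1.unique hn)
      ((R.cellRep_eq_iff h hxY hx2 (mem_product.1 hp).2).2 h2).symm

end IsMarkovRadius

end NonarchDyn

end
-- Eventual periodicity of the return numbers.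
noncomputable section

namespace NonarchDyn

open Metric

variable {X : Type*} [MetricSpace X] {f : X → X} {r : X → ℝ} {N : Set X}

/-- The orbit of `y` stays in `N` up to time `n`, when it is at `b`. -/
def Exits (f : X → X) (N : Set X) (b : X) (n : ℕ) (y : X) : Prop :=
  (∀ i < n, f^[i] y ∈ N) ∧ f^[n] y = b

theorem exits_add {b y : X} {k n : ℕ} :
    Exits f N b (k + n) y ↔ (∀ i < k, f^[i] y ∈ N) ∧ Exits f N b n (f^[k] y) := by
  simp only [Exits, ← and_assoc, ← Function.iterate_add_apply, Nat.add_comm n k]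
  refine and_congr_left fun _ => ⟨fun H => ⟨fun i hi => H i (by omega), fun i hi =>
    H _ (by omega)⟩, fun ⟨H1, H2⟩ i hi => ?_⟩
  by_cases hik : i < k
  · exact H1 i hik
  · have := H2 (i - k) (by omega)
    rwa [Nat.sub_add_cancel (not_lt.1 hik)] at this

/-- The points of `A` that exit from `N` at time `n`, at the point `b`. -/
def exitSet (f : X → X) (N A : Set X) (b : X) (n : ℕ) : Set X :=
  {y | y ∈ coreJulia f ∧ y ∈ A ∧ Exits f N b n y}

/-- The numbers of points near `z` and near `z'` with given exits agree up to a time shift `s`. -/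
def SameExits (f : X → X) (N : Set X) (δ : ℝ) (s : ℕ) (z z' : X) : Prop :=
  ∃ n₀, ∀ n ≥ n₀, ∀ b, (exitSet f N (ball z δ) b (n + s)).ncard =
    (exitSet f N (ball z' δ) b n).ncard

theorem SameExits.trans {δ : ℝ} {s s' : ℕ} {z z' z'' : X} (H : SameExits f N δ s z z')
    (H' : SameExits f N δ s' z' z'') : SameExits f N δ (s' + s) z z'' := by
  obtain ⟨n₁, H₁⟩ := H
  obtain ⟨n₂, H₂⟩ := H'
  refine ⟨max n₁ n₂, fun n hn b => ?_⟩
  rw [← Nat.add_assoc, H₁ _ ((le_max_left _ _).trans hn |>.trans (Nat.le_add_right _ _)),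
    H₂ _ ((le_max_right _ _).trans hn)]

/-- Periodicity of the exit numbers passes back along orbits: a shift common to `n` and `n + p`
cancels. -/
theorem SameExits.conj {δ : ℝ} {s p : ℕ} {z z' : X} (H : SameExits f N δ s z z')
    (H' : SameExits f N δ p z' z') : SameExits f N δ p z z := by
  obtain ⟨n₁, H₁⟩ := H
  obtain ⟨n₂, H₂⟩ := H'
  refine ⟨max n₁ n₂ + s, fun n hn b => ?_⟩
  obtain ⟨k, rfl⟩ := Nat.exists_eq_add_of_le' ((Nat.le_add_left _ _).trans hn)
  have hk : max n₁ n₂ ≤ k := Nat.le_of_add_le_add_right hn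
  rw [Nat.add_right_comm, H₁ _ ((le_max_left _ _).trans hk |>.trans (Nat.le_add_right _ _)),
    H₂ _ ((le_max_right _ _).trans hk), H₁ _ ((le_max_left _ _).trans hk)]

theorem SameExits.mul {δ : ℝ} {p : ℕ} {z : X} (H : SameExits f N δ p z z) (k : ℕ) :
    SameExits f N δ (p * k) z z := by
  induction k with
  | zero => exact ⟨0, fun n _ b => rfl⟩
  | succ k ih => rw [Nat.mul_succ, Nat.add_comm]; exact ih.trans H

variable [IsUltrametricDist X]

theorem HomogeneousCondition.exists_lift (hhom : HomogeneousCondition f)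
    (hsub : IsSubhyperbolic f) {z : X} (hz : z ∈ singularSet f) :
    ∃ (T : X → X) (ρ C : ℝ) (φ l : ℕ), 0 < ρ ∧ 0 < φ ∧ ScalesBall T z ρ C ∧ T z = z ∧
      ∀ u, dist u z < ρ → f^[l] (T u) = f^[φ + l] u := by
  obtain ⟨p, φ, V, T, -, hφ, hmain⟩ := hhom
  obtain ⟨⟨hV, hzV, hT, hTz⟩, h1, -⟩ := hmain z hz
  obtain ⟨k, -, hk⟩ := hsub.2 z hz
  have hle : forwardOrbit f (f^[k] z) ⊆ forwardOrbit f z := by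
    rintro _ ⟨i, rfl⟩
    exact ⟨i + k, Function.iterate_add_apply f i k z⟩
  have hγ : forwardOrbit f (f^[k] z) ∈ singularCycles f := ⟨⟨_, hk, rfl⟩, z, hz, hle⟩
  obtain ⟨ρ, hρ, C, H⟩ := hT.exists_scalesBall hV hzV (singularSet_subset_coreJulia hz).2
  obtain ⟨ε, hε, hsubV⟩ := hV.exists_ball_subset hzV
  exact ⟨T z, min ρ ε, C, φ ⟨_, hγ⟩, _, lt_min hρ hε, hφ _, H.mono (min_le_left _ _), hTz,
    fun u hu => h1 ⟨_, hγ⟩ hle u (hsubV (hu.trans_le (min_le_right _ _)))⟩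

namespace IsMarkovRadius

variable (h : IsTame f) (R : IsMarkovRadius f r N)

include h R in
theorem iterate_zero {z : X} (hz : z ∈ coreJulia f) (hz0 : r z = 0) (i : ℕ) :
    r (f^[i] z) = 0 := by
  by_contra hne
  exact R.ne_zero_of_map h hz hne (Nat.zero_le i) hz0

include h R in
/-- Points that stay in `N` for a long time are close to the zeros of `r`. -/
theorem exists_exit_bound {δ : ℝ} (hδ : 0 < δ) : ∃ n₀, ∀ n ≥ n₀, ∀ y ∈ coreJulia f,
    (∀ i < n, f^[i] y ∈ N) → ∃ z ∈ coreJulia f, r z = 0 ∧ dist y z < δ := by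
  set Z := {z | z ∈ coreJulia f ∧ r z = 0} with hZ
  have hK : IsCompact (coreJulia f ∩ (⋃ z ∈ Z, ball z δ)ᶜ) :=
    (isCompact_coreJulia h.compact).inter_right
      (isOpen_biUnion fun z _ => isOpen_ball).isClosed_compl
  have hloc : ∀ y ∈ coreJulia f ∩ (⋃ z ∈ Z, ball z δ)ᶜ, ∃ i : ℕ, ∃ ρ : ℝ, 0 < ρ ∧
      ∀ y' ∈ coreJulia f, dist y' y < ρ → f^[i] y' ∉ N := by
    rintro y ⟨hy, hyZ⟩
    have hy0 : r y ≠ 0 := fun h0 => hyZ (Set.mem_iUnion₂.2 ⟨y, ⟨hy, h0⟩, mem_ball_self hδ⟩)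
    have : ∃ i, f^[i] y ∉ N := by
      by_contra hcon
      push Not at hcon
      exact hy0 (R.trapped y hy hcon)
    obtain ⟨i, hi⟩ := this
    have hYi := h.iterate_mem hy i
    obtain ⟨ρ, hρ, hc⟩ := Metric.continuousAt_iff.1 ((h.cont.iterate i).continuousAt (x := y)) _
      (R.pos_of_notMem hYi hi)
    exact ⟨i, ρ, hρ, fun y' hy' hd =>
      (R.mem_iff _ hYi _ (h.iterate_mem hy' i) (hc hd)).not.2 hi⟩
  -- Away from the zeros, each point leaves `N` after some time that is locally constant, hence
  -- bounded on a compact set.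
  choose! i ρ hρ hiN using hloc
  obtain ⟨s, hs, hcov⟩ := hK.elim_nhds_subcover (fun x => ball x (ρ x))
    fun x hx => ball_mem_nhds x (hρ x hx)
  refine ⟨s.sup i + 1, fun n hn y hy hN => ?_⟩
  by_contra hcon
  push Not at hcon
  have hyK : y ∈ coreJulia f ∩ (⋃ z ∈ Z, ball z δ)ᶜ := ⟨hy, fun hm => by
    obtain ⟨z, hz, hyz⟩ := Set.mem_iUnion₂.1 hm
    exact absurd (mem_ball.1 hyz) (not_lt.2 (hcon z hz.1 hz.2))⟩
  obtain ⟨x, hx, hyx⟩ := Set.mem_iUnion₂.1 (hcov hyK)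
  exact hiN x (hs x hx) y hy hyx (hN _ (by have := Finset.le_sup (f := i) hx; omega))

include h R in
/-- Transfer of exit numbers along a scaling map. -/
theorem sameExits_of_scalesBall {δ : ℝ} (hδ : 0 < δ)
    (hsep : ∀ z ∈ coreJulia f, r z = 0 → ∀ z' ∈ coreJulia f, r z' = 0 → dist z z' < δ → z = z')
    {z z' : X} (hz : z ∈ coreJulia f) (hz0 : r z = 0) (hz' : z' ∈ coreJulia f) (hz'0 : r z' = 0)
    {T : X → X} {ρ C : ℝ} (hρ : 0 < ρ) (H : ScalesBall T z ρ C) (hTz : T z = z')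
    (hY : ∀ u, dist u z < ρ → (u ∈ coreJulia f ↔ T u ∈ coreJulia f)) {s n₁ : ℕ}
    (hT : ∀ u ∈ coreJulia f, dist u z < ρ → ∀ n ≥ n₁, ∀ b,
      (Exits f N b (n + s) u ↔ Exits f N b n (T u))) : SameExits f N δ s z z' := by
  set ρ₁ := min ρ (min δ (δ / C)) with hρ₁
  have hρ₁pos : 0 < ρ₁ := lt_min hρ (lt_min hδ (div_pos hδ H.pos))
  have h1 : ρ₁ ≤ ρ := min_le_left _ _
  have h2 : ρ₁ ≤ δ := (min_le_right _ _).trans (min_le_left _ _)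
  have h3 : C * ρ₁ ≤ δ := by
    rw [mul_comm, ← le_div_iff₀ H.pos]
    exact (min_le_right _ _).trans (min_le_right _ _)
  -- Late exits start arbitrarily close to a zero, so the radius of the ball around it does not
  -- affect the counts for large times.
  have hshrink : ∀ {w : X} {η : ℝ}, w ∈ coreJulia f → r w = 0 → 0 < η → η ≤ δ → ∃ n₀, ∀ n ≥ n₀,
      ∀ b, exitSet f N (ball w δ) b n = exitSet f N (ball w η) b n := by
    intro w η hw hw0 hη hηδ
    obtain ⟨n₀, hn₀⟩ := R.exists_exit_bound h hη
    refine ⟨n₀, fun n hn b => Set.Subset.antisymm ?_ ?_⟩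
    · rintro y ⟨hy, hyw, hyb⟩
      obtain ⟨v, hv, hv0, hyv⟩ := hn₀ n hn y hy hyb.1
      have : v = w := hsep v hv hv0 w hw hw0
        ((dist_triangle_max v y w).trans_lt (max_lt (by
          rw [dist_comm]; exact hyv.trans_le hηδ) hyw))
      exact ⟨hy, this ▸ hyv, hyb⟩
    · rintro y ⟨hy, hyw, hyb⟩
      exact ⟨hy, ball_subset_ball hηδ hyw, hyb⟩
  obtain ⟨n₂, hn₂⟩ := hshrink hz hz0 hρ₁pos h2
  obtain ⟨n₃, hn₃⟩ := hshrink hz' hz'0 (mul_pos H.pos hρ₁pos) h3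
  have H₁ := H.mono h1
  refine ⟨max n₁ (max n₂ n₃), fun n hn b => ?_⟩
  have hn1 : n₁ ≤ n := (le_max_left _ _).trans hn
  rw [hn₂ (n + s) (((le_max_left _ _).trans (le_max_right _ _)).trans hn |>.trans
    (Nat.le_add_right _ _)), hn₃ n (((le_max_right _ _).trans (le_max_right _ _)).trans hn)]
  have himg : T '' exitSet f N (ball z ρ₁) b (n + s) = exitSet f N (ball z' (C * ρ₁)) b n := by
    ext w
    constructor
    · rintro ⟨u, ⟨hu, huz, hub⟩, rfl⟩
      have huρ := (mem_ball.1 huz).trans_le h1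
      refine ⟨(hY u huρ).1 hu, ?_, (hT u hu huρ n hn1 b).1 hub⟩
      rw [mem_ball, ← hTz]
      exact H₁.dist_lt huz
    · rintro ⟨hw, hwz, hwb⟩
      rw [mem_ball, ← hTz] at hwz
      obtain ⟨u, hu, rfl⟩ := H₁.exists_preimage hwz
      have huρ := hu.trans_le h1
      have huY := (hY u huρ).2 hw
      exact ⟨u, ⟨huY, hu, (hT u huY huρ n hn1 b).2 hwb⟩, rfl⟩
  rw [← himg, Set.InjOn.ncard_image]
  rintro u ⟨-, hu, -⟩ v ⟨-, hv, -⟩ he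
  exact H₁.injOn hu hv he

include h R in
theorem exists_ball_iterate_mem {z : X} (hz : z ∈ coreJulia f) (hz0 : r z = 0) (k : ℕ) :
    ∃ ρ : ℝ, 0 < ρ ∧ ∀ u ∈ coreJulia f, dist u z < ρ → ∀ i ≤ k, f^[i] u ∈ N := by
  obtain ⟨ρ, hρ, H⟩ := exists_pos_forall_of_finite (Set.finite_Iic k)
    (P := fun i ρ => ∀ u ∈ coreJulia f, dist u z < ρ → f^[i] u ∈ N)
    (fun i s t H hst u hu hd => H u hu (hd.trans_le hst)) fun i _ => by
      obtain ⟨ε, hε, hN⟩ := R.nhds _ (h.iterate_mem hz i) (R.iterate_zero h hz hz0 i)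
      obtain ⟨ρ, hρ, hc⟩ := Metric.continuousAt_iff.1
        ((h.cont.iterate i).continuousAt (x := z)) ε hε
      exact ⟨ρ, hρ, fun u hu hd => hN _ (h.iterate_mem hu i) (hc hd)⟩
  exact ⟨ρ, hρ, fun u hu hd i hi => H i hi u hu hd⟩

include h R in
theorem sameExits_map {δ : ℝ} (hδ : 0 < δ)
    (hsep : ∀ z ∈ coreJulia f, r z = 0 → ∀ z' ∈ coreJulia f, r z' = 0 → dist z z' < δ → z = z')
    {z : X} (hz : z ∈ coreJulia f) (hz0 : r z = 0) (hs : z ∉ singularSet f) :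
    SameExits f N δ 1 z (f z) := by
  obtain ⟨ρ, hρ, H⟩ := exists_scalesBall_localScale hz hs
  obtain ⟨ρ', hρ', hN⟩ := R.exists_ball_iterate_mem h hz hz0 0
  have H' := H.mono (min_le_left ρ ρ')
  refine R.sameExits_of_scalesBall h hδ hsep hz hz0 (h.map_mem hz) (R.zero_map z hz hz0)
    (lt_min hρ hρ') H' rfl (fun u hu => H'.mem_coreJulia_iff_of_self hu) (n₁ := 0)
    fun u hu hd n _ b => ?_
  rw [Nat.add_comm, exits_add]
  exact and_iff_right fun i hi => hN u hu (hd.trans_le (min_le_right _ _)) i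
    (Nat.le_of_lt_succ hi)

include h R in
-- From `f^[l] ∘ T = f^[φ + l]`, the orbit of `T u` agrees from time `l` on with that of `u` from
-- time `φ + l` on. Near `z` the initial segments stay in `N`, so `T` advances every late exit by
-- exactly `φ`.
theorem sameExits_singular (hhom : HomogeneousCondition f) {δ : ℝ} (hδ : 0 < δ)
    (hsep : ∀ z ∈ coreJulia f, r z = 0 → ∀ z' ∈ coreJulia f, r z' = 0 → dist z z' < δ → z = z')
    {z : X} (hs : z ∈ singularSet f) : ∃ p, 0 < p ∧ SameExits f N δ p z z := by
  have hz := singularSet_subset_coreJulia hs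
  have hz0 := R.singular z hs
  obtain ⟨T, ρ, C, φ, l, hρ, hφ, H, hTz, hT⟩ := hhom.exists_lift h.subhyp hs
  obtain ⟨ρ', hρ', hN⟩ := R.exists_ball_iterate_mem h hz hz0 (φ + l)
  set ρ₁ := min ρ (min ρ' (ρ' / C)) with hρ₁
  have h1 : ρ₁ ≤ ρ := min_le_left _ _
  have h2 : ρ₁ ≤ ρ' := (min_le_right _ _).trans (min_le_left _ _)
  have h3 : C * ρ₁ ≤ ρ' := by
    rw [mul_comm, ← le_div_iff₀ H.pos]
    exact (min_le_right _ _).trans (min_le_right _ _)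
  have H₁ := H.mono h1
  have hY : ∀ u, dist u z < ρ₁ → (u ∈ coreJulia f ↔ T u ∈ coreJulia f) := fun u hu =>
    H₁.mem_coreJulia_iff (fun v hv => by
      rw [iterate_mem_grandOrbit_iff (φ + l) v, iterate_mem_grandOrbit_iff l (T v),
        hT v (hv.trans_le h1)]) hu
  refine ⟨φ, hφ, R.sameExits_of_scalesBall h hδ hsep hz hz0 hz hz0
    (lt_min hρ (lt_min hρ' (div_pos hρ' H.pos))) H₁ hTz hY (n₁ := l) fun u hu hd n hn b => ?_⟩
  obtain ⟨k, rfl⟩ := Nat.exists_eq_add_of_le hn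
  have hTu : dist (T u) z < ρ' := by
    rw [← hTz]
    exact (H₁.dist_lt hd).trans_le h3
  rw [show l + k + φ = φ + l + k by omega, exits_add, exits_add, hT u (hd.trans_le h1)]
  refine and_congr_left fun _ => iff_of_true (fun i hi => ?_) fun i hi => ?_
  · exact hN u hu (hd.trans_le h2) i hi.le
  · exact hN (T u) ((hY u hd).1 hu) hTu i (by omega)

include h R in
-- The orbit of a zero either meets a singular point, where `T` provides a period, or avoids them
-- all. In the latter case it is preperiodic by finiteness, and `f` itself, scaling near the cycle,
-- provides one.
theorem exists_sameExits_self (hhom : HomogeneousCondition f) {δ : ℝ} (hδ : 0 < δ)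
    (hsep : ∀ z ∈ coreJulia f, r z = 0 → ∀ z' ∈ coreJulia f, r z' = 0 → dist z z' < δ → z = z')
    {z : X} (hz : z ∈ coreJulia f) (hz0 : r z = 0) : ∃ p, 0 < p ∧ SameExits f N δ p z z := by
  classical
  have hiter : ∀ k w, w ∈ coreJulia f → r w = 0 → (∀ i < k, f^[i] w ∉ singularSet f) →
      SameExits f N δ k w (f^[k] w) := by
    intro k w hw hw0
    induction k with
    | zero => exact fun _ => ⟨0, fun n _ b => rfl⟩
    | succ k ih =>
      intro hs
      have := (ih fun i hi => hs i (hi.trans k.lt_succ_self)).trans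
        (R.sameExits_map h hδ hsep (h.iterate_mem hw k) (R.iterate_zero h hw hw0 k)
          (hs k k.lt_succ_self))
      rw [Function.iterate_succ_apply', Nat.add_comm k 1]
      exact this
  by_cases hex : ∃ i, f^[i] z ∈ singularSet f
  · have hmin := hiter (Nat.find hex) z hz hz0 fun i hi => Nat.find_min hex hi
    obtain ⟨p, hp, hpS⟩ := R.sameExits_singular h hhom hδ hsep (Nat.find_spec hex)
    exact ⟨p, hp, hmin.conj hpS⟩
  · push Not at hex
    obtain ⟨i, j, hij, he⟩ : ∃ i j : ℕ, i < j ∧ f^[i] z = f^[j] z := by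
      have hmem : ∀ i : ℕ, f^[i] z ∈ {z | z ∈ coreJulia f ∧ r z = 0} := fun i =>
        ⟨h.iterate_mem hz i, R.iterate_zero h hz hz0 i⟩
      exact R.finite_zero.exists_lt_map_eq_of_forall_mem hmem
    obtain ⟨k, rfl⟩ := Nat.exists_eq_add_of_lt hij
    have h2 := hiter (k + 1) (f^[i] z) (h.iterate_mem hz i) (R.iterate_zero h hz hz0 i)
      fun m _ => by rw [← Function.iterate_add_apply]; exact hex _
    rw [← Function.iterate_add_apply, show k + 1 + i = i + k + 1 by omega, ← he] at h2
    exact ⟨k + 1, k.succ_pos, (hiter i z hz hz0 fun m _ => hex m).conj h2⟩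

include h R in
theorem ncard_returnSet_succ {a b : X} (ha : a ∈ R.cells h) (hb : b ∈ R.cells h) (n : ℕ) :
    (returnSet f r N a b (n + 1)).ncard =
      (exitSet f N (ball (f a) (localScale f a * r a)) b n).ncard := by
  obtain ⟨ha1, -, ha3, -⟩ := R.mem_cells h ha
  have H := R.scales a ha1 ha3.ne'
  have himg : f '' returnSet f r N a b (n + 1) =
      exitSet f N (ball (f a) (localScale f a * r a)) b n := by
    ext w
    constructor
    · rintro ⟨u, ⟨hu, ⟨hua, hret⟩, hub⟩, rfl⟩
      exact ⟨h.map_mem hu, H.dist_lt hua, fun i hi => hret.2.1 (i + 1) i.succ_pos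
        (Nat.succ_lt_succ hi), hub⟩
    · rintro ⟨hw, hwa, hwN, hwb⟩
      obtain ⟨u, hu, rfl⟩ := H.exists_preimage hwa
      refine ⟨u, ⟨(H.mem_coreJulia_iff_of_self hu).2 hw, ⟨hu, n.succ_pos, fun i hi hin => ?_, ?_⟩,
        hwb⟩, rfl⟩
      · obtain ⟨j, rfl⟩ := Nat.exists_eq_succ_of_ne_zero hi.ne'
        exact hwN j (Nat.lt_of_succ_lt_succ hin)
      · rw [Function.iterate_succ_apply, hwb]
        exact (R.mem_cells h hb).2.1
  rw [← himg, Set.InjOn.ncard_image]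
  rintro u ⟨-, ⟨hu, -⟩, -⟩ v ⟨-, ⟨hv, -⟩, -⟩ he
  exact H.injOn hu hv he

theorem finite_exitSet (h : IsTame f) (A : Set X) (b : X) (n : ℕ) :
    (exitSet f N A b n).Finite :=
  (h.finite_iterate_preimage (Set.finite_singleton b) n).subset fun _ hx => ⟨hx.1, hx.2.2.2⟩

include h R in
/-- The numbers of returns between cells are eventually periodic in the return time. -/
theorem exists_period (hhom : HomogeneousCondition f) : ∃ p t : ℕ, 0 < p ∧
    ∀ a ∈ R.cells h, ∀ b ∈ R.cells h, ∀ n ≥ t,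
      (returnSet f r N a b (n + p)).ncard = (returnSet f r N a b n).ncard := by
  classical
  set Z := R.finite_zero.toFinset with hZ
  have hZmem : ∀ z, z ∈ Z ↔ z ∈ coreJulia f ∧ r z = 0 := fun z => Set.Finite.mem_toFinset _
  obtain ⟨δ₁, hδ₁, hsep₁⟩ := exists_pos_forall_of_finite (R.finite_zero.prod R.finite_zero)
    (P := fun q δ => dist q.1 q.2 < δ → q.1 = q.2) (fun q s t H hst hd => H (hd.trans_le hst))
    fun q _ => by
      by_cases he : q.1 = q.2
      · exact ⟨1, one_pos, fun _ => he⟩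
      · exact ⟨dist q.1 q.2, dist_pos.2 he, fun hd => absurd hd (lt_irrefl _)⟩
  obtain ⟨δ₂, hδ₂, hcell⟩ := exists_pos_forall_of_finite (R.cells h).finite_toSet
    (P := fun a δ => δ ≤ localScale f a * r a) (fun a s t H hst => hst.trans H) fun a ha =>
      ⟨_, mul_pos (localScale_pos f a) (R.mem_cells h ha).2.2.1, le_rfl⟩
  set δ := min δ₁ δ₂ with hδdef
  have hδ : 0 < δ := lt_min hδ₁ hδ₂
  have hsep : ∀ z ∈ coreJulia f, r z = 0 → ∀ z' ∈ coreJulia f, r z' = 0 → dist z z' < δ →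
      z = z' := fun z hz hz0 z' hz' hz'0 hd =>
    hsep₁ (z, z') ⟨⟨hz, hz0⟩, ⟨hz', hz'0⟩⟩ (hd.trans_le (min_le_left _ _))
  have hper : ∀ z ∈ Z, ∃ p, 0 < p ∧ SameExits f N δ p z z := fun z hz =>
    R.exists_sameExits_self h hhom hδ hsep ((hZmem z).1 hz).1 ((hZmem z).1 hz).2
  choose! p hp hpS using hper
  -- The product of the individual periods is a period common to all zeros.
  have hP : ∀ z ∈ Z, SameExits f N δ (∏ w ∈ Z, p w) z z := fun z hz => by
    rw [← Finset.mul_prod_erase Z p hz]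
    exact (hpS z hz).mul _
  have hP' : ∀ z ∈ Z, ∃ n₀, ∀ n ≥ n₀, ∀ b,
      (exitSet f N (ball z δ) b (n + ∏ w ∈ Z, p w)).ncard =
        (exitSet f N (ball z δ) b n).ncard := hP
  choose! n₀ hn₀ using hP'
  obtain ⟨n₁, hn₁⟩ := R.exists_exit_bound h hδ
  refine ⟨∏ w ∈ Z, p w, max n₁ (Z.sup n₀) + 1, Finset.prod_pos hp, fun a ha b hb n hn => ?_⟩
  -- After one step a return is an exit from the image ball of the cell; long exits start near
  -- exactly one zero, which lies in that ball because `δ` is at most its radius.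
  have hsum : ∀ n ≥ n₁, (returnSet f r N a b (n + 1)).ncard =
      ∑ z ∈ Z.filter (fun z => dist z (f a) < localScale f a * r a),
        (exitSet f N (ball z δ) b n).ncard := by
    intro n hn
    have hfin := finite_exitSet (N := N) h (ball (f a) (localScale f a * r a)) b n
    rw [R.ncard_returnSet_succ h ha hb, Set.ncard_eq_toFinset_card _ hfin,
      card_eq_sum_card_filter
        (T := Z.filter (fun z => dist z (f a) < localScale f a * r a))
        (fun y z => dist y z < δ)]
    · refine Finset.sum_congr rfl fun z hz => ?_
      obtain ⟨-, hza⟩ := Finset.mem_filter.1 hz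
      rw [← Set.ncard_coe_finset]
      congr 1
      ext y
      simp only [Finset.coe_filter, Set.Finite.mem_toFinset, Set.mem_ofPred_eq, exitSet, mem_ball]
      constructor
      · rintro ⟨⟨g1, -, g3⟩, g4⟩
        exact ⟨g1, g4, g3⟩
      · rintro ⟨g1, g2, g3⟩
        exact ⟨⟨g1, (dist_triangle_max y z (f a)).trans_lt (max_lt (g2.trans_le
          ((min_le_right _ _).trans (hcell a ha))) hza), g3⟩, g2⟩
    · intro y hy
      obtain ⟨g1, g2, g3⟩ := (Set.Finite.mem_toFinset _).1 hy
      obtain ⟨z, hz, hz0, hyz⟩ := hn₁ n hn y g1 g3.1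
      refine ⟨z, Finset.mem_filter.2 ⟨(hZmem z).2 ⟨hz, hz0⟩, ?_⟩, hyz, fun z' hz' hyz' => ?_⟩
      · refine (dist_triangle_max z y (f a)).trans_lt (max_lt ?_ g2)
        rw [dist_comm]
        exact hyz.trans_le ((min_le_right _ _).trans (hcell a ha))
      · obtain ⟨g4, g5⟩ := (hZmem z').1 (Finset.mem_filter.1 hz').1
        refine hsep z' g4 g5 z hz hz0 ((dist_triangle_max z' y z).trans_lt (max_lt ?_ hyz))
        rw [dist_comm]
        exact hyz'
  obtain ⟨k, rfl⟩ := Nat.exists_eq_add_of_le' ((Nat.le_add_left 1 _).trans hn)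
  have hk : max n₁ (Z.sup n₀) ≤ k := Nat.le_of_add_le_add_right hn
  have hk1 : n₁ ≤ k := (le_max_left _ _).trans hk
  rw [Nat.add_right_comm, hsum k hk1, hsum _ (hk1.trans (Nat.le_add_right _ _))]
  refine Finset.sum_congr rfl fun z hz => ?_
  have hzZ := (Finset.mem_filter.1 hz).1
  exact hn₀ z hzZ k ((Finset.le_sup hzZ).trans ((le_max_right _ _).trans hk)) b

end IsMarkovRadius

end NonarchDyn

end
-- Determinants and exponentials of closed-walk series.
noncomputable section

namespace NonarchDyn

open Matrix

theorem derivation_prod {R A ι : Type*} [CommRing R] [CommRing A] [Algebra R A] [DecidableEq ι]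
    (D : Derivation R A A) (g : ι → A) (s : Finset ι) :
    D (∏ i ∈ s, g i) = ∑ i ∈ s, D (g i) * ∏ j ∈ s.erase i, g j := by
  induction s using Finset.induction_on with
  | empty => simp
  | insert a s ha ih =>
    rw [Finset.prod_insert ha, D.leibniz, ih, Finset.sum_insert ha, Finset.erase_insert ha,
      smul_eq_mul, smul_eq_mul, Finset.mul_sum, add_comm, mul_comm (∏ i ∈ s, g i)]
    congr 1
    refine Finset.sum_congr rfl fun i hi => ?_
    have hne : a ≠ i := fun h => ha (h ▸ hi)
    rw [Finset.erase_insert_of_ne hne, Finset.prod_insert fun h => ha (Finset.mem_of_mem_erase h)]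
    ring

/-- Jacobi's formula. -/
theorem derivation_det {R A ι : Type*} [CommRing R] [CommRing A] [Algebra R A] [DecidableEq ι]
    [Fintype ι] (D : Derivation R A A) (M : Matrix ι ι A) :
    D M.det = (M.adjugate * M.map D).trace := by
  have key : ∀ i, (M.adjugate * M.map D) i i = (M.updateCol i fun k => D (M k i)).det := fun i => by
    rw [← cramer_apply, cramer_eq_adjugate_mulVec]
    rfl
  rw [trace]
  simp only [diag_apply, key, det_apply]
  rw [Finset.sum_comm, map_sum]
  refine Finset.sum_congr rfl fun σ _ => ?_
  rw [← Finset.smul_sum, Units.smul_def, Units.smul_def, map_zsmul, derivation_prod]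
  congr 1
  refine Finset.sum_congr rfl fun i hi => ?_
  rw [← Finset.mul_prod_erase _ _ hi, updateCol_self]
  congr 1
  refine Finset.prod_congr rfl fun j hj => ?_
  rw [updateCol_ne (Finset.ne_of_mem_erase hj)]

open PowerSeries

/-- The exponential of the series counting closed walks is the inverse of a determinant. -/
theorem exp_subst_mul_det {ι : Type*} [DecidableEq ι] [Fintype ι]
    (W C : Matrix ι ι ℚ⟦X⟧) (G : ℚ⟦X⟧) (hW : ∀ a b, constantCoeff (W a b) = 0)
    (hC : C = 1 + W * C) (hG0 : constantCoeff G = 0)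
    (hG : d⁄dX ℚ G = (W.map (d⁄dX ℚ) * C).trace) :
    (exp ℚ).subst G * (1 - W).det = 1 := by
  have hs : HasSubst G := HasSubst.of_constantCoeff_zero' hG0
  have hinv : (1 - W) * C = 1 := by
    rw [sub_mul, one_mul]
    nth_rewrite 1 [hC]
    exact add_sub_cancel_right _ _
  -- With `C` the inverse of `1 - W`, Jacobi's formula reads `D (det (1 - W)) = -det (1 - W) * tr
  -- (W' C)`, the logarithmic derivative opposite to that of `exp G`.
  have hadj : (1 - W).adjugate = (1 - W).det • C := by
    calc (1 - W).adjugate = (1 - W).adjugate * ((1 - W) * C) := by rw [hinv, mul_one]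
      _ = _ := by rw [← mul_assoc, adjugate_mul, smul_mul, one_mul]
  have hmap : (1 - W).map (d⁄dX ℚ) = -W.map (d⁄dX ℚ) := by
    ext1 i j
    rw [map_apply, Matrix.sub_apply, map_sub, neg_apply, map_apply, one_apply]
    split_ifs <;> simp
  have hD : d⁄dX ℚ (1 - W).det = -((1 - W).det * d⁄dX ℚ G) := by
    rw [derivation_det, hadj, hmap, hG, smul_mul, trace_smul, smul_eq_mul, mul_neg, trace_neg,
      mul_neg, trace_mul_comm]
  refine derivative.ext ?_ ?_
  · rw [Derivation.leibniz, derivative_subst hs, derivative_exp, hD, derivative_one]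
    simp only [smul_eq_mul]
    ring
  · rw [map_mul, map_one, RingHom.map_det]
    have h1 : (RingHom.mapMatrix constantCoeff) (1 - W) = (1 : Matrix ι ι ℚ) := by
      ext1 i j
      rw [RingHom.mapMatrix_apply, map_apply, Matrix.sub_apply, map_sub, hW, sub_zero, one_apply,
        one_apply]
      split_ifs <;> simp
    have h2 : constantCoeff ((exp ℚ).subst G) = 1 := by
      have := constantCoeff_subst_eq_zero (a := G) hG0 (exp ℚ - 1) (by simp)
      rw [subst_sub hs] at this
      have h3 : (1 : ℚ⟦X⟧).subst G = (1 : ℚ⟦X⟧) := by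
        rw [← coe_substAlgHom hs, map_one]
      rw [h3, map_sub, map_one] at this
      exact sub_eq_zero.1 this
    rw [h1, h2, det_one, one_mul]

/-- A Cauchy product form of `exp_subst_mul_det`. -/
theorem exp_subst_mul_det_of_count {ι : Type*} [DecidableEq ι] [Fintype ι]
    (w c : ι → ι → ℕ → ℕ) (n : ℕ → ℕ) (hw : ∀ a b, w a b 0 = 0)
    (hc0 : ∀ a b, c a b 0 = if a = b then 1 else 0)
    (hc : ∀ a b m, 1 ≤ m → c a b m =
      ∑ p ∈ Finset.HasAntidiagonal.antidiagonal m, ∑ e, w a e p.1 * c e b p.2)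
    (hn : ∀ m, 1 ≤ m → n m =
      ∑ p ∈ Finset.HasAntidiagonal.antidiagonal m, ∑ a, ∑ e, p.1 * (w a e p.1 * c e a p.2)) :
    (exp ℚ).subst (PowerSeries.mk fun m : ℕ => if m = 0 then (0 : ℚ) else (n m : ℚ) / m) *
      (1 - Matrix.of fun a b => (PowerSeries.mk fun m => (w a b m : ℚ))).det = 1 := by
  refine exp_subst_mul_det (Matrix.of fun a b => (PowerSeries.mk fun m => (w a b m : ℚ)))
    (Matrix.of fun a b => (PowerSeries.mk fun m => (c a b m : ℚ))) _ (fun a b => by simp [hw])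
    ?_ (by simp) ?_
  · ext a b m
    rw [Matrix.add_apply, map_add, mul_apply, map_sum]
    simp only [of_apply, coeff_mk, coeff_mul]
    rcases Nat.eq_zero_or_pos m with rfl | hm
    · simp [hw, hc0, one_apply]
    · have h1 : coeff m ((1 : Matrix ι ι ℚ⟦X⟧) a b) = 0 := by
        rw [one_apply]
        split_ifs
        · rw [coeff_one, if_neg hm.ne']
        · simp
      rw [h1, zero_add, hc a b m hm, Finset.sum_comm]
      push_cast
      rfl
  · ext m
    -- Differentiation removes the denominator `m + 1` on the left and creates the weight `p.1` on
    -- the right; the term with `p.1 = 0` vanishes.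
    rw [coeff_derivative, coeff_mk, if_neg m.succ_ne_zero, Nat.cast_succ,
      div_mul_cancel₀ _ (by positivity), hn _ m.succ_pos, trace, map_sum,
      Finset.Nat.sum_antidiagonal_succ]
    simp only [diag_apply, mul_apply, map_sum, coeff_mul, map_apply, of_apply, coeff_derivative,
      coeff_mk, zero_mul, Finset.sum_const_zero, zero_add]
    push_cast
    rw [Finset.sum_comm]
    refine Finset.sum_congr rfl fun a _ => ?_
    rw [Finset.sum_comm]
    refine Finset.sum_congr rfl fun e _ => Finset.sum_congr rfl fun p _ => ?_
    ring

end NonarchDyn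

end
-- A finite graph realising eventually periodic return numbers.
noncomputable section

namespace NonarchDyn

open Matrix

section Graph

variable {ι : Type*} [DecidableEq ι] [Fintype ι]

/-- The matrix of a path `t + Φ - 1 → ⋯ → 1 → 0` with an additional edge `t → t + Φ - 1`. -/
def loopMatrix (A : Type*) [CommRing A] (t Φ : ℕ) : Matrix (Fin (t + Φ)) (Fin (t + Φ)) A :=
  of fun m m' => (if (m' : ℕ) + 1 = m then 1 else 0) +
    if (m : ℕ) = t then (if (m' : ℕ) + 1 = t + Φ then 1 else 0) else 0

/-- A graph in which first returns from `a` to `b` of length `n` are counted by `w a b n`. -/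
def returnGraph (A : Type*) [CommRing A] (w : ι → ι → ℕ → ℕ) (t Φ M : ℕ) :
    Matrix (ι ⊕ (Fin (t + Φ) × (ι × Fin M))) (ι ⊕ (Fin (t + Φ) × (ι × Fin M))) A :=
  fromBlocks (of fun a b => if w a b 1 = 1 then 1 else 0)
    -- One step enters a copy at height `m`, then `m` steps descend to `0` and one leaves to the
    -- target: `m + 2` in all. Walks entering at `m ≥ t` may also circle the loop, adding multiples
    -- of `Φ`.
    (of fun a x => if (x.2.2 : ℕ) < w a x.2.1 (x.1 + 2) then 1 else 0)
    (of fun x b => if (x.1 : ℕ) = 0 ∧ x.2.1 = b then 1 else 0)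
    (blockDiagonal fun _ => loopMatrix A t Φ)

theorem loopMatrix_map {A A' : Type*} [CommRing A] [CommRing A'] (g : A →+* A') (t Φ : ℕ) :
    (loopMatrix A t Φ).map g = loopMatrix A' t Φ := by
  ext i j
  simp only [loopMatrix, map_apply, of_apply, map_add, apply_ite g, map_one, map_zero]

theorem returnGraph_map {A A' : Type*} [CommRing A] [CommRing A'] (g : A →+* A')
    (w : ι → ι → ℕ → ℕ) (t Φ M : ℕ) :
    (returnGraph A w t Φ M).map g = returnGraph A' w t Φ M := by
  rw [returnGraph, fromBlocks_map, blockDiagonal_map _ _ (map_zero g)]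
  simp only [loopMatrix_map]
  rw [returnGraph]
  congr 1 <;> · ext i j; simp only [map_apply, of_apply, apply_ite g, map_one, map_zero]

variable {A : Type*} [CommRing A]

theorem sum_fin_pred {L n : ℕ} (hn : n ≤ L) (g : ℕ → A) :
    ∑ m : Fin L, (if (m : ℕ) + 1 = n then g m else 0) = if n = 0 then 0 else g (n - 1) := by
  obtain _ | n := n
  · simp
  · rw [Finset.sum_eq_single (⟨n, hn⟩ : Fin L)]
    · simp
    · intro m _ hm
      exact if_neg fun h => hm (Fin.ext (Nat.succ_injective h))
    · simp

theorem loopMatrix_mulVec (t Φ : ℕ) (g : ℕ → A) (m : Fin (t + Φ)) (hΦ : 0 < Φ) :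
    (loopMatrix A t Φ *ᵥ fun m' => g m') m =
      (if (m : ℕ) = 0 then 0 else g (m - 1)) + if (m : ℕ) = t then g (t + Φ - 1) else 0 := by
  simp only [mulVec, dotProduct, loopMatrix, of_apply, add_mul, Finset.sum_add_distrib, ite_mul,
    one_mul, zero_mul]
  rw [sum_fin_pred m.2.le]
  congr 1
  split_ifs
  · rw [sum_fin_pred le_rfl, if_neg (by omega)]
  · simp

theorem det_one_sub_loopMatrix (s : A) (t Φ : ℕ) (hΦ : 0 < Φ) :
    (1 - s • loopMatrix A t Φ).det = 1 - s ^ Φ := by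
  set T : Matrix (Fin (t + Φ)) (Fin (t + Φ)) A :=
    of fun m m' => (if m = m' then 1 else 0) - s * if (m' : ℕ) + 1 = m then 1 else 0 with hT
  set v : ℕ → A := fun m => if m < t then 0 else s ^ (m + 1 - t) with hv
  have hTdet : T.det = 1 := by
    rw [det_of_isLowerTriangular T]
    · simp [hT]
    · intro i j hij
      have hij' : (i : ℕ) < j := hij
      simp only [hT, of_apply]
      rw [if_neg (by rintro rfl; exact lt_irrefl _ hij'), if_neg (by omega)]
      simp
  -- The edge closing the loop is a rank one perturbation of the unitriangular matrix `T` of the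
  -- path. The vector `v` solves `T v = s e_t`, and the determinant is `1` minus its last entry.
  have hfac : 1 - s • loopMatrix A t Φ =
      T * (1 - replicateCol Unit (fun m : Fin (t + Φ) => v m) *
        replicateRow Unit (fun m : Fin (t + Φ) => if (m : ℕ) + 1 = t + Φ then (1 : A) else 0)) := by
    rw [mul_sub, mul_one, ← Matrix.mul_assoc, ← replicateCol_mulVec]
    have hTv : T *ᵥ (fun m : Fin (t + Φ) => v m) =
        fun m : Fin (t + Φ) => if (m : ℕ) = t then s else 0 := by
      ext m
      simp only [mulVec, dotProduct, hT, of_apply, sub_mul, Finset.sum_sub_distrib, ite_mul,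
        one_mul, zero_mul, mul_assoc, ← Finset.mul_sum]
      rw [Finset.sum_ite_eq, if_pos (Finset.mem_univ _), sum_fin_pred m.2.le]
      obtain ⟨m, hm⟩ := m
      simp only [hv]
      rcases lt_trichotomy m t with hmt | rfl | hmt
      · rw [if_pos hmt, if_neg hmt.ne, if_pos (show m - 1 < t by omega), ite_self]
        simp
      · rw [if_neg (lt_irrefl _), if_pos rfl]
        rcases Nat.eq_zero_or_pos m with rfl | hm0
        · simp
        · rw [if_neg hm0.ne', if_pos (by omega)]
          simp
      · rw [if_neg hmt.not_gt, if_neg (by omega), if_neg (by omega), if_neg hmt.ne',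
          show m + 1 - t = (m - 1 + 1 - t) + 1 by omega, pow_succ']
        ring
    rw [hTv]
    ext m m'
    simp only [Matrix.sub_apply, one_apply, Matrix.smul_apply, smul_eq_mul, loopMatrix, of_apply,
      hT, mul_apply, replicateCol_apply, replicateRow_apply, Finset.univ_unique,
      Finset.sum_singleton]
    split_ifs <;> ring
  rw [hfac, det_mul, hTdet, one_mul, det_one_sub_mul_comm, det_unique]
  simp only [Matrix.sub_apply, one_apply_eq, mul_apply, replicateCol_apply, replicateRow_apply,
    ite_mul, one_mul, zero_mul]
  rw [sum_fin_pred le_rfl, if_neg (by omega)]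
  simp only [hv]
  rw [if_neg (by omega), show t + Φ - 1 + 1 - t = Φ by omega]

/-- The generating function of the walks from `m` out of the loop. -/
def exitWeight (s g : A) (t m : ℕ) : A := if m < t then s ^ (m + 1) else g * s ^ (m + 1)

/-- First-step analysis in the loop; `g` is the geometric series `1 / (1 - s ^ Φ)` of the turns
around it. -/
theorem exitWeight_sub (s g : A) (t Φ : ℕ) (hΦ : 0 < Φ) (hg : g * (1 - s ^ Φ) = 1)
    (m : ℕ) :
    exitWeight s g t m - s * ((if m = 0 then 0 else exitWeight s g t (m - 1)) +
      if m = t then exitWeight s g t (t + Φ - 1) else 0) = if m = 0 then s else 0 := by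
  have hlast : exitWeight s g t (t + Φ - 1) = g * s ^ (t + Φ) := by
    rw [exitWeight, if_neg (by omega), Nat.sub_add_cancel (by omega)]
  rw [hlast]
  rcases lt_trichotomy m t with hmt | rfl | hmt
  · rw [if_neg hmt.ne, exitWeight, if_pos hmt]
    obtain _ | m := m
    · simp
    · simp only [Nat.succ_ne_zero, if_false, Nat.add_sub_cancel, exitWeight]
      rw [if_pos (by omega)]
      ring
  · rw [if_pos rfl, exitWeight, if_neg (lt_irrefl _)]
    obtain _ | m := m
    · simp only [if_true, zero_add]
      linear_combination s * hg
    · simp only [Nat.succ_ne_zero, if_false, Nat.add_sub_cancel, exitWeight]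
      rw [if_pos (by omega), pow_add s (m + 1) Φ]
      linear_combination s ^ (m + 2) * hg
  · rw [if_neg hmt.ne', exitWeight, if_neg hmt.not_gt]
    obtain _ | m := m
    · omega
    · simp only [Nat.succ_ne_zero, if_false, Nat.add_sub_cancel, exitWeight]
      rw [if_neg (by omega)]
      ring

theorem sum_fin_lt (k M : ℕ) (hk : k ≤ M) (x : A) :
    ∑ i : Fin M, (if (i : ℕ) < k then x else 0) = k * x := by
  rw [Fin.sum_univ_eq_sum_range (fun i => if i < k then x else 0), ← Finset.sum_filter,
    Finset.sum_const, nsmul_eq_mul]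
  congr 2
  rw [show Finset.filter (fun i => i < k) (Finset.range M) = Finset.range k by
    ext i
    simp only [Finset.mem_filter, Finset.mem_range]
    omega, Finset.card_range]

/-- Eliminating the auxiliary vertices by the column operation with `U` leaves the return matrix as
Schur complement, and each of the copies of the loop contributes a factor `1 - s ^ Φ`. -/
theorem det_one_sub_returnGraph (s g : A) (w : ι → ι → ℕ → ℕ) (t Φ M : ℕ) (hΦ : 0 < Φ)
    (hg : g * (1 - s ^ Φ) = 1) (hM : ∀ a b, ∀ m < t + Φ, w a b (m + 2) ≤ M) :
    (1 - s • returnGraph A w t Φ M).det =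
      (1 - of fun a b => s * (if w a b 1 = 1 then 1 else 0) +
        s * ∑ m ∈ Finset.range (t + Φ), w a b (m + 2) * exitWeight s g t m).det *
      (1 - s ^ Φ) ^ Fintype.card (ι × Fin M) := by
  set U : Matrix (Fin (t + Φ) × (ι × Fin M)) ι A :=
    of fun x b => if x.2.1 = b then exitWeight s g t x.1 else 0 with hU
  set P : Matrix ι ι A := of fun a b => if w a b 1 = 1 then 1 else 0 with hP
  set Q : Matrix ι (Fin (t + Φ) × (ι × Fin M)) A :=
    of fun a x => if (x.2.2 : ℕ) < w a x.2.1 (x.1 + 2) then 1 else 0 with hQ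
  set R : Matrix (Fin (t + Φ) × (ι × Fin M)) ι A :=
    of fun x b => if (x.1 : ℕ) = 0 ∧ x.2.1 = b then 1 else 0 with hR
  set D : Matrix (Fin (t + Φ) × (ι × Fin M)) (Fin (t + Φ) × (ι × Fin M)) A :=
    blockDiagonal fun _ => loopMatrix A t Φ with hD
  have hblock : 1 - s • returnGraph A w t Φ M =
      fromBlocks (1 - s • P) (-(s • Q)) (-(s • R)) (1 - s • D) := by
    rw [returnGraph, ← fromBlocks_one, fromBlocks_smul, sub_eq_add_neg, fromBlocks_neg,
      fromBlocks_add, zero_add, zero_add, ← sub_eq_add_neg, ← sub_eq_add_neg]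
  have hDU : -(s • R) + (1 - s • D) * U = 0 := by
    ext x b
    obtain ⟨m, c, i⟩ := x
    have h1 : (D * U) (m, c, i) b = if c = b then
        (loopMatrix A t Φ *ᵥ fun m' => exitWeight s g t m') m else 0 := by
      rw [mul_apply, Fintype.sum_prod_type_right,
        Finset.sum_eq_single_of_mem (c, i) (Finset.mem_univ _)]
      · simp only [hD, hU, blockDiagonal_apply_eq, of_apply, mulVec, dotProduct]
        split_ifs <;> simp
      · intro k _ hk
        simp only [hD, blockDiagonal_apply_ne _ _ _ hk.symm, zero_mul, Finset.sum_const_zero]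
    rw [Matrix.sub_mul, Matrix.one_mul, Matrix.smul_mul, Matrix.add_apply, Matrix.neg_apply,
      Matrix.smul_apply,
      Matrix.sub_apply, Matrix.smul_apply, h1, loopMatrix_mulVec _ _ _ _ hΦ]
    have := exitWeight_sub s g t Φ hΦ hg m
    simp only [hR, hU, of_apply, smul_eq_mul, Matrix.zero_apply]
    by_cases hcb : c = b
    · simp only [hcb, and_true, if_true]
      rw [this]
      split_ifs <;> simp
    · simp [hcb]
  have hQU : 1 - s • P + -(s • Q) * U = 1 - of fun a b => s * (if w a b 1 = 1 then 1 else 0) +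
        s * ∑ m ∈ Finset.range (t + Φ), w a b (m + 2) * exitWeight s g t m := by
    ext a b
    have h1 : (Q * U) a b =
        ∑ m ∈ Finset.range (t + Φ), w a b (m + 2) * exitWeight s g t m := by
      rw [mul_apply, Fintype.sum_prod_type, ← Fin.sum_univ_eq_sum_range
        (fun m => (w a b (m + 2) : A) * exitWeight s g t m)]
      refine Finset.sum_congr rfl fun m _ => ?_
      rw [Fintype.sum_prod_type, Finset.sum_eq_single_of_mem b (Finset.mem_univ _)]
      · rw [← sum_fin_lt _ M (hM a b m m.2)]
        refine Finset.sum_congr rfl fun i _ => ?_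
        simp [hQ, hU]
      · intro c _ hc
        simp [hU, hc]
    rw [Matrix.neg_mul, Matrix.smul_mul, Matrix.add_apply, Matrix.neg_apply, Matrix.smul_apply, h1,
      Matrix.sub_apply, Matrix.sub_apply, Matrix.smul_apply]
    simp only [hP, of_apply, smul_eq_mul]
    ring
  have hmul : fromBlocks (1 - s • P) (-(s • Q)) (-(s • R)) (1 - s • D) * fromBlocks 1 0 U 1 =
      fromBlocks (1 - s • P + -(s • Q) * U) (-(s • Q)) 0 (1 - s • D) := by
    rw [fromBlocks_multiply, Matrix.mul_one, Matrix.mul_one, Matrix.mul_zero, Matrix.mul_zero,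
      zero_add, zero_add, Matrix.mul_one, Matrix.mul_one, hDU]
  have hDdet : (1 - s • D).det = (1 - s ^ Φ) ^ Fintype.card (ι × Fin M) := by
    have : 1 - s • D = blockDiagonal fun _ : ι × Fin M => 1 - s • loopMatrix A t Φ := by
      rw [hD, ← blockDiagonal_one, ← blockDiagonal_smul, ← blockDiagonal_sub]
      rfl
    rw [this, det_blockDiagonal]
    simp only [det_one_sub_loopMatrix s t Φ hΦ]
    rw [Finset.prod_const, Finset.card_univ]
  have h := congrArg det hmul
  rw [det_mul, det_fromBlocks_zero₁₂, det_one, det_one, one_mul, mul_one, ← hblock,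
    det_fromBlocks_zero₂₁, hQU, hDdet] at h
  exact h

end Graph

open PowerSeries

theorem mk_eq_sum_add (p : ℕ → ℚ) (k : ℕ) :
    (mk p : ℚ⟦X⟧) = (∑ i ∈ Finset.range k, C (p i) * X ^ i) + X ^ k * mk fun i => p (i + k) := by
  induction k with
  | zero => simp
  | succ k ih =>
    have h1 : (mk fun i => p (i + k) : ℚ⟦X⟧) = C (p k) + X * mk fun i => p (i + (k + 1)) := by
      ext n
      obtain _ | n := n
      · simp
      · rw [coeff_mk, map_add, coeff_succ_X_mul, coeff_mk, coeff_C, if_neg n.succ_ne_zero, zero_add,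
          Nat.add_right_comm, Nat.add_assoc]
    rw [ih, h1, Finset.sum_range_succ]
    ring

/-- The generating function of an eventually periodic sequence. -/
theorem mk_eq_of_eventually_periodic (p : ℕ → ℕ) (g : ℚ⟦X⟧) (t Φ : ℕ)
    (hg : g * (1 - X ^ Φ) = 1) (h0 : p 0 = 0) (h1 : p 1 ≤ 1)
    (hp : ∀ n ≥ t, p (n + Φ) = p n) :
    (mk fun n => (p n : ℚ)) = X * (if p 1 = 1 then 1 else 0) +
      X * ∑ m ∈ Finset.range (t + Φ), (p (m + 2) : ℚ⟦X⟧) * exitWeight X g t m := by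
  -- The tail starts at `2 + t`, since times `0` and `1` are not produced by the auxiliary vertices.
  have hper : (mk fun i => (p (i + (2 + t)) : ℚ) : ℚ⟦X⟧) =
      g * ∑ i ∈ Finset.range Φ, C (p (i + (2 + t)) : ℚ) * X ^ i := by
    have h := mk_eq_sum_add (fun i => (p (i + (2 + t)) : ℚ)) Φ
    have hs : ∀ i, p (i + Φ + (2 + t)) = p (i + (2 + t)) := fun i => by
      rw [Nat.add_right_comm]
      exact hp _ (by omega)
    simp only [hs] at h
    linear_combination g * h - (mk fun i => (p (i + (2 + t)) : ℚ)) * hg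
  rw [mk_eq_sum_add _ (2 + t), hper, Finset.sum_range_add, Finset.sum_range_add,
    Finset.sum_range_succ, Finset.sum_range_one, h0, add_assoc]
  congr 1
  · rcases Nat.le_one_iff_eq_zero_or_eq_one.1 h1 with h | h <;> simp [h]
  · rw [mul_add]
    congr 1
    · rw [Finset.mul_sum]
      refine Finset.sum_congr rfl fun i hi => ?_
      rw [exitWeight, if_pos (Finset.mem_range.1 hi), map_natCast, Nat.add_comm 2 i]
      ring
    · rw [Finset.mul_sum, Finset.mul_sum, Finset.mul_sum]
      refine Finset.sum_congr rfl fun i _ => ?_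
      rw [exitWeight, if_neg (by omega), map_natCast, show i + (2 + t) = t + i + 2 by omega]
      ring

end NonarchDyn

end
-- Cyclotomic numerators and the subshift of finite type.
noncomputable section

namespace NonarchDyn

open Polynomial

/-- `toSeries` as a ring homomorphism. -/
def toSeriesHom : ℤ[X] →+* PowerSeries ℚ :=
  Polynomial.coeToPowerSeries.ringHom.comp (Polynomial.mapRingHom (Int.castRingHom ℚ))

theorem toSeriesHom_apply (P : ℤ[X]) : toSeriesHom P = toSeries P := rfl

theorem toSeriesHom_X : toSeriesHom X = PowerSeries.X := by
  simp [toSeriesHom]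

theorem toSeriesHom_injective : Function.Injective toSeriesHom :=
  (Polynomial.coe_injective ℚ).comp (Polynomial.map_injective _ Int.cast_injective)

/-- `1 - X ^ n` is a product of cyclotomic polynomials up to sign. -/
theorem prod_one_sub_X_pow {ι : Type*} (s : Finset ι) (l : ι → ℕ) (hl : ∀ i ∈ s, 0 < l i) :
    ∃ (u : ℤ[X]ˣ) (t : Multiset ℕ), (∀ n ∈ t, 0 < n) ∧
      ∏ i ∈ s, (1 - X ^ l i : ℤ[X]) = u * (t.map fun n => cyclotomic n ℤ).prod := by
  classical
  refine ⟨(-1) ^ s.card, ∑ i ∈ s, (l i).divisors.val, fun n hn => ?_, ?_⟩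
  · obtain ⟨i, -, hi⟩ := Multiset.mem_sum.1 hn
    exact Nat.pos_of_mem_divisors hi
  · have hmap : (∑ i ∈ s, (l i).divisors.val).map (fun n => cyclotomic n ℤ) =
        ∑ i ∈ s, (l i).divisors.val.map fun n => cyclotomic n ℤ :=
      map_sum (Multiset.mapAddMonoidHom fun n => cyclotomic n ℤ) _ _
    rw [hmap, Multiset.prod_sum, Units.val_pow_eq_pow_val, Units.val_neg,
      Units.val_one, ← Finset.prod_const, ← Finset.prod_mul_distrib]
    refine Finset.prod_congr rfl fun i hi => ?_
    rw [show ((l i).divisors.val.map fun n => cyclotomic n ℤ).prod =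
      ∏ n ∈ (l i).divisors, cyclotomic n ℤ from rfl, prod_cyclotomic_eq_X_pow_sub_one (hl i hi)]
    ring

/-- A fraction with a product of cyclotomic polynomials as its numerator can be reduced. -/
theorem exists_isRelPrime_of_mul_eq {Z : PowerSeries ℚ} (t : Multiset ℕ) (ht : ∀ n ∈ t, 0 < n)
    (Q : ℤ[X]) (h : Z * toSeriesHom Q = toSeriesHom (t.map fun n => cyclotomic n ℤ).prod) :
    ∃ P Q : ℤ[X], IsRelPrime P Q ∧ Q ≠ 0 ∧
      (∃ s : Multiset ℕ, (∀ n ∈ s, 0 < n) ∧ P = (s.map fun n => cyclotomic n ℤ).prod) ∧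
      Z * toSeries Q = toSeries P := by
  induction hk : t.card generalizing t Q with
  | zero =>
    rw [Multiset.card_eq_zero] at hk
    subst hk
    refine ⟨1, Q, isRelPrime_one_left, ?_, ⟨0, by simp, by simp⟩, by simpa [toSeriesHom_apply] using h⟩
    rintro rfl
    simp at h
  | succ k ih =>
    -- Cancel common cyclotomic factors one at a time; they are irreducible, so coprimality holds
    -- once none divides `Q`.
    by_cases hdvd : ∃ n ∈ t, cyclotomic n ℤ ∣ Q
    · obtain ⟨n, hn, Q', rfl⟩ := hdvd
      obtain ⟨t', rfl⟩ := Multiset.exists_cons_of_mem hn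
      refine ih t' (fun m hm => ht m (Multiset.mem_cons_of_mem hm)) Q' ?_ (by simpa using hk)
      have hne : toSeriesHom (cyclotomic n ℤ) ≠ 0 :=
        (map_ne_zero_iff _ toSeriesHom_injective).2 (cyclotomic_ne_zero n ℤ)
      refine mul_left_cancel₀ hne ?_
      rw [Multiset.map_cons, Multiset.prod_cons, map_mul, map_mul] at h
      rw [← h]
      ring
    · push Not at hdvd
      refine ⟨_, Q, ?_, ?_, ⟨t, ht, rfl⟩, h⟩
      · have hrel : ∀ p ∈ t.map fun n => cyclotomic n ℤ, IsRelPrime p Q := by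
          intro p hp
          obtain ⟨n, hn, rfl⟩ := Multiset.mem_map.1 hp
          exact (cyclotomic.irreducible (ht n hn)).isRelPrime_iff_not_dvd.2 (hdvd n hn)
        generalize t.map (fun n => cyclotomic n ℤ) = u at hrel
        induction u using Multiset.induction_on with
        | empty => exact isRelPrime_one_left
        | cons p u ihu =>
          rw [Multiset.prod_cons]
          exact IsRelPrime.mul_left (hrel p (Multiset.mem_cons_self p u))
            (ihu fun q hq => hrel q (Multiset.mem_cons_of_mem hq))
      · rintro rfl
        obtain ⟨n, hn⟩ := Multiset.card_pos_iff_exists_mem.1 (hk.symm ▸ k.succ_pos : 0 < t.card)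
        exact hdvd n hn (dvd_zero _)

theorem exists_isRelPrime_of_mul_eq_prod {Z : PowerSeries ℚ} {ι : Type*} (s : Finset ι)
    (l : ι → ℕ) (hl : ∀ i ∈ s, 0 < l i) (Q : ℤ[X])
    (h : Z * toSeries Q = toSeries (∏ i ∈ s, (1 - X ^ l i))) :
    ∃ P Q : ℤ[X], IsRelPrime P Q ∧ Q ≠ 0 ∧
      (∃ s : Multiset ℕ, (∀ n ∈ s, 0 < n) ∧ P = (s.map fun n => cyclotomic n ℤ).prod) ∧
      Z * toSeries Q = toSeries P := by
  obtain ⟨u, t, ht, hu⟩ := prod_one_sub_X_pow s l hl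
  -- The sign of the numerator is moved into the denominator.
  refine exists_isRelPrime_of_mul_eq t ht (↑u⁻¹ * Q) ?_
  have h' : Z * toSeriesHom Q = toSeriesHom (∏ i ∈ s, (1 - X ^ l i)) := h
  rw [map_mul, mul_left_comm, h', hu, ← map_mul, Units.inv_mul_cancel_left]

section Shift

theorem shift_iterate {S : Type*} (a : ℕ → S) (i : ℕ) : shift^[i] a = fun n => a (n + i) := by
  induction i with
  | zero => rfl
  | succ i ih =>
    rw [Function.iterate_succ_apply', ih]
    funext n
    simp only [shift]
    congr 1
    omega

theorem minimalPeriod_shift {S : Type*} (a : ℕ → S) (Φ : ℕ) (hΦ : 0 < Φ)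
    (ha : ∀ i j, a i = a j ↔ i % Φ = j % Φ) :
    a ∈ Function.periodicPts (shift (S := S)) ∧
      Function.minimalPeriod (shift (S := S)) a = Φ := by
  have hper : Function.IsPeriodicPt (shift (S := S)) Φ a := by
    show shift^[Φ] a = a
    rw [shift_iterate]
    funext n
    rw [ha, Nat.add_mod_right]
  have hmem : a ∈ Function.periodicPts (shift (S := S)) := ⟨Φ, hΦ, hper⟩
  refine ⟨hmem, le_antisymm (hper.minimalPeriod_le hΦ) (Nat.le_of_dvd
    (Function.minimalPeriod_pos_of_mem_periodicPts hmem) (Nat.dvd_of_mod_eq_zero ?_))⟩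
  have h0 := congrFun (Function.isPeriodicPt_minimalPeriod (shift (S := S)) a).eq 0
  rw [shift_iterate, ha, zero_add, Nat.zero_mod] at h0
  exact h0

end Shift

open Matrix in
/-- A zeta function with eventually periodic first return numbers comes from a subshift of finite
type. -/
theorem exists_subshift {ι : Type*} [DecidableEq ι] [Fintype ι]
    (w c : ι → ι → ℕ → ℕ) (n : ℕ → ℕ) (t Φ : ℕ) (hΦ : 0 < Φ) (hw : ∀ a b, w a b 0 = 0)
    (hw1 : ∀ a b, w a b 1 ≤ 1) (hper : ∀ a b, ∀ m ≥ t, w a b (m + Φ) = w a b m)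
    (hc0 : ∀ a b, c a b 0 = if a = b then 1 else 0)
    (hc : ∀ a b m, 1 ≤ m → c a b m =
      ∑ p ∈ Finset.HasAntidiagonal.antidiagonal m, ∑ e, w a e p.1 * c e b p.2)
    (hn : ∀ m, 1 ≤ m → n m =
      ∑ p ∈ Finset.HasAntidiagonal.antidiagonal m, ∑ a, ∑ e, p.1 * (w a e p.1 * c e a p.2)) :
    ∃ (k : ℕ) (B : Matrix (Fin k) (Fin k) ℤ) (m₀ : ℕ) (β : Fin m₀ → ℕ → Fin k),
      (∀ i j, B i j = 0 ∨ B i j = 1) ∧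
      (∀ m, β m ∈ subshift B ∧ β m ∈ Function.periodicPts (shift (S := Fin k))) ∧
      (∀ m m', m ≠ m' → ∀ i : ℕ, shift^[i] (β m) ≠ β m') ∧
      (PowerSeries.exp ℚ).subst
          (PowerSeries.mk fun m : ℕ => if m = 0 then (0 : ℚ) else (n m : ℚ) / m) *
        toSeries (1 - (X : ℤ[X]) • B.map C).det =
        toSeries (∏ m, (1 - X ^ Function.minimalPeriod (shift (S := Fin k)) (β m))) := by
  classical
  -- The largest multiplicity to be realised: each target has `M` copies of the loop, of which an
  -- entry uses as many as it needs.
  set M := Finset.univ.sup fun x : ι × ι × Fin (t + Φ) => w x.1 x.2.1 (x.2.2 + 2) with hMdef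
  have hM : ∀ a b, ∀ m < t + Φ, w a b (m + 2) ≤ M := fun a b m hm =>
    Finset.le_sup (f := fun x : ι × ι × Fin (t + Φ) => w x.1 x.2.1 (x.2.2 + 2))
      (Finset.mem_univ (a, b, (⟨m, hm⟩ : Fin (t + Φ))))
  set e := Fintype.equivFin (ι ⊕ (Fin (t + Φ) × (ι × Fin M))) with he
  set eJ := Fintype.equivFin (ι × Fin M) with heJ
  have hlt : ∀ i, t + (Φ - 1 - i % Φ) < t + Φ := fun i => by omega
  -- Each copy has one cycle, run downwards from `t + Φ - 1` to `t` and then back up.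
  set β : Fin (Fintype.card (ι × Fin M)) → ℕ → Fin (Fintype.card
      (ι ⊕ (Fin (t + Φ) × (ι × Fin M)))) := fun m i =>
    e (Sum.inr (⟨t + (Φ - 1 - i % Φ), hlt i⟩, eJ.symm m)) with hβ
  have hβ_iff : ∀ m i j, β m i = β m j ↔ i % Φ = j % Φ := fun m i j => by
    have h1 := Nat.mod_lt i hΦ
    have h2 := Nat.mod_lt j hΦ
    simp only [hβ, e.injective.eq_iff, Sum.inr.injEq, Prod.mk.injEq, Fin.mk.injEq, and_true]
    omega
  refine ⟨_, (returnGraph ℤ w t Φ M).submatrix e.symm e.symm, _, β, fun i j => ?_, fun m =>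
    ⟨fun i => ?_, (minimalPeriod_shift _ Φ hΦ (hβ_iff m)).1⟩, fun m m' hm i hi => ?_, ?_⟩
  · rw [submatrix_apply]
    obtain a | ⟨m, k⟩ := e.symm i <;> obtain b | ⟨m', k'⟩ := e.symm j
    · simp only [returnGraph, fromBlocks_apply₁₁, of_apply]
      split_ifs <;> simp
    · simp only [returnGraph, fromBlocks_apply₁₂, of_apply]
      split_ifs <;> simp
    · simp only [returnGraph, fromBlocks_apply₂₁, of_apply]
      split_ifs <;> simp
    · simp only [returnGraph, fromBlocks_apply₂₂, blockDiagonal_apply, loopMatrix, of_apply]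
      split_ifs <;> omega
  · have hmod : (i + 1) % Φ = (i % Φ + 1) % Φ := (Nat.mod_add_mod i Φ 1).symm
    have h1 := Nat.mod_lt i hΦ
    rw [submatrix_apply]
    simp only [hβ, Equiv.symm_apply_apply, returnGraph, fromBlocks_apply₂₂,
      blockDiagonal_apply_eq, loopMatrix, of_apply]
    rcases Nat.lt_or_ge (i % Φ + 1) Φ with h2 | h2
    · rw [Nat.mod_eq_of_lt h2] at hmod
      rw [if_pos (by omega), if_neg (by omega), add_zero]
    · rw [show i % Φ + 1 = Φ by omega, Nat.mod_self] at hmod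
      rw [if_neg (by omega), if_pos (by omega), if_pos (by omega), zero_add]
  · have h0 := congrFun hi 0
    rw [shift_iterate] at h0
    simp only [hβ, e.injective.eq_iff, Sum.inr.injEq, Prod.mk.injEq, eJ.symm.injective.eq_iff] at h0
    exact hm h0.2
  · have hZ := exp_subst_mul_det_of_count w c n hw hc0 hc hn
    have hΦs : PowerSeries.constantCoeff (1 - PowerSeries.X ^ Φ : PowerSeries ℚ) ≠ 0 := by
      simp [hΦ.ne']
    have hg := PowerSeries.inv_mul_cancel _ hΦs
    have hdet : toSeries (1 - (X : ℤ[X]) • ((returnGraph ℤ w t Φ M).submatrix e.symm e.symm).map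
        C).det = (1 - (PowerSeries.X : PowerSeries ℚ) •
          returnGraph (PowerSeries ℚ) w t Φ M).det := by
      rw [← toSeriesHom_apply, RingHom.map_det, map_sub, map_one, ← det_submatrix_equiv_self e.symm
        (1 - (PowerSeries.X : PowerSeries ℚ) • returnGraph (PowerSeries ℚ) w t Φ M),
        submatrix_sub, Pi.sub_apply, Pi.sub_apply, submatrix_one_equiv, ← returnGraph_map (Int.castRingHom (PowerSeries ℚ))]
      congr 2
      ext1 i j
      simp only [RingHom.mapMatrix_apply, map_apply, Matrix.smul_apply, submatrix_apply,
        smul_eq_mul, map_mul, toSeriesHom_X]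
      congr 1
      exact RingHom.congr_fun (RingHom.ext_int (toSeriesHom.comp C) _) _
    have hW : (Matrix.of fun a b => PowerSeries.mk fun m => (w a b m : ℚ)) =
        Matrix.of fun a b => PowerSeries.X * (if w a b 1 = 1 then 1 else 0) +
        PowerSeries.X * ∑ m ∈ Finset.range (t + Φ), (w a b (m + 2) : PowerSeries ℚ) *
          exitWeight PowerSeries.X (1 - PowerSeries.X ^ Φ : PowerSeries ℚ)⁻¹ t m := by
      ext1 a b
      exact mk_eq_of_eventually_periodic _ _ t Φ hg (hw a b) (hw1 a b) (hper a b)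
    -- The factor `det (1 - W)` cancels against the zeta function; only the loop factors remain.
    rw [hdet, det_one_sub_returnGraph _ _ w t Φ M hΦ hg hM, ← hW, ← mul_assoc, hZ, one_mul]
    simp only [(minimalPeriod_shift _ Φ hΦ (hβ_iff _)).2]
    rw [Finset.prod_const, Finset.card_univ, Fintype.card_fin, ← toSeriesHom_apply, map_pow,
      map_sub, map_pow, map_one, toSeriesHom_X]

end NonarchDyn

end
-- Assembly.
noncomputable section

namespace NonarchDyn

open Polynomial (C)

variable {X : Type*} [MetricSpace X] [IsUltrametricDist X] {f : X → X}

theorem sum_antidiagonal_eq_sum_Icc {F : ℕ → ℕ → ℕ} {m : ℕ} (h0 : F 0 m = 0) :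
    ∑ p ∈ Finset.HasAntidiagonal.antidiagonal m, F p.1 p.2 =
      ∑ n ∈ Finset.Icc 1 m, F n (m - n) := by
  rw [Finset.Nat.sum_antidiagonal_eq_sum_range_succ F, Finset.sum_range_succ', Nat.sub_zero, h0,
    add_zero, ← Finset.sum_image (g := fun i => i + 1) (f := fun n => F n (m - n))
      fun _ _ _ _ h => Nat.succ_injective h]
  refine Finset.sum_congr ?_ fun _ _ => rfl
  ext i
  simp only [Finset.mem_image, Finset.mem_range, Finset.mem_Icc]
  exact ⟨fun ⟨j, hj, he⟩ => by omega, fun h => ⟨i - 1, by omega, by omega⟩⟩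

/-- The states are the cells outside `N` together with the zeros of the radius. The latter form a
separate block carrying the periodic points that the cells do not see. -/
theorem IsTame.exists_subshift (h : IsTame f) (hhom : HomogeneousCondition f) :
    ∃ (k : ℕ) (B : Matrix (Fin k) (Fin k) ℤ) (m₀ : ℕ) (β : Fin m₀ → ℕ → Fin k),
      (∀ i j, B i j = 0 ∨ B i j = 1) ∧
      (∀ m, β m ∈ subshift B ∧ β m ∈ Function.periodicPts (shift (S := Fin k))) ∧
      (∀ m m', m ≠ m' → ∀ i : ℕ, shift^[i] (β m) ≠ β m') ∧
      zeta f * toSeries (1 - (Polynomial.X : Polynomial ℤ) • B.map C).det =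
        toSeries (∏ m, (1 - Polynomial.X ^ Function.minimalPeriod (shift (S := Fin k)) (β m))) := by
  classical
  obtain ⟨r, N, R⟩ := h.exists_isMarkovRadius
  obtain ⟨Φ, t, hΦ, hper⟩ := R.exists_period h hhom
  set Z := R.finite_zero.toFinset with hZdef
  have hZ : ∀ z, z ∈ Z ↔ z ∈ coreJulia f ∧ r z = 0 := fun z => Set.Finite.mem_toFinset _
  let fZ : Z → Z := fun z => ⟨f z, (hZ _).2 ⟨h.map_mem ((hZ _).1 z.2).1,
    R.zero_map _ ((hZ _).1 z.2).1 ((hZ _).1 z.2).2⟩⟩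
  let w : (R.cells h ⊕ Z) → (R.cells h ⊕ Z) → ℕ → ℕ := fun
    | .inl a, .inl b, n => (returnSet f r N (a : X) b n).ncard
    | .inr z, .inr z', n => if n = 1 then (if fZ z = z' then 1 else 0) else 0
    | .inl _, .inr _, _ => 0
    | .inr _, .inl _, _ => 0
  let c : (R.cells h ⊕ Z) → (R.cells h ⊕ Z) → ℕ → ℕ := fun
    | .inl a, .inl b, m => (transitSet f r (a : X) b m).ncard
    | .inr z, .inr z', m => if f^[m] (z : X) = z' then 1 else 0
    | .inl _, .inr _, _ => 0
    | .inr _, .inl _, _ => 0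
  have hw : ∀ a b, w a b 0 = 0 := by
    rintro (a | a) (b | b)
    · simp only [w, IsMarkovRadius.returnSet_zero, Set.ncard_empty]
    all_goals rfl
  -- From time `2` on the zeros have no first returns, so starting the period at `max t 2` suits
  -- both blocks.
  refine NonarchDyn.exists_subshift w c (fun m => (fixStar f m).ncard) (max t 2) Φ hΦ hw ?_ ?_ ?_
    ?_ ?_
  · rintro (a | a) (b | b)
    · exact R.ncard_returnSet_one_le h a.2
    · exact Nat.zero_le _
    · exact Nat.zero_le _
    · simp only [w, if_true]
      split_ifs <;> simp
  · rintro (a | a) (b | b) m hm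
    · exact hper a a.2 b b.2 m ((le_max_left _ _).trans hm)
    · rfl
    · rfl
    · have := (le_max_right t 2).trans hm
      simp only [w]
      rw [if_neg (by omega), if_neg (by omega)]
  · rintro (a | a) (b | b)
    · simp only [c, R.ncard_transitSet_zero h a.2 b.2, Sum.inl.injEq, Subtype.ext_iff]
    · simp [c]
    · simp [c]
    · exact if_congr (by rw [Sum.inr.injEq, Subtype.ext_iff]; rfl) rfl rfl
  · intro a b m hm
    rw [sum_antidiagonal_eq_sum_Icc (F := fun i j => ∑ e, w a e i * c e b j) (by simp [hw])]
    simp only [Fintype.sum_sum_type]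
    obtain a | a := a <;> obtain b | b := b
    · simp only [w, c, zero_mul, Finset.sum_const_zero, add_zero]
      rw [R.ncard_transitSet_eq h a.2 b.2 hm]
      refine Finset.sum_congr rfl fun n _ => (Finset.sum_coe_sort (R.cells h) fun e =>
        (returnSet f r N (a : X) e n).ncard * (transitSet f r e (b : X) (m - n)).ncard).symm
    · simp [w, c]
    · simp [w, c]
    · simp only [w, c, zero_mul, Finset.sum_const_zero, zero_add]
      rw [Finset.sum_eq_single_of_mem 1 (Finset.mem_Icc.2 ⟨le_rfl, hm⟩)
        fun n _ hn => by simp [hn]]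
      obtain ⟨k, rfl⟩ := Nat.exists_eq_add_of_le' hm
      simp only [if_true, ite_mul, one_mul, zero_mul, Finset.sum_ite_eq, Finset.mem_univ,
        Nat.add_sub_cancel]
      rfl
  · intro m hm
    rw [sum_antidiagonal_eq_sum_Icc (F := fun i j => ∑ a, ∑ e, i * (w a e i * c e a j)) (by simp)]
    have hsplit : (fixStar f m).ncard = {x | x ∈ coreJulia f ∧ r x ≠ 0 ∧ f^[m] x = x}.ncard +
        (Z.filter fun z => f^[m] z = z).card := by
      have hfin := finite_fixStar h.cont h.reg h.subhyp h.normal h.compact hm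
      rw [fixStar_eq h.cont h.reg h.subhyp h.normal hm] at hfin ⊢
      rw [← Set.ncard_coe_finset, ← Set.ncard_union_eq _ (hfin.subset fun x hx => ⟨hx.1, hx.2.2⟩)
        (Finset.finite_toSet _)]
      · congr 1
        ext x
        simp only [Set.mem_ofPred_eq, Set.mem_union, Finset.coe_filter, hZ]
        tauto
      · rw [Set.disjoint_left]
        rintro x ⟨-, hx, -⟩ hx'
        exact hx ((hZ x).1 (Finset.mem_filter.1 hx').1).2
    simp only [Fintype.sum_sum_type, Finset.sum_add_distrib]
    rw [hsplit, R.ncard_periodic_eq h hm]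
    simp only [w, c, mul_zero, Finset.sum_const_zero, add_zero, zero_add]
    congr 1
    · refine Finset.sum_congr rfl fun n hn => ?_
      rw [← Finset.sum_coe_sort (R.cells h)]
      refine Finset.sum_congr rfl fun a _ => ?_
      rw [R.ncard_transit_return h a.2 (Finset.mem_Icc.1 hn).2, Finset.mul_sum,
        ← Finset.sum_coe_sort (R.cells h)]
    · rw [Finset.sum_eq_single_of_mem 1 (Finset.mem_Icc.2 ⟨le_rfl, hm⟩)
        fun n _ hn => by simp [hn]]
      obtain ⟨k, rfl⟩ := Nat.exists_eq_add_of_le' hm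
      simp only [if_true, one_mul, ite_mul, zero_mul, Finset.sum_ite_eq, Finset.mem_univ,
        Nat.add_sub_cancel]
      rw [Finset.card_filter, ← Finset.sum_coe_sort Z]
      rfl

end NonarchDyn

end
theorem mainTheorem3 {X : Type*} [MetricSpace X] [IsUltrametricDist X] [CompleteSpace X]
    (f : X → X) (hf : Continuous f) (hsub : NonarchDyn.IsSubhyperbolic f)
    (hJ : IsCompact (NonarchDyn.juliaSet f))
    (hnormal : ∀ x ∈ NonarchDyn.singularSet f, NonarchDyn.IsNormalPoint f x)
    (hhom : NonarchDyn.HomogeneousCondition f) :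
    (∀ n : ℕ, 1 ≤ n → (NonarchDyn.fixStar f n).Finite) ∧
    (∃ P Q : Polynomial ℤ,
      IsRelPrime P Q ∧ Q ≠ 0 ∧
      (∃ s : Multiset ℕ, (∀ n ∈ s, 0 < n) ∧
        P = (s.map fun n => Polynomial.cyclotomic n ℤ).prod) ∧
      NonarchDyn.zeta f * NonarchDyn.toSeries Q = NonarchDyn.toSeries P) ∧
    (∃ (k : ℕ) (B : Matrix (Fin k) (Fin k) ℤ) (m₀ : ℕ) (β : Fin m₀ → ℕ → Fin k),
      (∀ i j, B i j = 0 ∨ B i j = 1) ∧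
      (∀ m, β m ∈ NonarchDyn.subshift B ∧
        β m ∈ Function.periodicPts (NonarchDyn.shift (S := Fin k))) ∧
      (∀ m m', m ≠ m' → ∀ i : ℕ, NonarchDyn.shift^[i] (β m) ≠ β m') ∧
      NonarchDyn.zeta f * NonarchDyn.toSeries
          (1 - (Polynomial.X : Polynomial ℤ) • B.map Polynomial.C).det =
        NonarchDyn.toSeries
          (∏ m, (1 - Polynomial.X ^
            Function.minimalPeriod (NonarchDyn.shift (S := Fin k)) (β m)))) := by
  have hreg : ∀ x ∈ NonarchDyn.singularSet f, x ∉ NonarchDyn.repellingPoints f :=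
    fun x hx => NonarchDyn.singularSet_disjoint_repellingPoints hhom hx
  have h : NonarchDyn.IsTame f := ⟨hf, hsub, hJ, hnormal, hreg⟩
  obtain ⟨k, B, m₀, β, hB, hβ, hne, hz⟩ := h.exists_subshift hhom
  exact ⟨fun n hn => NonarchDyn.finite_fixStar hf hreg hsub hnormal hJ hn,
    NonarchDyn.exists_isRelPrime_of_mul_eq_prod Finset.univ _
      (fun m _ => Function.minimalPeriod_pos_of_mem_periodicPts (hβ m).2) _ hz,
    k, B, m₀, β, hB, hβ, hne, hz⟩
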